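/- Let $\mathbb D=\{z\in\mathbb C:|z|<1\}$, let $H(\mathbb D)$ be the space of analytic functions on $\mathbb D$, and let $dA$ be the normalized area measure on $\mathbb D$. Let $n\in\mathbb N_0$, $p>0$, $q>-2$, $\gamma=\frac{q+2}{p}$, and assume that $p\neq q+2$ if $n=0$ (i.e. $\gamma+n-1\ne 0$). Let $K:[0,\infty)\to[0,\infty)$ be nondecreasing and continuous with $$\int_0^1(1-r^2)^qK(-\log r)\,r\,dr<\infty,\qquad \int_0^1K(-\log r)(1-r)^{\min\{-1,q\}}\Big(\log\frac1{1-r}\Big)^{\chi}r\,dr<\infty,$$ where $\chi=1$ if $q=-1$ and $\chi=0$ otherwise. The space $\mathcal Q_K(p,q)$ consists of all $f\in H(\mathbb D)$ with $$\|f\|_{\mathcal Q_K(p,q)}=|f(0)|+\Big(\sup_{\xi\in\mathbb D}\int_{\mathbb D}|f'(z)|^p(1-|z|^2)^qK\Big(\log\Big|\frac{1-\bar\xi z}{\xi-z}\Big|\Big)\,dA(z)\Big)^{1/p}<\infty .$$ A positive continuous function $\mu$ on $[0,1)$ is called normal if there are $b>a>0$ and $\delta\in[0,1)$ such that, on $[\delta,1)$,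 $\mu(r)/(1-r)^a$ is decreasing with limit $0$ and $\mu(r)/(1-r)^b$ is increasing with limit $\infty$ as $r\to1$. For such $\mu$ put $\mu(z)=\mu(|z|)$, and let $\mathcal B_\mu$ be the space of all $f\in H(\mathbb D)$ with $\|f\|_{\mathcal B_\mu}=|f(0)|+\sup_{z\in\mathbb D}\mu(z)|f'(z)|<\infty$. For $\psi_1,\psi_2\in H(\mathbb D)$ and an analytic map $\varphi:\mathbb D\to\mathbb D$ let $$(T^n_{\psi_1,\psi_2,\varphi}f)(z)=\psi_1(z)f^{(n)}(\varphi(z))+\psi_2(z)f^{(n+1)}(\varphi(z)).$$ The essential norm $\|T\|_e$ of a bounded operator $T:\mathcal Q_K(p,q)\to\mathcal B_\mu$ is the infimum over all compact linear operators $L:\mathcal Q_K(p,q)\to\mathcal B_\mu$ of $\sup\{\|(T-L)f\|_{\mathcal B_\mu}:\|f\|_{\mathcal Q_K(p,q)}\le1\}$. Put $$A(u,\varphi,s)=\limsup_{|\varphi(z)|\to1}\frac{\mu(z)|u(z)|}{(1-|\varphi(z)|^2)^s},$$ which is understood to be $0$ if $\sup_{z\in\mathbb D}|\varphi(z)|<1$.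 Then there is a constant $C>0$, depending only on $n,p,q,K$, such that for every normal $\mu$, all $\psi_1,\psi_2\in H(\mathbb D)$ and every analytic $\varphi:\mathbb D\to\mathbb D$ for which $T^n_{\psi_1,\psi_2,\varphi}:\mathcal Q_K(p,q)\to\mathcal B_\mu$ is bounded, $$C^{-1}M\le\|T^n_{\psi_1,\psi_2,\varphi}\|_e\le C\,M,$$ $$M=\max\{A(\psi_1',\varphi,\gamma+n-1),\;A(\psi_1\varphi'+\psi_2',\varphi,\gamma+n),\;A(\psi_2\varphi',\varphi,\gamma+n+1)\}.$$ -/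

import Mathlib

open Set Filter Topology MeasureTheory Metric
open scoped NNReal ENNReal

noncomputable section

namespace SteSha

/-- The open unit disc. -/
abbrev disc : Set ℂ := ball (0 : ℂ) 1

/-- `H(D)`: analytic functions on the disc. Each is represented by its extension by zero, so that
two elements are equal exactly when they agree on the disc. -/
def HolDisc : Submodule ℂ (ℂ → ℂ) where
  carrier := {f | DifferentiableOn ℂ f disc ∧ ∀ z, z ∉ disc → f z = 0}
  add_mem' := by
    rintro f g ⟨hf, hf0⟩ ⟨hg, hg0⟩
    exact ⟨hf.add hg, fun z hz => by simp [hf0 z hz, hg0 z hz]⟩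
  zero_mem' := ⟨differentiableOn_const 0, fun _ _ => rfl⟩
  smul_mem' := by
    rintro c f ⟨hf, hf0⟩
    exact ⟨hf.const_smul c, fun z hz => by simp [hf0 z hz]⟩

theorem HolDisc.differentiableAt {f : ℂ → ℂ} (hf : f ∈ HolDisc) {z : ℂ} (hz : z ∈ disc) :
    DifferentiableAt ℂ f z :=
  hf.1.differentiableAt (isOpen_ball.mem_nhds hz)

/-- A normal function `m` on `[0,1)`. -/
def IsNormal (m : ℝ → ℝ) : Prop :=
  ContinuousOn m (Ico 0 1) ∧ (∀ r ∈ Ico (0 : ℝ) 1, 0 < m r) ∧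
  ∃ a b δ : ℝ, 0 < a ∧ a < b ∧ δ ∈ Ico (0 : ℝ) 1 ∧
    AntitoneOn (fun r => m r / (1 - r) ^ a) (Ico δ 1) ∧
    Tendsto (fun r => m r / (1 - r) ^ a) (𝓝[<] 1) (𝓝 0) ∧
    MonotoneOn (fun r => m r / (1 - r) ^ b) (Ico δ 1) ∧
    Tendsto (fun r => m r / (1 - r) ^ b) (𝓝[<] 1) atTop

/-- The norm of the weighted Bloch space of the radial weight `z ↦ m |z|`:
`|f(0)| + sup_z m(|z|) |f'(z)|`. -/
def blochNorm (m : ℝ → ℝ) (f : ℂ → ℂ) : ℝ≥0∞ :=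
  ‖f 0‖ₑ + ⨆ z ∈ disc, ENNReal.ofReal (m ‖z‖) * ‖deriv f z‖ₑ

/-- The weighted Bloch space. -/
def Bloch (m : ℝ → ℝ) : Submodule ℂ (ℂ → ℂ) where
  carrier := {f | f ∈ HolDisc ∧ blochNorm m f < ∞}
  add_mem' := by
    rintro f g ⟨hf, hfn⟩ ⟨hg, hgn⟩
    refine ⟨HolDisc.add_mem hf hg, lt_of_le_of_lt ?_ (ENNReal.add_lt_top.2 ⟨hfn, hgn⟩)⟩
    unfold blochNorm
    rw [add_add_add_comm]
    refine add_le_add (enorm_add_le _ _) (iSup₂_le fun z hz => ?_)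
    rw [deriv_add (HolDisc.differentiableAt hf hz) (HolDisc.differentiableAt hg hz)]
    refine (mul_le_mul_right (enorm_add_le _ _) _).trans ?_
    rw [mul_add]
    exact add_le_add
      (le_iSup₂ (f := fun z (_ : z ∈ disc) => ENNReal.ofReal (m ‖z‖) * ‖deriv f z‖ₑ) z hz)
      (le_iSup₂ (f := fun z (_ : z ∈ disc) => ENNReal.ofReal (m ‖z‖) * ‖deriv g z‖ₑ) z hz)
  zero_mem' := ⟨HolDisc.zero_mem, by simp [blochNorm]⟩
  smul_mem' := by
    rintro c f ⟨hf, hfn⟩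
    refine ⟨HolDisc.smul_mem c hf, lt_of_le_of_lt ?_ (ENNReal.mul_lt_top (enorm_lt_top (x := c)) hfn)⟩
    unfold blochNorm
    rw [mul_add]
    refine add_le_add (by simp [enorm_mul]) (iSup₂_le fun z hz => ?_)
    rw [deriv_const_smul c (HolDisc.differentiableAt hf hz), enorm_smul, mul_left_comm]
    exact mul_le_mul_right
      (le_iSup₂ (f := fun z (_ : z ∈ disc) => ENNReal.ofReal (m ‖z‖) * ‖deriv f z‖ₑ) z hz) _

/-- The disc automorphism `φ_ξ(z) = (ξ - z) / (1 - conj ξ * z)`. -/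
def discAut (ξ z : ℂ) : ℂ := (ξ - z) / (1 - (starRingEnd ℂ) ξ * z)

/-- The Green function `g(z,ξ) = log (1 / |φ_ξ(z)|)`, which is nonnegative on the disc. -/
def green (z ξ : ℂ) : ℝ := Real.log (1 / ‖discAut ξ z‖)

/-- `∫_D |f'(z)|^p (1-|z|²)^q K(g(z,ξ)) dA(z)`, with `dA` the normalized area measure. -/
def qkIntegral (p q : ℝ) (K : ℝ≥0 → ℝ≥0) (f : ℂ → ℂ) (ξ : ℂ) : ℝ≥0∞ :=
  ENNReal.ofReal (1 / Real.pi) *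
    ∫⁻ z in disc, ‖deriv f z‖ₑ ^ p *
      (ENNReal.ofReal ((1 - ‖z‖ ^ 2) ^ q) * (K (Real.toNNReal (green z ξ)) : ℝ≥0∞))

/-- The (quasi-)norm of `Q_K(p,q)`:
`|f(0)| + (sup_ξ ∫_D |f'(z)|^p (1-|z|²)^q K(g(z,ξ)) dA(z))^(1/p)`. -/
def qkNorm (p q : ℝ) (K : ℝ≥0 → ℝ≥0) (f : ℂ → ℂ) : ℝ≥0∞ :=
  ‖f 0‖ₑ + (⨆ ξ ∈ disc, qkIntegral p q K f ξ) ^ (1 / p)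

theorem lintegral_rpow_add_le {p : ℝ} (hp : 0 < p) (ν : Measure ℂ) (u v w : ℂ → ℝ≥0∞)
    (hu : Measurable u) (hv : Measurable v) :
    ∫⁻ z, (u z + v z) ^ p * w z ∂ν
      ≤ 2 ^ p * ((∫⁻ z, u z ^ p * w z ∂ν) + ∫⁻ z, v z ^ p * w z ∂ν) := by
  have h2 : (2 : ℝ≥0∞) ^ p ≠ ∞ := ENNReal.rpow_ne_top_of_nonneg hp.le (by simp)
  have hs : MeasurableSet {z | u z ≤ v z} := measurableSet_le hu hv
  rw [← lintegral_add_compl _ hs, mul_add, ← lintegral_const_mul' _ _ h2,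
    ← lintegral_const_mul' _ _ h2, add_comm]
  refine add_le_add ?_ ?_
  · refine (setLIntegral_mono' hs.compl fun z hz => ?_).trans (setLIntegral_le_lintegral _ _)
    rw [← mul_assoc, ← ENNReal.mul_rpow_of_nonneg _ _ hp.le, two_mul]
    have hz' : v z ≤ u z := le_of_lt (not_le.1 hz)
    gcongr
  · refine (setLIntegral_mono' hs fun z hz => ?_).trans (setLIntegral_le_lintegral _ _)
    rw [← mul_assoc, ← ENNReal.mul_rpow_of_nonneg _ _ hp.le, two_mul]
    have hz' : u z ≤ v z := hz
    gcongr

theorem qkIntegral_add_le {p : ℝ} (hp : 0 < p) (q : ℝ) (K : ℝ≥0 → ℝ≥0) {f g : ℂ → ℂ}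
    (hf : f ∈ HolDisc) (hg : g ∈ HolDisc) (ξ : ℂ) :
    qkIntegral p q K (f + g) ξ ≤ 2 ^ p * (qkIntegral p q K f ξ + qkIntegral p q K g ξ) := by
  unfold qkIntegral
  rw [← mul_add, mul_left_comm]
  refine mul_le_mul_right (le_trans ?_ (lintegral_rpow_add_le hp _ _ _ _
    (measurable_deriv f).enorm (measurable_deriv g).enorm)) _
  refine setLIntegral_mono' measurableSet_ball fun z hz => ?_
  rw [deriv_add (HolDisc.differentiableAt hf hz) (HolDisc.differentiableAt hg hz)]
  gcongr
  exact enorm_add_le _ _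

theorem qkIntegral_smul {p : ℝ} (hp : 0 < p) (q : ℝ) (K : ℝ≥0 → ℝ≥0) {f : ℂ → ℂ}
    (hf : f ∈ HolDisc) (c : ℂ) (ξ : ℂ) :
    qkIntegral p q K (c • f) ξ = ‖c‖ₑ ^ p * qkIntegral p q K f ξ := by
  unfold qkIntegral
  rw [mul_left_comm, ← lintegral_const_mul' _ _ (ENNReal.rpow_ne_top_of_nonneg hp.le enorm_ne_top)]
  congr 1
  refine setLIntegral_congr_fun measurableSet_ball fun z hz => ?_
  rw [deriv_const_smul c (HolDisc.differentiableAt hf hz), enorm_smul,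
    ENNReal.mul_rpow_of_nonneg _ _ hp.le, mul_assoc]

theorem qkNorm_lt_top_iff {p : ℝ} (hp : 0 < p) (q : ℝ) (K : ℝ≥0 → ℝ≥0) (f : ℂ → ℂ) :
    qkNorm p q K f < ∞ ↔ (⨆ ξ ∈ disc, qkIntegral p q K f ξ) < ∞ := by
  unfold qkNorm
  rw [ENNReal.add_lt_top, ENNReal.rpow_lt_top_iff_of_pos (by positivity)]
  simp

/-- The space `Q_K(p,q)`. -/
def QK (p q : ℝ) (K : ℝ≥0 → ℝ≥0) (hp : 0 < p) : Submodule ℂ (ℂ → ℂ) where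
  carrier := {f | f ∈ HolDisc ∧ qkNorm p q K f < ∞}
  add_mem' := by
    rintro f g ⟨hf, hfn⟩ ⟨hg, hgn⟩
    rw [qkNorm_lt_top_iff hp] at hfn hgn
    refine ⟨HolDisc.add_mem hf hg, (qkNorm_lt_top_iff hp _ _ _).2 ?_⟩
    refine lt_of_le_of_lt (iSup₂_le fun ξ hξ => (qkIntegral_add_le hp q K hf hg ξ).trans ?_)
      (ENNReal.mul_lt_top (ENNReal.rpow_lt_top_of_nonneg (x := 2) hp.le (by simp))
        (ENNReal.add_lt_top.2 ⟨hfn, hgn⟩))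
    exact mul_le_mul_right (add_le_add
      (le_iSup₂ (f := fun ξ (_ : ξ ∈ disc) => qkIntegral p q K f ξ) ξ hξ)
      (le_iSup₂ (f := fun ξ (_ : ξ ∈ disc) => qkIntegral p q K g ξ) ξ hξ)) _
  zero_mem' := by
    refine ⟨HolDisc.zero_mem, (qkNorm_lt_top_iff hp _ _ _).2 ?_⟩
    simp [qkIntegral, hp]
  smul_mem' := by
    rintro c f ⟨hf, hfn⟩
    rw [qkNorm_lt_top_iff hp] at hfn
    refine ⟨HolDisc.smul_mem c hf, (qkNorm_lt_top_iff hp _ _ _).2 ?_⟩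
    refine lt_of_le_of_lt (iSup₂_le fun ξ hξ => (qkIntegral_smul hp q K hf c ξ).le.trans ?_)
      (ENNReal.mul_lt_top
        (ENNReal.rpow_lt_top_of_nonneg (x := ‖c‖ₑ) hp.le enorm_ne_top) hfn)
    exact mul_le_mul_right
      (le_iSup₂ (f := fun ξ (_ : ξ ∈ disc) => qkIntegral p q K f ξ) ξ hξ) _

/-- The generalized Stević–Sharma operator
`(T f)(z) = ψ₁(z) f⁽ⁿ⁾(φ(z)) + ψ₂(z) f⁽ⁿ⁺¹⁾(φ(z))` for `z` in the disc (and `0` outside). -/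
def steSha (n : ℕ) (ψ₁ ψ₂ φ : ℂ → ℂ) (f : ℂ → ℂ) : ℂ → ℂ :=
  disc.indicator fun z =>
    ψ₁ z * iteratedDeriv n f (φ z) + ψ₂ z * iteratedDeriv (n + 1) f (φ z)

/-- `T : Q_K(p,q) → B_μ` is a (well-defined) bounded operator. -/
def IsBoundedOp (p q : ℝ) (K : ℝ≥0 → ℝ≥0) (hp : 0 < p) (m : ℝ → ℝ)
    (T : (ℂ → ℂ) → (ℂ → ℂ)) : Prop :=
  ∃ M : ℝ≥0, ∀ f ∈ QK p q K hp, T f ∈ Bloch m ∧ blochNorm m (T f) ≤ M * qkNorm p q K f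

/-- The linear operator `L : Q_K(p,q) → B_μ` is compact: the image of every bounded sequence
has a subsequence that converges in `B_μ`. -/
def IsCompactOp {p q : ℝ} {K : ℝ≥0 → ℝ≥0} {hp : 0 < p} {m : ℝ → ℝ}
    (L : QK p q K hp →ₗ[ℂ] Bloch m) : Prop :=
  ∀ (M : ℝ≥0) (f : ℕ → QK p q K hp), (∀ i, qkNorm p q K (f i) ≤ M) →
    ∃ (g : Bloch m) (s : ℕ → ℕ), StrictMono s ∧
      Tendsto (fun i => blochNorm m ((L (f (s i)) : ℂ → ℂ) - g)) atTop (𝓝 0)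

/-- The essential norm of `T : Q_K(p,q) → B_μ`: the infimum of the operator norms `‖T - L‖` over
all compact linear operators `L : Q_K(p,q) → B_μ`. -/
def essNorm (p q : ℝ) (K : ℝ≥0 → ℝ≥0) (hp : 0 < p) (m : ℝ → ℝ)
    (T : (ℂ → ℂ) → (ℂ → ℂ)) : ℝ≥0∞ :=
  ⨅ (L : QK p q K hp →ₗ[ℂ] Bloch m) (_ : IsCompactOp L),
    ⨆ (f : QK p q K hp) (_ : qkNorm p q K f ≤ 1), blochNorm m (T f - (L f : ℂ → ℂ))

/-- `A(u, φ, s) = limsup_{|φ(z)| → 1} μ(z) |u(z)| / (1 - |φ(z)|²)^s`, where `z` ranges over the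
disc. It is `0` when `sup |φ| < 1`. -/
def limsupA (m : ℝ → ℝ) (u φ : ℂ → ℂ) (s : ℝ) : ℝ≥0∞ :=
  limsup (fun z => ENNReal.ofReal (m ‖z‖ * ‖u z‖ / (1 - ‖φ z‖ ^ 2) ^ s))
    (comap (fun z => ‖φ z‖) (𝓝 1) ⊓ 𝓟 disc)

/-- `max {A(ψ₁', φ, γ+n-1), A(ψ₁φ' + ψ₂', φ, γ+n), A(ψ₂φ', φ, γ+n+1)}`. -/
def maxA (n : ℕ) (γ : ℝ) (m : ℝ → ℝ) (ψ₁ ψ₂ φ : ℂ → ℂ) : ℝ≥0∞ :=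
  max (limsupA m (deriv ψ₁) φ (γ + n - 1))
    (max (limsupA m (fun z => ψ₁ z * deriv φ z + deriv ψ₂ z) φ (γ + n))
      (limsupA m (fun z => ψ₂ z * deriv φ z) φ (γ + n + 1)))

/-- The two integrability conditions on `K`:
`∫₀¹ (1-r²)^q K(-log r) r dr < ∞` and
`∫₀¹ K(-log r) (1-r)^(min(-1,q)) (log (1/(1-r)))^χ r dr < ∞`,
where `χ = 1` if `q = -1` and `χ = 0` otherwise. -/
def Admissible (q : ℝ) (K : ℝ≥0 → ℝ≥0) : Prop :=
  (∫⁻ r in Ioo (0 : ℝ) 1,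
    ENNReal.ofReal ((1 - r ^ 2) ^ q * (K (Real.toNNReal (-Real.log r)) : ℝ) * r)) < ∞ ∧
  (∫⁻ r in Ioo (0 : ℝ) 1,
    ENNReal.ofReal ((K (Real.toNNReal (-Real.log r)) : ℝ) * (1 - r) ^ min (-1) q *
      Real.log (1 / (1 - r)) ^ (Set.indicator {(-1 : ℝ)} (fun _ => (1 : ℝ)) q) * r)) < ∞

end SteSha

end

/-!
The estimates rest on two facts about `Q_K(p,q)`, with `γ = (q + 2) / p`.

* If `‖f'‖` is dominated by `|φ_w'|^γ` for a disc automorphism `φ_w`, then `f` lies in `Q_K(p,q)` with a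
  bound independent of `w` (`exists_qkNorm_le_of_autDeriv`). The conformal change of variables that
  sends the pole `ξ` of the Green function to the origin makes the weight radial; the circle averages
  of `|φ_η'|^(q+2)` are then controlled through those of the Poisson kernel, and what remains is the
  second integrability condition on `K`.
* If `K` is not identically zero, functions of the unit ball satisfy
  `‖f'(z)‖ ≤ C (1 - ‖z‖)^(-γ)` (`exists_norm_deriv_le`), by a sub-mean-value inequality for `‖f'‖^p`
  with arbitrary `p > 0` on discs about `z` of radius comparable to `1 - ‖z‖`.

Lower bound. The functions `testFun γ k w` vanish to order exactly `k` at `w`, are bounded in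
`Q_K(p,q)` and tend to zero locally uniformly as `|w| → 1`. For a compact `L` and points `z_j` with
`|φ(z_j)| → 1`, a subsequence of the images under `L` of the functions centred at `φ(z_j)` converges,
so `L` is almost zero on differences `F_i - F_j` of two of them; for fixed `i` the function `F_j` no
longer contributes to `(T (F_i - F_j))'(z_i)` as `j → ∞`. This avoids any appeal to weak convergence
and gives `limsup_testFun_le`. The orders `k = n + 2, n + 1, n` then isolate one after the other the
three coefficients of `(T f)' = ψ₁' f⁽ⁿ⁾(φ) + (ψ₁φ' + ψ₂') f⁽ⁿ⁺¹⁾(φ) + ψ₂φ' f⁽ⁿ⁺²⁾(φ)`.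

Upper bound. `L f` is `T` applied to a Taylor polynomial of the dilation `f_r(z) = f(r z)`, an operator
of finite rank. The Taylor remainder of `f_r` is small in `Q_K(p,q)`, uniformly on the unit ball. The
error `f - f_r` is small on compact sets, and near the circle it obeys the growth bounds that match the
denominators in `A(u, φ, s)`. For `n = 0` and `γ < 1` the functions themselves are bounded, and there
`f - f_r` is uniformly small on the whole disc; `γ = 1` with `n = 0` is the excluded logarithmic case.
If `K = 0`, the quasi-norm is `|f(0)|` and `T` has rank at most one.
-/

noncomputable section

namespace SteSha

/-! ### Polar coordinates and circle averages -/

theorem lintegral_ball_polar {g : ℂ → ℝ≥0∞} (hg : Measurable g) (c : ℂ) (R : ℝ) :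
    ∫⁻ z in ball c R, g z =
      ∫⁻ r in Ioo (0 : ℝ) R, ENNReal.ofReal r *
        ∫⁻ θ in Ioo (-Real.pi) Real.pi, g (circleMap c r θ) := by
  have hshift : ∫⁻ z in ball c R, g z = ∫⁻ z, (ball (0 : ℂ) R).indicator (fun z => g (c + z)) z := by
    rw [← lintegral_indicator measurableSet_ball, ← lintegral_add_left_eq_self _ c]
    refine lintegral_congr fun z => ?_
    simp [indicator]
  rw [hshift, ← Complex.lintegral_comp_polarCoord_symm]
  have hm : Measurable fun p : ℝ × ℝ => ENNReal.ofReal p.1 * g (circleMap c p.1 p.2) := by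
    refine (by fun_prop : Measurable fun p : ℝ × ℝ => ENNReal.ofReal p.1).mul (hg.comp ?_)
    unfold circleMap
    fun_prop
  have htarget : polarCoord.target = Ioi (0 : ℝ) ×ˢ Ioo (-Real.pi) Real.pi := rfl
  have hrect : MeasurableSet (Ioo (0 : ℝ) R ×ˢ Ioo (-Real.pi) Real.pi) :=
    measurableSet_Ioo.prod measurableSet_Ioo
  have hstep : ∫⁻ p in polarCoord.target, ENNReal.ofReal p.1 •
      (ball (0 : ℂ) R).indicator (fun z => g (c + z)) (Complex.polarCoord.symm p) =
      ∫⁻ p in Ioo (0 : ℝ) R ×ˢ Ioo (-Real.pi) Real.pi,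
        ENNReal.ofReal p.1 * g (circleMap c p.1 p.2) := by
    rw [htarget, ← lintegral_indicator (measurableSet_Ioi.prod measurableSet_Ioo),
      ← lintegral_indicator hrect]
    refine lintegral_congr fun p => ?_
    by_cases hp : p ∈ Ioo (0 : ℝ) R ×ˢ Ioo (-Real.pi) Real.pi
    · have hp' : p ∈ Ioi (0 : ℝ) ×ˢ Ioo (-Real.pi) Real.pi := ⟨hp.1.1, hp.2⟩
      have hb : Complex.polarCoord.symm p ∈ ball (0 : ℂ) R := by
        rw [mem_ball_zero_iff, Complex.norm_polarCoord_symm, abs_of_pos hp.1.1]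
        exact hp.1.2
      rw [indicator_of_mem hp, indicator_of_mem hp', indicator_of_mem hb, smul_eq_mul,
        circleMap, Complex.polarCoord_symm_apply, Complex.exp_mul_I]
      simp
    · rw [indicator_of_notMem hp]
      by_cases hp' : p ∈ Ioi (0 : ℝ) ×ˢ Ioo (-Real.pi) Real.pi
      · have hb : Complex.polarCoord.symm p ∉ ball (0 : ℂ) R := by
          rw [mem_ball_zero_iff, Complex.norm_polarCoord_symm, abs_of_pos hp'.1]
          exact fun h => hp ⟨⟨hp'.1, h⟩, hp'.2⟩
        rw [indicator_of_mem hp', indicator_of_notMem hb, smul_zero]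
      · rw [indicator_of_notMem hp']
  rw [hstep, Measure.volume_eq_prod, ← Measure.prod_restrict, lintegral_prod _ hm.aemeasurable]
  refine lintegral_congr fun r => ?_
  rw [lintegral_const_mul' _ _ ENNReal.ofReal_ne_top]

theorem lintegral_circleMap_eq_circleAverage {h : ℂ → ℝ} {c : ℂ} {r : ℝ}
    (hc : ContinuousOn h (sphere c |r|)) (h0 : ∀ z ∈ sphere c |r|, 0 ≤ h z) :
    ∫⁻ θ in Ioo (-Real.pi) Real.pi, ENNReal.ofReal (h (circleMap c r θ)) =
      ENNReal.ofReal (2 * Real.pi * Real.circleAverage h c r) := by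
  have hmem : ∀ θ, circleMap c r θ ∈ sphere c |r| := fun θ => circleMap_mem_sphere' c r θ
  have hcont : Continuous fun θ => h (circleMap c r θ) :=
    hc.comp_continuous (continuous_circleMap c r) hmem
  have hpi : -Real.pi ≤ Real.pi := by linarith [Real.pi_pos]
  rw [Real.circleAverage_eq_integral_add (-Real.pi),
    intervalIntegral.integral_comp_add_right (fun θ => h (circleMap c r θ)), smul_eq_mul,
    ← mul_assoc, mul_inv_cancel₀ (by positivity), one_mul]
  have h1 : (0 : ℝ) + -Real.pi = -Real.pi := by ring
  have h2 : 2 * Real.pi + -Real.pi = Real.pi := by ring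
  rw [h1, h2, intervalIntegral.integral_of_le hpi, ← integral_Ioc_eq_integral_Ioo.symm,
    ofReal_integral_eq_lintegral_ofReal]
  · exact ((hcont.integrableOn_Icc).mono_set Ioo_subset_Icc_self)
  · exact Eventually.of_forall fun θ => h0 _ (hmem θ)

/-! ### Sub-mean-value inequalities over discs -/

theorem lintegral_ofReal_id_Ioo {R : ℝ} (hR : 0 ≤ R) :
    ∫⁻ r in Ioo (0 : ℝ) R, ENNReal.ofReal r = ENNReal.ofReal (R ^ 2 / 2) := by
  rw [← ofReal_integral_eq_lintegral_ofReal, ← integral_Ioc_eq_integral_Ioo,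
    ← intervalIntegral.integral_of_le hR, integral_id]
  · simp
  · exact (continuous_id.integrableOn_Icc).mono_set Ioo_subset_Icc_self
  · exact (ae_restrict_iff' measurableSet_Ioo).2 (Eventually.of_forall fun r hr => hr.1.le)

theorem area_submean {f : ℂ → ℂ} (hm : Measurable f) {c : ℂ} {R : ℝ} (hR : 0 ≤ R)
    (hf : DifferentiableOn ℂ f (ball c R)) :
    ENNReal.ofReal (Real.pi * R ^ 2) * ‖f c‖ₑ ≤ ∫⁻ z in ball c R, ‖f z‖ₑ := by
  rw [lintegral_ball_polar hm.enorm]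
  have key : ∀ r ∈ Ioo (0 : ℝ) R, ENNReal.ofReal r * (ENNReal.ofReal (2 * Real.pi) * ‖f c‖ₑ) ≤
      ENNReal.ofReal r * ∫⁻ θ in Ioo (-Real.pi) Real.pi, ‖f (circleMap c r θ)‖ₑ := by
    intro r hr
    refine mul_le_mul_right ?_ _
    have hsub : closedBall c |r| ⊆ ball c R := by
      rw [abs_of_pos hr.1]; exact closedBall_subset_ball hr.2
    have hfr : ContinuousOn f (sphere c |r|) :=
      hf.continuousOn.mono (sphere_subset_closedBall.trans hsub)
    have h1 := lintegral_circleMap_eq_circleAverage (h := fun z => ‖f z‖) hfr.norm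
      (fun z _ => norm_nonneg _)
    simp only [ofReal_norm] at h1
    rw [h1, ← ofReal_norm, ← ENNReal.ofReal_mul (by positivity)]
    refine ENNReal.ofReal_le_ofReal (mul_le_mul_of_nonneg_left ?_ (by positivity))
    have hmean : Real.circleAverage f c r = f c :=
      DiffContOnCl.circleAverage (DifferentiableOn.diffContOnCl (hf.mono
        ((closure_ball_subset_closedBall).trans hsub)))
    rw [← hmean]
    rw [Real.circleAverage_def, Real.circleAverage_def, norm_smul, smul_eq_mul, Real.norm_of_nonneg
      (by positivity)]
    refine mul_le_mul_of_nonneg_left ?_ (by positivity)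
    exact intervalIntegral.norm_integral_le_integral_norm (by positivity)
  calc ENNReal.ofReal (Real.pi * R ^ 2) * ‖f c‖ₑ
      = ∫⁻ r in Ioo (0 : ℝ) R, ENNReal.ofReal r * (ENNReal.ofReal (2 * Real.pi) * ‖f c‖ₑ) := by
        rw [lintegral_mul_const' _ _ (by finiteness), lintegral_ofReal_id_Ioo hR, ← mul_assoc,
          ← ENNReal.ofReal_mul (by positivity)]
        congr 2
        ring
    _ ≤ _ := setLIntegral_mono' measurableSet_Ioo key

/-- For `p ≥ 1`, convexity of `x ^ p` is replaced by the pointwise bound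
`x ≤ a / 2 + (a / 2) ^ (1 - p) * x ^ p` with `a = ‖f c‖`, whose constant term takes up only half of
the mean value `a`. -/
theorem area_submean_rpow_of_one_le {p : ℝ} (hp : 1 ≤ p) {f : ℂ → ℂ} (hm : Measurable f) {c : ℂ}
    {R : ℝ} (hR : 0 < R) (hf : DifferentiableOn ℂ f (closedBall c R)) :
    ENNReal.ofReal (R ^ 2 * ‖f c‖ ^ p) ≤
      ENNReal.ofReal (2 ^ p) * ∫⁻ z in ball c R, ‖f z‖ₑ ^ p := by
  have hp0 : 0 < p := by linarith
  rcases (norm_nonneg (f c)).eq_or_lt with ha | ha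
  · rw [← ha, Real.zero_rpow hp0.ne']; simp
  set a := ‖f c‖ with ha_def
  rcases eq_or_ne (∫⁻ z in ball c R, ‖f z‖ₑ ^ p) ∞ with hI | hI
  · rw [hI, ENNReal.mul_top (by simp; positivity)]; exact le_top
  have hpt : ∀ x : ℝ, 0 ≤ x → x ≤ a / 2 + (a / 2) ^ (1 - p) * x ^ p := by
    intro x hx
    rcases le_total x (a / 2) with h | h
    · have : 0 ≤ (a / 2) ^ (1 - p) * x ^ p := by positivity
      linarith
    · have hxpos : 0 < x := by linarith
      have h1 : x ^ (1 - p) ≤ (a / 2) ^ (1 - p) :=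
        Real.rpow_le_rpow_of_nonpos (by positivity) h (by linarith)
      have h2 : x = x ^ (1 - p) * x ^ p := by
        rw [← Real.rpow_add hxpos]; simp
      have h3 : x ^ (1 - p) * x ^ p ≤ (a / 2) ^ (1 - p) * x ^ p :=
        mul_le_mul_of_nonneg_right h1 (by positivity)
      have : 0 < a / 2 := by positivity
      linarith
  have hpt' : ∀ z, ‖f z‖ₑ ≤ ENNReal.ofReal (a / 2) +
      ENNReal.ofReal ((a / 2) ^ (1 - p)) * ‖f z‖ₑ ^ p := by
    intro z
    rw [← ofReal_norm, ENNReal.ofReal_rpow_of_nonneg (norm_nonneg _) hp0.le,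
      ← ENNReal.ofReal_mul (by positivity), ← ENNReal.ofReal_add (by positivity) (by positivity)]
    exact ENNReal.ofReal_le_ofReal (hpt _ (norm_nonneg _))
  have h1 := (area_submean hm hR.le (hf.mono ball_subset_closedBall)).trans
    (lintegral_mono fun z => hpt' z)
  rw [lintegral_add_left (by fun_prop), lintegral_const_mul' _ _ ENNReal.ofReal_ne_top,
    setLIntegral_const, Complex.volume_ball, ← ofReal_norm, ← ha_def] at h1
  set I := ∫⁻ z in ball c R, ‖f z‖ₑ ^ p with hI_def
  have hvol : ENNReal.ofReal R ^ 2 * (NNReal.pi : ℝ≥0∞) = ENNReal.ofReal (Real.pi * R ^ 2) := by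
    rw [mul_comm, ENNReal.ofReal_mul Real.pi_pos.le, ENNReal.ofReal_pow hR.le]
    congr 1
    rw [← NNReal.coe_real_pi, ENNReal.ofReal_coe_nnreal]
  rw [hvol] at h1
  lift I to ℝ≥0 using hI with J
  have hJ : (J : ℝ≥0∞) = ENNReal.ofReal J := (ENNReal.ofReal_coe_nnreal).symm
  rw [hJ] at h1 ⊢
  rw [← ENNReal.ofReal_mul (by positivity), ← ENNReal.ofReal_mul (by positivity),
    ← ENNReal.ofReal_mul (by positivity), ← ENNReal.ofReal_add (by positivity) (by positivity),
    ENNReal.ofReal_le_ofReal_iff (by positivity)] at h1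
  rw [← ENNReal.ofReal_mul (by positivity)]
  refine ENNReal.ofReal_le_ofReal ?_
  have h2 : Real.pi * R ^ 2 * (a / 2) ≤ (a / 2) ^ (1 - p) * J := by linarith
  have h3 : Real.pi * R ^ 2 * (a / 2) ^ p ≤ J := by
    have h4 := mul_le_mul_of_nonneg_left h2 (by positivity : 0 ≤ (a / 2) ^ (p - 1))
    have h5 : (a / 2) ^ (p - 1) * (a / 2) ^ (1 - p) = 1 := by
      rw [← Real.rpow_add (by positivity)]; simp
    have h6 : (a / 2) ^ (p - 1) * (a / 2) = (a / 2) ^ p := by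
      rw [← Real.rpow_add_one (by positivity)]; simp
    calc Real.pi * R ^ 2 * (a / 2) ^ p
        = (a / 2) ^ (p - 1) * (Real.pi * R ^ 2 * (a / 2)) := by rw [← h6]; ring
      _ ≤ _ := h4
      _ = J := by rw [← mul_assoc, h5, one_mul]
  have h7 : R ^ 2 * (a / 2) ^ p ≤ Real.pi * R ^ 2 * (a / 2) ^ p := by
    have : 0 ≤ R ^ 2 * (a / 2) ^ p := by positivity
    nlinarith [Real.pi_gt_three]
  have h8 : a ^ p = 2 ^ p * (a / 2) ^ p := by
    rw [← Real.mul_rpow (by norm_num) (by positivity)]; congr 1; ring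
  rw [h8]
  have : (0 : ℝ) ≤ 2 ^ p := by positivity
  calc (R ^ 2 * (2 ^ p * (a / 2) ^ p) : ℝ) = 2 ^ p * (R ^ 2 * (a / 2) ^ p) := by ring
    _ ≤ 2 ^ p * (J : ℝ) := mul_le_mul_of_nonneg_left (h7.trans h3) this

/-- For `p < 1` the function `‖f‖ ^ p` is controlled by comparing `‖f‖` with `‖f‖ ^ p` near a point
where the weighted modulus `(R - ‖w - c‖) ^ (2 / p) * ‖f w‖` is maximal. -/
theorem area_submean_rpow_of_le_one {p : ℝ} (hp0 : 0 < p) (hp : p ≤ 1) {f : ℂ → ℂ}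
    (hm : Measurable f) {c : ℂ} {R : ℝ} (hR : 0 < R)
    (hf : DifferentiableOn ℂ f (closedBall c R)) :
    ENNReal.ofReal (R ^ 2 * ‖f c‖ ^ p) ≤
      ENNReal.ofReal (4 * (2 ^ (2 / p)) ^ (1 - p)) * ∫⁻ z in ball c R, ‖f z‖ₑ ^ p := by
  have hcont : ContinuousOn (fun w => (R - ‖w - c‖) ^ (2 / p) * ‖f w‖) (closedBall c R) := by
    refine ContinuousOn.mul ?_ hf.continuousOn.norm
    refine ContinuousOn.rpow_const (by fun_prop) fun _ _ => Or.inr (by positivity)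
  obtain ⟨w, hw, hmax⟩ := (isCompact_closedBall c R).exists_isMaxOn
    (nonempty_closedBall.2 hR.le) hcont
  have hmax' : ∀ u ∈ closedBall c R,
      (R - ‖u - c‖) ^ (2 / p) * ‖f u‖ ≤ (R - ‖w - c‖) ^ (2 / p) * ‖f w‖ := fun u hu => hmax hu
  have hc := hmax' c (mem_closedBall_self hR.le)
  rw [sub_self, norm_zero, sub_zero] at hc
  rcases (norm_nonneg (f c)).eq_or_lt with ha | ha
  · rw [← ha, Real.zero_rpow hp0.ne']; simp
  have hpos : 0 < (R - ‖w - c‖) ^ (2 / p) * ‖f w‖ := lt_of_lt_of_le (by positivity) hc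
  have hwR : 0 ≤ R - ‖w - c‖ := by
    have := mem_closedBall_iff_norm.1 hw; linarith
  have hwR' : 0 < R - ‖w - c‖ := by
    rcases hwR.eq_or_lt with h | h
    · rw [← h, Real.zero_rpow (by positivity)] at hpos; simp at hpos
    · exact h
  have hfw : 0 < ‖f w‖ := pos_of_mul_pos_right hpos (by positivity)
  -- On the disc of half the distance to the circle, maximality at `w` bounds `‖f‖` by a multiple of
  -- `‖f w‖`; the exponent `2 / p` makes the `p`-th power of the weight a squared radius.
  set s := (R - ‖w - c‖) / 2 with hs
  have hs0 : 0 < s := by positivity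
  have hsub : ball w s ⊆ ball c R := by
    refine ball_subset_ball' ?_
    rw [dist_eq_norm]; linarith
  set M := 2 ^ (2 / p) * ‖f w‖ with hM
  have hM0 : 0 < M := by positivity
  have hbound : ∀ u ∈ ball w s, ‖f u‖ ≤ M := by
    intro u hu
    have h1 := hmax' u (ball_subset_closedBall (hsub hu))
    have h2 : s ≤ R - ‖u - c‖ := by
      have h3 : ‖u - c‖ ≤ ‖u - w‖ + ‖w - c‖ := by
        simpa using norm_add_le (u - w) (w - c)
      have h4 := mem_ball_iff_norm.1 hu
      linarith
    have h5 : s ^ (2 / p) * ‖f u‖ ≤ s ^ (2 / p) * M := by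
      calc s ^ (2 / p) * ‖f u‖ ≤ (R - ‖u - c‖) ^ (2 / p) * ‖f u‖ := by gcongr
        _ ≤ _ := h1
        _ = s ^ (2 / p) * M := by
          rw [hM, ← mul_assoc, ← Real.mul_rpow hs0.le (by norm_num)]
          congr 2; rw [hs]; ring
    exact le_of_mul_le_mul_left h5 (by positivity)
  have hpt : ∀ u ∈ ball w s, ‖f u‖ₑ ≤ ENNReal.ofReal (M ^ (1 - p)) * ‖f u‖ₑ ^ p := by
    intro u hu
    rw [← ofReal_norm, ENNReal.ofReal_rpow_of_nonneg (norm_nonneg _) hp0.le,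
      ← ENNReal.ofReal_mul (by positivity)]
    refine ENNReal.ofReal_le_ofReal ?_
    rcases (norm_nonneg (f u)).eq_or_lt with h | h
    · rw [← h, Real.zero_rpow hp0.ne', mul_zero]
    · calc ‖f u‖ = ‖f u‖ ^ (1 - p) * ‖f u‖ ^ p := by rw [← Real.rpow_add h]; simp
        _ ≤ M ^ (1 - p) * ‖f u‖ ^ p := mul_le_mul_of_nonneg_right
          (Real.rpow_le_rpow h.le (hbound u hu) (by linarith)) (by positivity)
  have h1 := (area_submean hm hs0.le (hf.mono (hsub.trans ball_subset_closedBall))).trans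
    (setLIntegral_mono' measurableSet_ball hpt)
  rw [lintegral_const_mul' _ _ ENNReal.ofReal_ne_top] at h1
  have h2 := h1.trans (mul_le_mul_right (lintegral_mono_set hsub) _)
  set I := ∫⁻ z in ball c R, ‖f z‖ₑ ^ p with hI_def
  rcases eq_or_ne I ∞ with hI | hI
  · rw [hI, ENNReal.mul_top (by simp; positivity)]; exact le_top
  lift I to ℝ≥0 using hI with J
  have hJ : (J : ℝ≥0∞) = ENNReal.ofReal J := (ENNReal.ofReal_coe_nnreal).symm
  rw [hJ, ← ofReal_norm, ← ENNReal.ofReal_mul (by positivity), ← ENNReal.ofReal_mul (by positivity),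
    ENNReal.ofReal_le_ofReal_iff (by positivity)] at h2
  rw [hJ, ← ENNReal.ofReal_mul (by positivity)]
  refine ENNReal.ofReal_le_ofReal ?_
  have h3 : R ^ 2 * ‖f c‖ ^ p ≤ (2 * s) ^ 2 * ‖f w‖ ^ p := by
    have h4 := Real.rpow_le_rpow (by positivity) hc hp0.le
    rw [Real.mul_rpow (by positivity) (by positivity), Real.mul_rpow (by positivity) (by positivity),
      ← Real.rpow_mul hR.le, ← Real.rpow_mul hwR, div_mul_cancel₀ _ hp0.ne'] at h4
    have h5 : R - ‖w - c‖ = 2 * s := by rw [hs]; ring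
    rw [h5] at h4
    exact_mod_cast h4
  have h6 : M ^ (1 - p) = (2 ^ (2 / p)) ^ (1 - p) * ‖f w‖ ^ (1 - p) :=
    Real.mul_rpow (by positivity) (by positivity)
  have h7 : ‖f w‖ = ‖f w‖ ^ (1 - p) * ‖f w‖ ^ p := by rw [← Real.rpow_add hfw]; simp
  have h8 : Real.pi * s ^ 2 * ‖f w‖ ^ p ≤ (2 ^ (2 / p)) ^ (1 - p) * J := by
    have h9 : 0 < ‖f w‖ ^ (1 - p) := by positivity
    refine le_of_mul_le_mul_left ?_ h9
    calc ‖f w‖ ^ (1 - p) * (Real.pi * s ^ 2 * ‖f w‖ ^ p)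
        = Real.pi * s ^ 2 * (‖f w‖ ^ (1 - p) * ‖f w‖ ^ p) := by ring
      _ = Real.pi * s ^ 2 * ‖f w‖ := by rw [← h7]
      _ ≤ M ^ (1 - p) * J := h2
      _ = _ := by rw [h6]; ring
  have h10 : 0 ≤ s ^ 2 * ‖f w‖ ^ p := by positivity
  nlinarith [Real.pi_gt_three]

/-- Sub-mean-value inequality for `‖f‖ ^ p` over discs, for every `p > 0`; the constant depends only on
`p`. -/
theorem exists_area_submean_rpow {p : ℝ} (hp : 0 < p) :
    ∃ C : ℝ, 0 < C ∧ ∀ (f : ℂ → ℂ), Measurable f → ∀ (c : ℂ) (R : ℝ), 0 < R →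
      DifferentiableOn ℂ f (closedBall c R) →
      ENNReal.ofReal (R ^ 2 * ‖f c‖ ^ p) ≤
        ENNReal.ofReal C * ∫⁻ z in ball c R, ‖f z‖ₑ ^ p := by
  rcases le_total 1 p with h | h
  · exact ⟨2 ^ p, by positivity, fun f hm c R hR hf => area_submean_rpow_of_one_le h hm hR hf⟩
  · exact ⟨4 * (2 ^ (2 / p)) ^ (1 - p), by positivity,
      fun f hm c R hR hf => area_submean_rpow_of_le_one hp h hm hR hf⟩

/-! ### Disc automorphisms and the conformal change of variables -/

/-- The modulus `(1 - |w|²) / |1 - conj w * z|²` of the derivative at `z` of the disc automorphism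
`φ_w`. -/
def autDeriv (w z : ℂ) : ℝ := (1 - ‖w‖ ^ 2) / ‖1 - (starRingEnd ℂ) w * z‖ ^ 2

theorem norm_lt_one_of_mem_disc {z : ℂ} (hz : z ∈ disc) : ‖z‖ < 1 := mem_ball_zero_iff.1 hz

theorem one_sub_norm_sq_pos {z : ℂ} (hz : z ∈ disc) : 0 < 1 - ‖z‖ ^ 2 := by
  have := norm_lt_one_of_mem_disc hz
  nlinarith [norm_nonneg z]

theorem one_sub_norm_left_le {w z : ℂ} (hz : ‖z‖ ≤ 1) :
    1 - ‖w‖ ≤ ‖1 - (starRingEnd ℂ) w * z‖ := by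
  have h := norm_sub_norm_le (1 : ℂ) ((starRingEnd ℂ) w * z)
  rw [norm_one, norm_mul, RCLike.norm_conj] at h
  nlinarith [norm_nonneg w]

theorem one_sub_norm_right_le {w z : ℂ} (hw : ‖w‖ ≤ 1) :
    1 - ‖z‖ ≤ ‖1 - (starRingEnd ℂ) w * z‖ := by
  have h := norm_sub_norm_le (1 : ℂ) ((starRingEnd ℂ) w * z)
  rw [norm_one, norm_mul, RCLike.norm_conj] at h
  nlinarith [norm_nonneg z]

theorem norm_den_pos {w z : ℂ} (hw : w ∈ disc) (hz : ‖z‖ ≤ 1) :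
    0 < ‖1 - (starRingEnd ℂ) w * z‖ :=
  lt_of_lt_of_le (sub_pos.2 (norm_lt_one_of_mem_disc hw)) (one_sub_norm_left_le hz)

theorem den_ne_zero {w z : ℂ} (hw : w ∈ disc) (hz : z ∈ disc) :
    1 - (starRingEnd ℂ) w * z ≠ 0 :=
  norm_pos_iff.1 (norm_den_pos hw (norm_lt_one_of_mem_disc hz).le)

theorem autDeriv_pos {w z : ℂ} (hw : w ∈ disc) (hz : z ∈ disc) : 0 < autDeriv w z :=
  div_pos (one_sub_norm_sq_pos hw) (pow_pos (norm_den_pos hw (norm_lt_one_of_mem_disc hz).le) 2)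

theorem normSq_den_sub_normSq_num (a z : ℂ) :
    ‖1 - (starRingEnd ℂ) a * z‖ ^ 2 - ‖a - z‖ ^ 2 = (1 - ‖a‖ ^ 2) * (1 - ‖z‖ ^ 2) := by
  simp only [← Complex.normSq_eq_norm_sq, Complex.normSq_apply]
  simp
  ring

theorem one_sub_norm_discAut_sq {a z : ℂ} (ha : a ∈ disc) (hz : z ∈ disc) :
    1 - ‖discAut a z‖ ^ 2 = autDeriv a z * (1 - ‖z‖ ^ 2) := by
  have h := norm_den_pos ha (norm_lt_one_of_mem_disc hz).le
  have h2 := normSq_den_sub_normSq_num a z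
  rw [discAut, autDeriv, norm_div, div_pow, div_mul_eq_mul_div, ← h2, sub_div,
    div_self (pow_pos h 2).ne']

theorem discAut_mem {a z : ℂ} (ha : a ∈ disc) (hz : z ∈ disc) : discAut a z ∈ disc := by
  have h := mul_pos (autDeriv_pos ha hz) (one_sub_norm_sq_pos hz)
  rw [← one_sub_norm_discAut_sq ha hz] at h
  rw [mem_ball_zero_iff]
  nlinarith [norm_nonneg (discAut a z)]

theorem norm_num_le_norm_den {a z : ℂ} (ha : a ∈ disc) (hz : z ∈ disc) :
    ‖a - z‖ ≤ ‖1 - (starRingEnd ℂ) a * z‖ := by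
  have h2 := normSq_den_sub_normSq_num a z
  have h3 := mul_pos (one_sub_norm_sq_pos ha) (one_sub_norm_sq_pos hz)
  exact le_of_lt (lt_of_pow_lt_pow_left₀ 2 (norm_nonneg _) (by linarith))

theorem discAut_discAut {a z : ℂ} (ha : a ∈ disc) (hz : z ∈ disc) :
    discAut a (discAut a z) = z := by
  have h1 := den_ne_zero ha hz
  have h2 := den_ne_zero ha (discAut_mem ha hz)
  have h1' : 1 - z * (starRingEnd ℂ) a ≠ 0 := by rwa [mul_comm]
  rw [discAut, div_eq_iff h2]
  simp only [discAut]
  field_simp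
  ring

theorem image_discAut {a : ℂ} (ha : a ∈ disc) : discAut a '' disc = disc := by
  ext z
  constructor
  · rintro ⟨u, hu, rfl⟩; exact discAut_mem ha hu
  · intro hz; exact ⟨discAut a z, discAut_mem ha hz, discAut_discAut ha hz⟩

theorem injOn_discAut {a : ℂ} (ha : a ∈ disc) : InjOn (discAut a) disc := by
  intro x hx y hy hxy
  rw [← discAut_discAut ha hx, hxy, discAut_discAut ha hy]

theorem ofReal_norm_sq (a : ℂ) : ((‖a‖ ^ 2 : ℝ) : ℂ) = (starRingEnd ℂ) a * a := by
  rw [← Complex.normSq_eq_norm_sq, Complex.normSq_eq_conj_mul_self]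

theorem hasDerivAt_discAut {a z : ℂ} (ha : a ∈ disc) (hz : z ∈ disc) :
    HasDerivAt (discAut a)
      (-((1 - ‖a‖ ^ 2 : ℝ) : ℂ) / (1 - (starRingEnd ℂ) a * z) ^ 2) z := by
  have h1 := den_ne_zero ha hz
  have h : HasDerivAt (discAut a) _ z := ((hasDerivAt_id z).const_sub a).div
    (((hasDerivAt_id z).const_mul ((starRingEnd ℂ) a)).const_sub 1) h1
  convert h using 1
  congr 1
  rw [Complex.ofReal_sub, ofReal_norm_sq]
  simp
  ring

theorem det_restrictScalars_toSpanSingleton (c : ℂ) :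
    ((ContinuousLinearMap.toSpanSingleton ℂ c).restrictScalars ℝ).det = ‖c‖ ^ 2 := by
  simp [ContinuousLinearMap.det, LinearMap.det_restrictScalars,
    Algebra.norm_complex_eq, Complex.normSq_eq_norm_sq]

theorem lintegral_disc_comp_discAut {a : ℂ} (ha : a ∈ disc) (g : ℂ → ℝ≥0∞) :
    ∫⁻ z in disc, g z = ∫⁻ u in disc, ENNReal.ofReal (autDeriv a u ^ 2) * g (discAut a u) := by
  conv_lhs => rw [← image_discAut ha]
  rw [lintegral_image_eq_lintegral_abs_det_fderiv_mul volume measurableSet_ball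
    (fun u hu => ((hasDerivAt_discAut ha hu).hasFDerivAt.restrictScalars ℝ).hasFDerivWithinAt)
    (injOn_discAut ha)]
  refine setLIntegral_congr_fun measurableSet_ball fun u hu => ?_
  rw [det_restrictScalars_toSpanSingleton, norm_div, norm_neg, norm_pow, autDeriv,
    Complex.norm_real, Real.norm_of_nonneg (one_sub_norm_sq_pos ha).le, abs_of_nonneg (by positivity)]

/-- The cocycle rule `|φ_w'(φ_ξ u)| |φ_ξ'(u)| = |φ_η'(u)|` with `η = φ_ξ w`. -/
theorem autDeriv_discAut {w ξ u : ℂ} (hw : w ∈ disc) (hξ : ξ ∈ disc) (hu : u ∈ disc) :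
    autDeriv w (discAut ξ u) * autDeriv ξ u = autDeriv (discAut ξ w) u := by
  have h1 := den_ne_zero hξ hu
  have h2 := den_ne_zero hξ hw
  have h3 := den_ne_zero hw hξ
  have hη := one_sub_norm_discAut_sq hξ hw
  have h4 := den_ne_zero (discAut_mem hξ hw) hu
  have key : (1 - (starRingEnd ℂ) w * discAut ξ u) * (1 - (starRingEnd ℂ) ξ * u) =
      (1 - (starRingEnd ℂ) w * ξ) * (1 - (starRingEnd ℂ) (discAut ξ w) * u) := by
    simp only [discAut, map_div₀, map_sub, map_mul, map_one, Complex.conj_conj]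
    have h3' : 1 - ξ * (starRingEnd ℂ) w ≠ 0 := by rwa [mul_comm]
    have h1' : 1 - u * (starRingEnd ℂ) ξ ≠ 0 := by rwa [mul_comm]
    field_simp
    ring
  have hsymm : ‖1 - (starRingEnd ℂ) ξ * w‖ = ‖1 - (starRingEnd ℂ) w * ξ‖ := by
    rw [← RCLike.norm_conj]; simp [mul_comm]
  have keyn := congrArg (fun x => ‖x‖ ^ 2) key
  simp only [norm_mul, mul_pow] at keyn
  rw [autDeriv, autDeriv, autDeriv, hη, autDeriv, hsymm, div_mul_div_comm, keyn]
  have := norm_ne_zero_iff.2 h3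
  have := norm_ne_zero_iff.2 h4
  field_simp

theorem green_discAut {ξ u : ℂ} (hξ : ξ ∈ disc) (hu : u ∈ disc) :
    green (discAut ξ u) ξ = -Real.log ‖u‖ := by
  rw [green, discAut_discAut hξ hu, one_div, Real.log_inv]

theorem autDeriv_le_div {η u : ℂ} (hη : η ∈ disc) (hu : u ∈ disc) :
    autDeriv η u ≤ 2 / (1 - ‖u‖) := by
  have h1 := norm_lt_one_of_mem_disc hη
  have h2 := norm_lt_one_of_mem_disc hu
  have h3 := one_sub_norm_left_le (w := η) h2.le
  have h4 := one_sub_norm_right_le (z := u) h1.le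
  rw [autDeriv, div_le_div_iff₀ (pow_pos (norm_den_pos hη h2.le) 2) (by linarith)]
  have h5 : (1 - ‖η‖) * (1 - ‖u‖) ≤ ‖1 - (starRingEnd ℂ) η * u‖ ^ 2 := by
    rw [sq]; exact mul_le_mul h3 h4 (by linarith) (norm_nonneg _)
  have h6 : 0 ≤ (1 - ‖η‖) * (1 - ‖u‖) := mul_nonneg (by linarith) (by linarith)
  nlinarith [norm_nonneg η]

/-- `|φ_η'|` is at most the Poisson kernel of the circle of radius `r`, whose average is `1`. -/
theorem lintegral_autDeriv_circle_le {η : ℂ} (hη : η ∈ disc) {r : ℝ} (hr : r ∈ Ioo (0 : ℝ) 1) :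
    ∫⁻ θ in Ioo (-Real.pi) Real.pi, ENNReal.ofReal (autDeriv η (circleMap 0 r θ)) ≤
      ENNReal.ofReal (2 * Real.pi) := by
  have hη1 := norm_lt_one_of_mem_disc hη
  set F : ℂ → ℂ := fun u => (1 + (starRingEnd ℂ) η * u) / (1 - (starRingEnd ℂ) η * u) with hF
  have hden : ∀ u ∈ closedBall (0 : ℂ) |r|, 1 - (starRingEnd ℂ) η * u ≠ 0 := by
    intro u hu
    refine den_ne_zero hη ?_
    rw [mem_closedBall_zero_iff, abs_of_pos hr.1] at hu
    exact mem_ball_zero_iff.2 (hu.trans_lt hr.2)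
  have hFd : DifferentiableOn ℂ F (closedBall 0 |r|) :=
    DifferentiableOn.div (by fun_prop) (by fun_prop) hden
  have hmean : Real.circleAverage F 0 r = 1 := by
    rw [DiffContOnCl.circleAverage (DifferentiableOn.diffContOnCl (hFd.mono
      closure_ball_subset_closedBall))]
    simp [hF]
  have hFc : ContinuousOn F (sphere 0 |r|) := hFd.continuousOn.mono sphere_subset_closedBall
  have hre : Real.circleAverage (fun u => (F u).re) 0 r = 1 := by
    have := Complex.reCLM.circleAverage_comp_comm (f := F) (c := 0) (R := r)
      (ContinuousOn.circleIntegrable' hFc)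
    rw [hmean] at this
    simpa [Function.comp_def] using this
  have hFre : ∀ u ∈ sphere (0 : ℂ) |r|,
      (F u).re = (1 - ‖η‖ ^ 2 * r ^ 2) / ‖1 - (starRingEnd ℂ) η * u‖ ^ 2 := by
    intro u hu
    rw [mem_sphere_zero_iff_norm, abs_of_pos hr.1] at hu
    have hr2 : r ^ 2 = Complex.normSq u := by rw [Complex.normSq_eq_norm_sq, hu]
    rw [hF, hr2]
    simp only [Complex.div_re, ← Complex.normSq_eq_norm_sq]
    rw [← add_div]
    congr 1
    simp [Complex.normSq_apply]
    ring
  have hle : ∀ u ∈ sphere (0 : ℂ) |r|, autDeriv η u ≤ (F u).re := by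
    intro u hu
    rw [hFre u hu, autDeriv]
    have : ‖η‖ ^ 2 * r ^ 2 ≤ ‖η‖ ^ 2 := by
      have : r ^ 2 ≤ 1 := by nlinarith [hr.1, hr.2]
      nlinarith [sq_nonneg ‖η‖]
    gcongr
  have h0 : ∀ u ∈ sphere (0 : ℂ) |r|, 0 ≤ (F u).re := by
    intro u hu
    refine le_trans ?_ (hle u hu)
    exact div_nonneg (one_sub_norm_sq_pos hη).le (by positivity)
  calc _ ≤ ∫⁻ θ in Ioo (-Real.pi) Real.pi, ENNReal.ofReal ((F (circleMap 0 r θ)).re) :=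
        lintegral_mono fun θ => ENNReal.ofReal_le_ofReal (hle _ (circleMap_mem_sphere' 0 r θ))
    _ = _ := by
      rw [lintegral_circleMap_eq_circleAverage (h := fun u => (F u).re)
        (Complex.continuous_re.comp_continuousOn hFc) h0, hre, mul_one]

/-! ### Uniform integrability of powers of the derivatives of disc automorphisms -/

/-- The logarithm in the second integrability condition may be dropped: for `q = -1` the first
condition already controls the weight `(1 - r) ^ (-1)`. -/
theorem Admissible.lintegral_lt_top {q : ℝ} {K : ℝ≥0 → ℝ≥0} (hK : Admissible q K) :
    ∫⁻ r in Ioo (0 : ℝ) 1, ENNReal.ofReal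
      ((K (Real.toNNReal (-Real.log r)) : ℝ) * (1 - r) ^ min (-1) q * r) < ∞ := by
  by_cases hq : q = -1
  · have h := ENNReal.mul_lt_top (ENNReal.ofReal_lt_top (r := 2)) hK.1
    rw [← lintegral_const_mul' _ _ ENNReal.ofReal_ne_top] at h
    refine lt_of_le_of_lt (setLIntegral_mono' measurableSet_Ioo fun r hr => ?_) h
    rw [← ENNReal.ofReal_mul (by norm_num)]
    refine ENNReal.ofReal_le_ofReal ?_
    have h1 : 0 < 1 - r := by linarith [hr.2]
    have h2 : (1 - r) ^ min (-1) q ≤ 2 * (1 - r ^ 2) ^ q := by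
      rw [hq, min_self, Real.rpow_neg_one, Real.rpow_neg_one, ← div_eq_mul_inv, inv_eq_one_div,
        div_le_div_iff₀ h1 (by nlinarith [hr.1])]
      nlinarith [hr.1, hr.2]
    calc (K (Real.toNNReal (-Real.log r)) : ℝ) * (1 - r) ^ min (-1) q * r
        ≤ (K (Real.toNNReal (-Real.log r)) : ℝ) * (2 * (1 - r ^ 2) ^ q) * r := by
          have := hr.1.le
          gcongr
      _ = _ := by ring
  · have h := hK.2
    rw [indicator_of_notMem (by simpa using hq)] at h
    simpa using h

/-- Circle averages of `|φ_η'|^(q+2)`, uniformly in `η`. The weight `(1 - r)^min(-1, q)` is that of the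
second integrability condition on `K`. -/
theorem exists_lintegral_autDeriv_rpow_circle_le {q : ℝ} (hq : -2 < q) :
    ∃ c : ℝ, 0 ≤ c ∧ ∀ η ∈ disc, ∀ r ∈ Ioo (0 : ℝ) 1,
      (∫⁻ θ in Ioo (-Real.pi) Real.pi, ENNReal.ofReal (autDeriv η (circleMap 0 r θ) ^ (q + 2))) *
        ENNReal.ofReal ((1 - r ^ 2) ^ q) ≤ ENNReal.ofReal (c * (1 - r) ^ min (-1) q) := by
  -- Linear majorants of `x ^ (q + 2)` reduce the claim to the average of `autDeriv η`.
  have reduce : ∀ η ∈ disc, ∀ r ∈ Ioo (0 : ℝ) 1, ∀ A B : ℝ, 0 ≤ A → 0 ≤ B →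
      (∀ x, 0 < x → x ≤ 2 / (1 - r) → x ^ (q + 2) ≤ A + B * x) →
      (∫⁻ θ in Ioo (-Real.pi) Real.pi,
        ENNReal.ofReal (autDeriv η (circleMap 0 r θ) ^ (q + 2))) ≤
          ENNReal.ofReal (2 * Real.pi * (A + B)) := by
    intro η hη r hr A B hA hB h
    have hmem : ∀ θ, circleMap 0 r θ ∈ disc := fun θ => by
      rw [mem_ball_zero_iff, norm_circleMap_zero, abs_of_pos hr.1]; exact hr.2
    calc _ ≤ ∫⁻ θ in Ioo (-Real.pi) Real.pi, (ENNReal.ofReal A +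
          ENNReal.ofReal B * ENNReal.ofReal (autDeriv η (circleMap 0 r θ))) := by
          refine lintegral_mono fun θ => ?_
          have hpos := autDeriv_pos hη (hmem θ)
          rw [← ENNReal.ofReal_mul hB, ← ENNReal.ofReal_add hA (by positivity)]
          refine ENNReal.ofReal_le_ofReal (h _ hpos ?_)
          have := autDeriv_le_div hη (hmem θ)
          rwa [norm_circleMap_zero, abs_of_pos hr.1] at this
      _ ≤ ENNReal.ofReal A * ENNReal.ofReal (2 * Real.pi) +
          ENNReal.ofReal B * ENNReal.ofReal (2 * Real.pi) := by
          rw [lintegral_add_left (by fun_prop), lintegral_const_mul' _ _ ENNReal.ofReal_ne_top,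
            setLIntegral_const, Real.volume_Ioo]
          refine add_le_add (by rw [sub_neg_eq_add, two_mul])
            (mul_le_mul_right (lintegral_autDeriv_circle_le hη hr) _)
      _ = _ := by
          rw [← add_mul, ← ENNReal.ofReal_add hA hB, ← ENNReal.ofReal_mul (by positivity), mul_comm]
  have hweight : ∀ r ∈ Ioo (0 : ℝ) 1, (1 - r ^ 2) ^ q ≤ 2 ^ |q| * (1 - r) ^ q := by
    intro r hr
    have h1 : 0 < 1 - r := by linarith [hr.2]
    have h2 : 1 - r ^ 2 = (1 + r) * (1 - r) := by ring
    rw [h2, Real.mul_rpow (by linarith [hr.1]) h1.le]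
    gcongr
    calc (1 + r) ^ q ≤ (1 + r) ^ |q| :=
          Real.rpow_le_rpow_of_exponent_le (by linarith [hr.1]) (le_abs_self q)
      _ ≤ 2 ^ |q| := Real.rpow_le_rpow (by linarith [hr.1]) (by linarith [hr.2]) (abs_nonneg q)
  rcases le_or_gt (-1) q with h | h
  · refine ⟨2 * Real.pi * (2 ^ (q + 1) * 2 ^ |q|), by positivity, fun η hη r hr => ?_⟩
    have h1 : 0 < 1 - r := by linarith [hr.2]
    have h2 := reduce η hη r hr 0 ((2 / (1 - r)) ^ (q + 1)) le_rfl (by positivity) (by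
      intro x hx hx2
      rw [zero_add]
      calc x ^ (q + 2) = x ^ (q + 1) * x := by rw [← Real.rpow_add_one hx.ne']; ring_nf
        _ ≤ _ := by gcongr; linarith)
    refine (mul_le_mul_left h2 _).trans ?_
    rw [← ENNReal.ofReal_mul (by positivity)]
    refine ENNReal.ofReal_le_ofReal ?_
    rw [zero_add, min_eq_left h]
    have h3 : (1 - r) ^ (-1 : ℝ) = (1 - r) ^ q / (1 - r) ^ (q + 1) := by
      rw [← Real.rpow_sub h1]; congr 1; ring
    calc 2 * Real.pi * (2 / (1 - r)) ^ (q + 1) * (1 - r ^ 2) ^ q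
        ≤ 2 * Real.pi * (2 / (1 - r)) ^ (q + 1) * (2 ^ |q| * (1 - r) ^ q) := by
          gcongr
          exact hweight r hr
      _ = _ := by rw [h3, Real.div_rpow (by norm_num) h1.le]; ring
  · refine ⟨2 * Real.pi * (2 * 2 ^ |q|), by positivity, fun η hη r hr => ?_⟩
    have h1 : 0 < 1 - r := by linarith [hr.2]
    have h2 := reduce η hη r hr 1 1 zero_le_one zero_le_one (by
      intro x hx _
      rcases le_total x 1 with hx1 | hx1
      · have := Real.rpow_le_one hx.le hx1 (by linarith : 0 ≤ q + 2)
        linarith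
      · have := Real.rpow_le_rpow_of_exponent_le hx1 (by linarith : q + 2 ≤ 1)
        rw [Real.rpow_one] at this
        linarith)
    refine (mul_le_mul_left h2 _).trans ?_
    rw [← ENNReal.ofReal_mul (by positivity)]
    refine ENNReal.ofReal_le_ofReal ?_
    rw [min_eq_right h.le]
    calc 2 * Real.pi * (1 + 1) * (1 - r ^ 2) ^ q
        ≤ 2 * Real.pi * (1 + 1) * (2 ^ |q| * (1 - r) ^ q) := by
          gcongr
          exact hweight r hr
      _ = _ := by ring

theorem measurable_autDeriv (w : ℂ) : Measurable (autDeriv w) := by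
  unfold autDeriv
  fun_prop

/-- Moving `ξ` to the origin turns the integral into a radial one, in which only the circle averages
of a power of `autDeriv` enter. -/
theorem exists_lintegral_autDeriv_le {q : ℝ} (hq : -2 < q) {K : ℝ≥0 → ℝ≥0}
    (hKcont : Continuous K) (hK : Admissible q K) :
    ∃ C : ℝ≥0, ∀ w ∈ disc, ∀ ξ ∈ disc,
      ∫⁻ z in disc, ENNReal.ofReal (autDeriv w z ^ (q + 2)) *
        (ENNReal.ofReal ((1 - ‖z‖ ^ 2) ^ q) * (K (Real.toNNReal (green z ξ)) : ℝ≥0∞)) ≤ C := by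
  obtain ⟨c, hc0, hc⟩ := exists_lintegral_autDeriv_rpow_circle_le hq
  have hJ := ENNReal.mul_lt_top (ENNReal.ofReal_lt_top (r := c)) hK.lintegral_lt_top
  refine ⟨(ENNReal.ofReal c * ∫⁻ r in Ioo (0 : ℝ) 1, ENNReal.ofReal
      ((K (Real.toNNReal (-Real.log r)) : ℝ) * (1 - r) ^ min (-1) q * r)).toNNReal, ?_⟩
  intro w hw ξ hξ
  rw [ENNReal.coe_toNNReal hJ.ne, lintegral_disc_comp_discAut hξ]
  have hη := discAut_mem hξ hw
  set η := discAut ξ w with hη_def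
  have hcongr : ∫⁻ u in disc, ENNReal.ofReal (autDeriv ξ u ^ 2) *
      (ENNReal.ofReal (autDeriv w (discAut ξ u) ^ (q + 2)) *
        (ENNReal.ofReal ((1 - ‖discAut ξ u‖ ^ 2) ^ q) *
          (K (Real.toNNReal (green (discAut ξ u) ξ)) : ℝ≥0∞))) =
      ∫⁻ u in disc, ENNReal.ofReal (autDeriv η u ^ (q + 2)) *
        (ENNReal.ofReal ((1 - ‖u‖ ^ 2) ^ q) *
          (K (Real.toNNReal (-Real.log ‖u‖)) : ℝ≥0∞)) := by
    refine setLIntegral_congr_fun measurableSet_ball fun u hu => ?_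
    have h1 := autDeriv_pos hξ hu
    have h2 := autDeriv_pos hw (discAut_mem hξ hu)
    have h3 := one_sub_norm_sq_pos hu
    rw [green_discAut hξ hu, ← mul_assoc, ← mul_assoc, ← mul_assoc, ← ENNReal.ofReal_mul (by positivity),
      ← ENNReal.ofReal_mul (by positivity), ← ENNReal.ofReal_mul
      (Real.rpow_nonneg (autDeriv_pos hη hu).le _), one_sub_norm_discAut_sq hξ hu,
      ← autDeriv_discAut hw hξ hu, Real.mul_rpow h1.le h3.le, Real.mul_rpow h2.le h1.le,
      Real.rpow_add h1 q 2, Real.rpow_two]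
    congr 2
    ring
  have hmeas : Measurable fun u : ℂ => ENNReal.ofReal (autDeriv η u ^ (q + 2)) *
        (ENNReal.ofReal ((1 - ‖u‖ ^ 2) ^ q) *
          (K (Real.toNNReal (-Real.log ‖u‖)) : ℝ≥0∞)) := by
    have := measurable_autDeriv η
    have := hKcont.measurable
    fun_prop
  rw [hcongr, lintegral_ball_polar hmeas, ← lintegral_const_mul' _ _ ENNReal.ofReal_ne_top]
  refine setLIntegral_mono' measurableSet_Ioo fun r hr => ?_
  have h1r : 0 < 1 - r := by linarith [hr.2]
  have hnorm : ∀ θ, ‖circleMap 0 r θ‖ = r := fun θ => by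
    rw [norm_circleMap_zero, abs_of_pos hr.1]
  simp only [hnorm]
  rw [lintegral_mul_const' _ _ (by finiteness), ← mul_assoc (∫⁻ _ in _, _)]
  refine (mul_le_mul_right (mul_le_mul_left (hc η hη r hr) _) _).trans ?_
  have hKr : (K (Real.toNNReal (-Real.log r)) : ℝ≥0∞) =
    ENNReal.ofReal (K (Real.toNNReal (-Real.log r)) : ℝ) := (ENNReal.ofReal_coe_nnreal).symm
  rw [hKr, ← ENNReal.ofReal_mul (by positivity), ← ENNReal.ofReal_mul hr.1.le,
    ← ENNReal.ofReal_mul hc0]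
  refine (congrArg ENNReal.ofReal ?_).le
  ring

/-- Functions whose derivative is dominated by a power of `|φ_w'|` are bounded in `Q_K(p,q)`,
uniformly in `w`. -/
theorem exists_qkNorm_le_of_autDeriv {p q : ℝ} (hp : 0 < p) (hq : -2 < q) {K : ℝ≥0 → ℝ≥0}
    (hKcont : Continuous K) (hK : Admissible q K) :
    ∃ C : ℝ≥0, ∀ w ∈ disc, ∀ (f : ℂ → ℂ) (B : ℝ), 0 ≤ B →
      (∀ z ∈ disc, ‖deriv f z‖ ≤ B * autDeriv w z ^ ((q + 2) / p)) →
      qkNorm p q K f ≤ ‖f 0‖ₑ + ENNReal.ofReal B * C := by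
  obtain ⟨C, hC⟩ := exists_lintegral_autDeriv_le hq hKcont hK
  refine ⟨((ENNReal.ofReal (1 / Real.pi) * C) ^ (1 / p)).toNNReal, fun w hw f B hB hf => ?_⟩
  have hfin : (ENNReal.ofReal (1 / Real.pi) * C) ^ (1 / p) ≠ ∞ :=
    ENNReal.rpow_ne_top_of_nonneg (by positivity) (by finiteness)
  rw [ENNReal.coe_toNNReal hfin]
  unfold qkNorm
  refine add_le_add_right ?_ _
  have hB' : ENNReal.ofReal B = (ENNReal.ofReal B ^ p) ^ (1 / p) := by
    rw [← ENNReal.rpow_mul, mul_one_div_cancel hp.ne', ENNReal.rpow_one]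
  rw [hB', ← ENNReal.mul_rpow_of_nonneg _ _ (by positivity)]
  refine ENNReal.rpow_le_rpow (iSup₂_le fun ξ hξ => ?_) (by positivity)
  unfold qkIntegral
  rw [mul_left_comm]
  refine mul_le_mul_right ?_ _
  refine le_trans ?_ (mul_le_mul_right (hC w hw ξ hξ) _)
  rw [← lintegral_const_mul' _ _ (ENNReal.rpow_ne_top_of_nonneg hp.le ENNReal.ofReal_ne_top)]
  refine setLIntegral_mono' measurableSet_ball fun z hz => ?_
  rw [← mul_assoc (ENNReal.ofReal B ^ p)]
  refine mul_le_mul_left ?_ _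
  have h1 := autDeriv_pos hw hz
  rw [← ofReal_norm, ENNReal.ofReal_rpow_of_nonneg (norm_nonneg _) hp.le,
    ENNReal.ofReal_rpow_of_nonneg hB hp.le, ← ENNReal.ofReal_mul (by positivity)]
  refine ENNReal.ofReal_le_ofReal ?_
  calc ‖deriv f z‖ ^ p ≤ (B * autDeriv w z ^ ((q + 2) / p)) ^ p :=
        Real.rpow_le_rpow (norm_nonneg _) (hf z hz) hp.le
    _ = _ := by
      rw [Real.mul_rpow hB (by positivity), ← Real.rpow_mul h1.le, div_mul_cancel₀ _ hp.ne']

/-- A bounded derivative is enough for membership in `Q_K(p,q)`. -/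
theorem exists_qkNorm_le_of_deriv_bounded {p q : ℝ} (hp : 0 < p) (hq : -2 < q) {K : ℝ≥0 → ℝ≥0}
    (hKcont : Continuous K) (hK : Admissible q K) :
    ∃ C : ℝ≥0, ∀ (f : ℂ → ℂ) (B : ℝ), 0 ≤ B → (∀ z ∈ disc, ‖deriv f z‖ ≤ B) →
      qkNorm p q K f ≤ ‖f 0‖ₑ + ENNReal.ofReal B * C := by
  obtain ⟨C, hC⟩ := exists_qkNorm_le_of_autDeriv hp hq hKcont hK
  refine ⟨C, fun f B hB hf => hC 0 (mem_ball_self one_pos) f B hB fun z hz => ?_⟩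
  simpa [autDeriv] using hf z hz

/-! ### Growth of functions in `Q_K(p,q)` and of their derivatives -/

theorem three_rpow_neg_abs_le {x q : ℝ} (h1 : 1 / 3 ≤ x) (h2 : x ≤ 3) :
    (3 : ℝ) ^ (-|q|) ≤ x ^ q := by
  rcases le_total 0 q with h | h
  · rw [abs_of_nonneg h, Real.rpow_neg (by norm_num), ← Real.inv_rpow (by norm_num)]
    exact Real.rpow_le_rpow (by norm_num) (by linarith) h
  · rw [abs_of_nonpos h, neg_neg]
    exact Real.rpow_le_rpow_of_nonpos (by linarith) h2 h

/-- The space `Q_K(p,q)` embeds in the Bloch space of the weight `(1 - r) ^ ((q + 2) / p)`: the weight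
`K (green z ξ)` is bounded below on a disc about `ξ` of radius comparable to `1 - ‖ξ‖`. -/
theorem exists_norm_deriv_le {p q : ℝ} (hp : 0 < p) {K : ℝ≥0 → ℝ≥0} (hKmono : Monotone K)
    {t : ℝ≥0} (ht : K t ≠ 0) :
    ∃ C : ℝ, 0 < C ∧ ∀ f ∈ HolDisc, ∀ N : ℝ, 0 ≤ N → qkNorm p q K f ≤ ENNReal.ofReal N →
      ∀ z ∈ disc, ‖deriv f z‖ ≤ C * N * (1 - ‖z‖) ^ (-((q + 2) / p)) := by
  obtain ⟨A, hA0, hA⟩ := exists_area_submean_rpow hp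
  -- `|φ_ξ(z)| ≤ exp (-t)` makes the Green function at least `t`; the bound `1 / 2` keeps the disc of
  -- radius `r₀ (1 - |ξ|)` where `1 - |z|` is comparable to `1 - |ξ|`.
  set r₀ : ℝ := min (Real.exp (-t)) (1 / 2) with hr₀
  have hr₀pos : 0 < r₀ := lt_min (Real.exp_pos _) (by norm_num)
  have hr₀half : r₀ ≤ 1 / 2 := min_le_right _ _
  have hκ : (0 : ℝ) < K t := by exact_mod_cast pos_iff_ne_zero.2 ht
  set D : ℝ := A * Real.pi / ((3 : ℝ) ^ (-|q|) * K t * r₀ ^ 2) with hD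
  have hD0 : 0 < D := by positivity
  refine ⟨D ^ (1 / p), by positivity, fun f hf N hN hfN ξ hξ => ?_⟩
  have hξ1 := norm_lt_one_of_mem_disc hξ
  set d := 1 - ‖ξ‖ with hd
  have hd0 : 0 < d := by linarith
  set R := r₀ * d with hR
  have hR0 : 0 < R := by positivity
  have hRd : R ≤ d / 2 := by nlinarith
  have hsub : closedBall ξ R ⊆ disc := by
    intro z hz
    have h1 := mem_closedBall_iff_norm.1 hz
    have h2 : ‖z‖ ≤ ‖z - ξ‖ + ‖ξ‖ := by simpa using norm_add_le (z - ξ) ξ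
    rw [mem_ball_zero_iff]
    linarith
  have hweight : ∀ z ∈ ball ξ R, (3 : ℝ) ^ (-|q|) * d ^ q ≤ (1 - ‖z‖ ^ 2) ^ q := by
    intro z hz
    have h1 := mem_ball_iff_norm.1 hz
    have h2 : ‖z‖ ≤ ‖z - ξ‖ + ‖ξ‖ := by simpa using norm_add_le (z - ξ) ξ
    have h3 : ‖ξ‖ ≤ ‖z - ξ‖ + ‖z‖ := by
      rw [norm_sub_rev]; simpa using norm_add_le (ξ - z) z
    have h4 := norm_nonneg z
    have h5 : 1 - ‖z‖ ^ 2 = (1 - ‖z‖ ^ 2) / d * d := by field_simp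
    have h6 : 1 / 3 ≤ (1 - ‖z‖ ^ 2) / d := by
      rw [le_div_iff₀ hd0]; nlinarith
    have h7 : (1 - ‖z‖ ^ 2) / d ≤ 3 := by
      rw [div_le_iff₀ hd0]; nlinarith
    rw [h5, Real.mul_rpow (by linarith) hd0.le]
    gcongr
    exact three_rpow_neg_abs_le h6 h7
  have hgreen : ∀ z ∈ ball ξ R, z ≠ ξ → K t ≤ K (Real.toNNReal (green z ξ)) := by
    intro z hz hne
    refine hKmono ?_
    have h1 := mem_ball_iff_norm'.1 hz
    have hzd := hsub (ball_subset_closedBall hz)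
    have h2 : d ≤ ‖1 - (starRingEnd ℂ) ξ * z‖ :=
      one_sub_norm_left_le (norm_lt_one_of_mem_disc hzd).le
    have h3 : ‖discAut ξ z‖ ≤ Real.exp (-t) := by
      refine le_trans ?_ (min_le_left _ (1 / 2))
      rw [discAut, norm_div, div_le_iff₀ (by linarith)]
      exact h1.le.trans (mul_le_mul_of_nonneg_left h2 hr₀pos.le)
    have h4 : 0 < ‖discAut ξ z‖ := norm_pos_iff.2
      (div_ne_zero (sub_ne_zero.2 hne.symm) (den_ne_zero hξ hzd))
    refine NNReal.le_toNNReal_of_coe_le ?_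
    rw [green, one_div, Real.log_inv]
    have := Real.log_le_log h4 h3
    rw [Real.log_exp] at this
    linarith
  have hint : (∫⁻ z in ball ξ R, ‖deriv f z‖ₑ ^ p) *
      ENNReal.ofReal ((3 : ℝ) ^ (-|q|) * d ^ q * K t) ≤
      ENNReal.ofReal (Real.pi * N ^ p) := by
    have h1 : qkIntegral p q K f ξ ≤ ENNReal.ofReal (N ^ p) := by
      have h2 : (⨆ ξ ∈ disc, qkIntegral p q K f ξ) ^ (1 / p) ≤ ENNReal.ofReal N :=
        le_add_self.trans hfN
      rw [one_div, ENNReal.rpow_inv_le_iff hp, ENNReal.ofReal_rpow_of_nonneg hN hp.le] at h2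
      exact (le_iSup₂ (f := fun ξ (_ : ξ ∈ disc) => qkIntegral p q K f ξ) ξ hξ).trans h2
    have h3 : (∫⁻ z in ball ξ R, ‖deriv f z‖ₑ ^ p) *
        ENNReal.ofReal ((3 : ℝ) ^ (-|q|) * d ^ q * K t) ≤
        ∫⁻ z in disc, ‖deriv f z‖ₑ ^ p *
          (ENNReal.ofReal ((1 - ‖z‖ ^ 2) ^ q) * (K (Real.toNNReal (green z ξ)) : ℝ≥0∞)) := by
      rw [← lintegral_mul_const' _ _ ENNReal.ofReal_ne_top]
      refine le_trans ?_ (lintegral_mono_set (ball_subset_closedBall.trans hsub))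
      refine lintegral_mono_ae ?_
      -- At `z = ξ` the pole of the Green function carries the junk value `log (1 / 0) = 0`, so this
      -- point is left out.
      filter_upwards [ae_restrict_mem measurableSet_ball,
        ae_restrict_of_ae (compl_mem_ae_iff.2 (measure_singleton ξ))] with z hz hne
      refine mul_le_mul_right ?_ _
      rw [ENNReal.ofReal_mul (by positivity), ENNReal.ofReal_coe_nnreal]
      exact mul_le_mul' (ENNReal.ofReal_le_ofReal (hweight z hz))
        (ENNReal.coe_le_coe.2 (hgreen z hz hne))
    refine h3.trans ?_
    have h4 := mul_le_mul_right h1 (ENNReal.ofReal Real.pi)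
    rw [qkIntegral, ← mul_assoc, ← ENNReal.ofReal_mul Real.pi_pos.le,
      mul_one_div_cancel Real.pi_pos.ne', ENNReal.ofReal_one, one_mul,
      ← ENNReal.ofReal_mul Real.pi_pos.le] at h4
    exact h4
  have hsm := hA (deriv f) (measurable_deriv f) ξ R hR0 ((hf.1.deriv isOpen_ball).mono hsub)
  have h5 := (mul_le_mul_left hsm (ENNReal.ofReal ((3 : ℝ) ^ (-|q|) * d ^ q * K t))).trans
    ((mul_assoc _ _ _).le.trans (mul_le_mul_right hint _))
  rw [← ENNReal.ofReal_mul (by positivity), ← ENNReal.ofReal_mul (by positivity),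
    ENNReal.ofReal_le_ofReal_iff (by positivity)] at h5
  have h6 : ‖deriv f ξ‖ ^ p ≤ D * N ^ p * d ^ (-(q + 2)) := by
    have h7 : d ^ (-(q + 2)) = (d ^ q * d ^ 2)⁻¹ := by
      rw [Real.rpow_neg hd0.le, Real.rpow_add hd0, Real.rpow_two]
    rw [h7, hD]
    have h8 : 0 < d ^ q := by positivity
    have h9 : 0 < (3 : ℝ) ^ (-|q|) := by positivity
    rw [hR] at h5
    rw [div_mul_eq_mul_div, ← div_eq_mul_inv, div_div, le_div_iff₀ (by positivity)]
    linarith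
  calc ‖deriv f ξ‖ = (‖deriv f ξ‖ ^ p) ^ (1 / p) := by
        rw [← Real.rpow_mul (norm_nonneg _), mul_one_div_cancel hp.ne', Real.rpow_one]
    _ ≤ (D * N ^ p * d ^ (-(q + 2))) ^ (1 / p) := Real.rpow_le_rpow (by positivity) h6 (by positivity)
    _ = _ := by
      rw [Real.mul_rpow (by positivity) (by positivity), Real.mul_rpow (by positivity) (by positivity),
        ← Real.rpow_mul hN, ← Real.rpow_mul hd0.le, mul_one_div_cancel hp.ne', Real.rpow_one]
      rw [neg_mul, mul_one_div]

/-- Cauchy's estimate on the disc of half the distance to the unit circle. -/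
theorem norm_iteratedDeriv_le_of_rpow {g : ℂ → ℂ} (hg : DifferentiableOn ℂ g disc) {B s : ℝ}
    (hB : 0 ≤ B) (h : ∀ z ∈ disc, ‖g z‖ ≤ B * (1 - ‖z‖) ^ s) (k : ℕ) {z : ℂ} (hz : z ∈ disc) :
    ‖iteratedDeriv k g z‖ ≤ k.factorial * 2 ^ k * 3 ^ |s| * B * (1 - ‖z‖) ^ (s - k) := by
  have hz1 := norm_lt_one_of_mem_disc hz
  set d := 1 - ‖z‖ with hd
  have hd0 : 0 < d := by linarith
  have hsub : closedBall z (d / 2) ⊆ disc := by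
    intro u hu
    have h1 := mem_closedBall_iff_norm.1 hu
    have h2 : ‖u‖ ≤ ‖u - z‖ + ‖z‖ := by simpa using norm_add_le (u - z) z
    rw [mem_ball_zero_iff]
    linarith
  have hbd : ∀ u ∈ sphere z (d / 2), ‖g u‖ ≤ B * (3 ^ |s| * d ^ s) := by
    intro u hu
    have hu' := sphere_subset_closedBall hu
    refine (h u (hsub hu')).trans (mul_le_mul_of_nonneg_left ?_ hB)
    have h1 := mem_closedBall_iff_norm.1 hu'
    have h2 : ‖u‖ ≤ ‖u - z‖ + ‖z‖ := by simpa using norm_add_le (u - z) z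
    have h3 : ‖z‖ ≤ ‖u - z‖ + ‖u‖ := by
      rw [norm_sub_rev]; simpa using norm_add_le (z - u) u
    have h4 : 0 < 1 - ‖u‖ := by linarith
    have h6 : 1 / 3 ≤ d / (1 - ‖u‖) := by rw [le_div_iff₀ h4]; linarith
    have h7 : d / (1 - ‖u‖) ≤ 3 := by rw [div_le_iff₀ h4]; linarith
    have h8 := three_rpow_neg_abs_le (q := s) h6 h7
    rw [Real.div_rpow hd0.le h4.le, Real.rpow_neg (by norm_num), le_div_iff₀ (by positivity),
      inv_mul_le_iff₀ (by positivity)] at h8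
    exact h8
  have hdc : DiffContOnCl ℂ g (ball z (d / 2)) :=
    DifferentiableOn.diffContOnCl (hg.mono (closure_ball_subset_closedBall.trans hsub))
  refine (Complex.norm_iteratedDeriv_le_of_forall_mem_sphere_norm_le k (by positivity)
    hdc hbd).trans (le_of_eq ?_)
  rw [Real.rpow_sub hd0, Real.rpow_natCast, div_pow]
  field_simp

theorem iteratedDeriv_succ_bound {f : ℂ → ℂ} (hf : f ∈ HolDisc) {B γ : ℝ} (hB : 0 ≤ B)
    (h : ∀ z ∈ disc, ‖deriv f z‖ ≤ B * (1 - ‖z‖) ^ (-γ)) (k : ℕ) {z : ℂ} (hz : z ∈ disc) :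
    ‖iteratedDeriv (k + 1) f z‖ ≤
      k.factorial * 2 ^ k * 3 ^ |γ| * B * (1 - ‖z‖) ^ (-(γ + k)) := by
  rw [iteratedDeriv_succ']
  have := norm_iteratedDeriv_le_of_rpow (hf.1.deriv isOpen_ball) hB h k hz
  rwa [abs_neg, ← neg_add'] at this

/-- Integration of the derivative bound along a radius. -/
theorem norm_sub_dilation_le {f : ℂ → ℂ} (hf : f ∈ HolDisc) {B γ : ℝ} (hγ : γ ≠ 1)
    (h : ∀ z ∈ disc, ‖deriv f z‖ ≤ B * (1 - ‖z‖) ^ (-γ)) {r : ℝ} (hr : r ∈ Icc (0 : ℝ) 1)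
    {z : ℂ} (hz : z ∈ disc) :
    ‖f z - f (r * z)‖ ≤
      B * (((1 - r * ‖z‖) ^ (1 - γ) - (1 - ‖z‖) ^ (1 - γ)) / (1 - γ)) := by
  have hz1 := norm_lt_one_of_mem_disc hz
  have hγ' : 1 - γ ≠ 0 := sub_ne_zero.2 hγ.symm
  have hpos : ∀ t ∈ Icc r 1, 0 < 1 - t * ‖z‖ := by
    intro t ht
    nlinarith [norm_nonneg z, ht.2]
  have hmem : ∀ t ∈ Icc r 1, (t : ℂ) * z ∈ disc := by
    intro t ht
    have := hpos t ht
    rw [mem_ball_zero_iff, norm_mul, Complex.norm_real, Real.norm_of_nonneg (hr.1.trans ht.1)]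
    linarith
  have hder : ∀ t ∈ Icc r 1, HasDerivAt (fun t : ℝ => f (t * z)) (deriv f (t * z) * z) t := by
    intro t ht
    have h1 := (HolDisc.differentiableAt hf (hmem t ht)).hasDerivAt
    have h2 : HasDerivAt (fun t : ℂ => t * z) z (t : ℂ) := by
      simpa using (hasDerivAt_id (t : ℂ)).mul_const z
    exact (h1.comp (t : ℂ) h2).comp_ofReal
  have hBder : ∀ t ∈ Icc r 1, HasDerivAt
      (fun t : ℝ => B * (((1 - r * ‖z‖) ^ (1 - γ) - (1 - t * ‖z‖) ^ (1 - γ)) / (1 - γ)))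
      (B * ((1 - t * ‖z‖) ^ (-γ) * ‖z‖)) t := by
    intro t ht
    have h1 : HasDerivAt (fun t : ℝ => 1 - t * ‖z‖) (-‖z‖) t := by
      simpa using ((hasDerivAt_id t).mul_const ‖z‖).const_sub 1
    have h2 := ((h1.rpow_const (p := 1 - γ) (Or.inl (hpos t ht).ne')).const_sub
      ((1 - r * ‖z‖) ^ (1 - γ))).div_const (1 - γ)
    convert! h2.const_mul B using 1
    have h3 : 1 - γ - 1 = -γ := by ring
    rw [h3]
    field_simp
  have key := image_norm_le_of_norm_deriv_right_le_deriv_boundary' (a := r) (b := 1)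
    (f := fun t : ℝ => f (t * z) - f (r * z)) (f' := fun t => deriv f (t * z) * z)
    (B := fun t : ℝ => B * (((1 - r * ‖z‖) ^ (1 - γ) - (1 - t * ‖z‖) ^ (1 - γ)) / (1 - γ)))
    (B' := fun t => B * ((1 - t * ‖z‖) ^ (-γ) * ‖z‖))
    (fun t ht => ((hder t ht).continuousAt.sub continuousAt_const).continuousWithinAt)
    (fun t ht => ((hder t ⟨ht.1, ht.2.le⟩).sub_const _).hasDerivWithinAt)
    (by simp)
    (fun t ht => (hBder t ht).continuousAt.continuousWithinAt)
    (fun t ht => (hBder t ⟨ht.1, ht.2.le⟩).hasDerivWithinAt)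
    (fun t ht => by
      have h1 := h _ (hmem t ⟨ht.1, ht.2.le⟩)
      rw [norm_mul, Complex.norm_real, Real.norm_of_nonneg (hr.1.trans ht.1)] at h1
      rw [norm_mul, ← mul_assoc]
      exact mul_le_mul_of_nonneg_right h1 (norm_nonneg z))
  simpa using key (right_mem_Icc.2 hr.2)

/-! ### The operator on holomorphic functions and the derivative of its values -/

theorem HolDisc.contDiffAt {f : ℂ → ℂ} (hf : f ∈ HolDisc) {z : ℂ} (hz : z ∈ disc) {k : ℕ} :
    ContDiffAt ℂ k f z :=
  (hf.1.analyticAt (isOpen_ball.mem_nhds hz)).contDiffAt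

theorem HolDisc.differentiableAt_iteratedDeriv {f : ℂ → ℂ} (hf : f ∈ HolDisc) (k : ℕ) {z : ℂ}
    (hz : z ∈ disc) : DifferentiableAt ℂ (iteratedDeriv k f) z := by
  rw [iteratedDeriv_eq_iterate]
  exact ((hf.1.analyticAt (isOpen_ball.mem_nhds hz)).iterated_deriv k).differentiableAt

theorem indicator_mem_HolDisc {g : ℂ → ℂ} (hg : DifferentiableOn ℂ g disc) :
    disc.indicator g ∈ HolDisc :=
  ⟨hg.congr fun _ hz => indicator_of_mem hz g, fun _ hz => indicator_of_notMem hz g⟩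

theorem indicator_eventuallyEq {g : ℂ → ℂ} {z : ℂ} (hz : z ∈ disc) :
    disc.indicator g =ᶠ[𝓝 z] g := by
  filter_upwards [isOpen_ball.mem_nhds hz] with u hu using indicator_of_mem hu g

theorem deriv_indicator {g : ℂ → ℂ} {z : ℂ} (hz : z ∈ disc) :
    deriv (disc.indicator g) z = deriv g z :=
  (indicator_eventuallyEq hz).deriv_eq

theorem iteratedDeriv_indicator {g : ℂ → ℂ} {z : ℂ} (hz : z ∈ disc) (k : ℕ) :
    iteratedDeriv k (disc.indicator g) z = iteratedDeriv k g z :=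
  (indicator_eventuallyEq hz).iteratedDeriv_eq k

/-- The operator as a linear map on `H(D)`. -/
def steShaLin (n : ℕ) (ψ₁ ψ₂ φ : ℂ → ℂ) (hφ : MapsTo φ disc disc) :
    HolDisc →ₗ[ℂ] (ℂ → ℂ) where
  toFun f := steSha n ψ₁ ψ₂ φ f
  map_add' f g := by
    ext z
    by_cases hz : z ∈ disc
    · simp only [steSha, indicator_of_mem hz, Pi.add_apply, Submodule.coe_add]
      rw [iteratedDeriv_add (HolDisc.contDiffAt f.2 (hφ hz)) (HolDisc.contDiffAt g.2 (hφ hz)),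
        iteratedDeriv_add (HolDisc.contDiffAt f.2 (hφ hz)) (HolDisc.contDiffAt g.2 (hφ hz))]
      ring
    · simp [steSha, indicator_of_notMem hz]
  map_smul' c f := by
    ext z
    by_cases hz : z ∈ disc
    · simp only [steSha, indicator_of_mem hz, Pi.smul_apply, Submodule.coe_smul, smul_eq_mul,
        RingHom.id_apply]
      rw [iteratedDeriv_const_smul_field, iteratedDeriv_const_smul_field]
      simp only [smul_eq_mul]
      ring
    · simp [steSha, indicator_of_notMem hz]

theorem steSha_sub {n : ℕ} {ψ₁ ψ₂ φ : ℂ → ℂ} (hφ : MapsTo φ disc disc) {f g : ℂ → ℂ}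
    (hf : f ∈ HolDisc) (hg : g ∈ HolDisc) :
    steSha n ψ₁ ψ₂ φ (f - g) = steSha n ψ₁ ψ₂ φ f - steSha n ψ₁ ψ₂ φ g :=
  (steShaLin n ψ₁ ψ₂ φ hφ).map_sub ⟨f, hf⟩ ⟨g, hg⟩

theorem steSha_smul {n : ℕ} {ψ₁ ψ₂ φ : ℂ → ℂ} (hφ : MapsTo φ disc disc) {f : ℂ → ℂ}
    (hf : f ∈ HolDisc) (c : ℂ) :
    steSha n ψ₁ ψ₂ φ (c • f) = c • steSha n ψ₁ ψ₂ φ f :=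
  (steShaLin n ψ₁ ψ₂ φ hφ).map_smul c ⟨f, hf⟩

theorem deriv_steSha (n : ℕ) {ψ₁ ψ₂ φ : ℂ → ℂ} (h₁ : DifferentiableOn ℂ ψ₁ disc)
    (h₂ : DifferentiableOn ℂ ψ₂ disc) (h₃ : DifferentiableOn ℂ φ disc) (hφ : MapsTo φ disc disc)
    {f : ℂ → ℂ} (hf : f ∈ HolDisc) {z : ℂ} (hz : z ∈ disc) :
    deriv (steSha n ψ₁ ψ₂ φ f) z =
      deriv ψ₁ z * iteratedDeriv n f (φ z) +
        (ψ₁ z * deriv φ z + deriv ψ₂ z) * iteratedDeriv (n + 1) f (φ z) +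
        ψ₂ z * deriv φ z * iteratedDeriv (n + 2) f (φ z) := by
  have hn := isOpen_ball.mem_nhds hz
  have d₁ := (h₁.differentiableAt hn).hasDerivAt
  have d₂ := (h₂.differentiableAt hn).hasDerivAt
  have d₃ := (h₃.differentiableAt hn).hasDerivAt
  have e₁ := (HolDisc.differentiableAt_iteratedDeriv hf n (hφ hz)).hasDerivAt
  have e₂ := (HolDisc.differentiableAt_iteratedDeriv hf (n + 1) (hφ hz)).hasDerivAt
  rw [← iteratedDeriv_succ] at e₁ e₂
  rw [steSha, deriv_indicator hz]
  have := (d₁.mul (e₁.comp z d₃)).add (d₂.mul (e₂.comp z d₃))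
  refine this.deriv.trans ?_
  simp only [Function.comp_apply]
  ring

/-! ### The weighted Bloch norm and the `Q_K` quasi-norm -/

theorem blochNorm_add_le (m : ℝ → ℝ) {f g : ℂ → ℂ} (hf : f ∈ HolDisc) (hg : g ∈ HolDisc) :
    blochNorm m (f + g) ≤ blochNorm m f + blochNorm m g := by
  unfold blochNorm
  rw [add_add_add_comm]
  refine add_le_add (enorm_add_le _ _) (iSup₂_le fun z hz => ?_)
  rw [deriv_add (HolDisc.differentiableAt hf hz) (HolDisc.differentiableAt hg hz)]
  refine (mul_le_mul_right (enorm_add_le _ _) _).trans ?_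
  rw [mul_add]
  exact add_le_add
    (le_iSup₂ (f := fun z (_ : z ∈ disc) => ENNReal.ofReal (m ‖z‖) * ‖deriv f z‖ₑ) z hz)
    (le_iSup₂ (f := fun z (_ : z ∈ disc) => ENNReal.ofReal (m ‖z‖) * ‖deriv g z‖ₑ) z hz)

theorem blochNorm_smul_le (m : ℝ → ℝ) {f : ℂ → ℂ} (hf : f ∈ HolDisc) (c : ℂ) :
    blochNorm m (c • f) ≤ ‖c‖ₑ * blochNorm m f := by
  unfold blochNorm
  rw [mul_add]
  refine add_le_add (by simp [enorm_mul]) (iSup₂_le fun z hz => ?_)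
  rw [deriv_const_smul c (HolDisc.differentiableAt hf hz), enorm_smul, mul_left_comm]
  exact mul_le_mul_right
    (le_iSup₂ (f := fun z (_ : z ∈ disc) => ENNReal.ofReal (m ‖z‖) * ‖deriv f z‖ₑ) z hz) _

theorem blochNorm_sub_le (m : ℝ → ℝ) {f g : ℂ → ℂ} (hf : f ∈ HolDisc) (hg : g ∈ HolDisc) :
    blochNorm m (f - g) ≤ blochNorm m f + blochNorm m g := by
  have h1 : f - g = f + (-1 : ℂ) • g := by rw [neg_one_smul, sub_eq_add_neg]
  rw [h1]
  refine (blochNorm_add_le m hf (HolDisc.smul_mem _ hg)).trans (add_le_add_right ?_ _)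
  simpa using blochNorm_smul_le m hg (-1)

theorem blochNorm_zero (m : ℝ → ℝ) : blochNorm m 0 = 0 := by
  simp [blochNorm]

theorem blochNorm_sum_le (m : ℝ → ℝ) {ι : Type*} (s : Finset ι) (f : ι → ℂ → ℂ)
    (hf : ∀ i ∈ s, f i ∈ HolDisc) :
    blochNorm m (∑ i ∈ s, f i) ≤ ∑ i ∈ s, blochNorm m (f i) := by
  classical
  induction s using Finset.induction_on with
  | empty => simp [blochNorm_zero]
  | insert a s ha ih =>
    rw [Finset.sum_insert ha, Finset.sum_insert ha]
    have h1 : ∀ i ∈ s, f i ∈ HolDisc := fun i hi => hf i (Finset.mem_insert_of_mem hi)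
    exact (blochNorm_add_le m (hf a (Finset.mem_insert_self a s)) (HolDisc.sum_mem h1)).trans
      (add_le_add_right (ih h1) _)

theorem mul_enorm_deriv_le_blochNorm (m : ℝ → ℝ) (f : ℂ → ℂ) {z : ℂ} (hz : z ∈ disc) :
    ENNReal.ofReal (m ‖z‖) * ‖deriv f z‖ₑ ≤ blochNorm m f :=
  (le_iSup₂ (f := fun z (_ : z ∈ disc) => ENNReal.ofReal (m ‖z‖) * ‖deriv f z‖ₑ) z hz).trans
    le_add_self

theorem qkNorm_smul {p : ℝ} (hp : 0 < p) (q : ℝ) (K : ℝ≥0 → ℝ≥0) {f : ℂ → ℂ}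
    (hf : f ∈ HolDisc) (c : ℂ) :
    qkNorm p q K (c • f) = ‖c‖ₑ * qkNorm p q K f := by
  unfold qkNorm
  simp only [qkIntegral_smul hp q K hf c]
  rw [mul_add, Pi.smul_apply, enorm_smul]
  congr 1
  simp only [← ENNReal.mul_iSup]
  rw [ENNReal.mul_rpow_of_nonneg _ _ (by positivity), ← ENNReal.rpow_mul,
    mul_one_div_cancel hp.ne', ENNReal.rpow_one]

/-- The quasi-triangle inequality. -/
theorem exists_qkNorm_sub_le {p : ℝ} (hp : 0 < p) (q : ℝ) (K : ℝ≥0 → ℝ≥0) :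
    ∃ κ : ℝ≥0, ∀ f ∈ HolDisc, ∀ g ∈ HolDisc, ∀ B : ℝ≥0, qkNorm p q K f ≤ B → qkNorm p q K g ≤ B →
      qkNorm p q K (f - g) ≤ κ * B := by
  refine ⟨2 + 2 * 2 ^ (1 / p), fun f hf g hg B hfB hgB => ?_⟩
  have hint : ∀ h : ℂ → ℂ, qkNorm p q K h ≤ B → ∀ ξ ∈ disc, qkIntegral p q K h ξ ≤ (B : ℝ≥0∞) ^ p := by
    intro h hB ξ hξ
    have h1 : (⨆ ξ ∈ disc, qkIntegral p q K h ξ) ^ (1 / p) ≤ (B : ℝ≥0∞) := le_add_self.trans hB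
    rw [one_div, ENNReal.rpow_inv_le_iff hp] at h1
    exact (le_iSup₂ (f := fun ξ (_ : ξ ∈ disc) => qkIntegral p q K h ξ) ξ hξ).trans h1
  have hneg : f - g = f + (-1 : ℂ) • g := by rw [neg_one_smul, sub_eq_add_neg]
  have hgB' : qkNorm p q K ((-1 : ℂ) • g) ≤ B := by rw [qkNorm_smul hp q K hg]; simpa using hgB
  have h0 : ‖(f - g) 0‖ₑ ≤ 2 * B := by
    rw [two_mul]
    exact (enorm_sub_le).trans (add_le_add (le_self_add.trans hfB) (le_self_add.trans hgB))
  have h1 : (⨆ ξ ∈ disc, qkIntegral p q K (f - g) ξ) ^ (1 / p) ≤ 2 * 2 ^ (1 / p) * B := by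
    have h2 : ∀ ξ ∈ disc, qkIntegral p q K (f - g) ξ ≤ 2 ^ p * (2 * (B : ℝ≥0∞) ^ p) := by
      intro ξ hξ
      rw [hneg]
      refine (qkIntegral_add_le hp q K hf (HolDisc.smul_mem _ hg) ξ).trans (mul_le_mul_right ?_ _)
      rw [two_mul]
      exact add_le_add (hint f hfB ξ hξ) (hint _ hgB' ξ hξ)
    refine (ENNReal.rpow_le_rpow (iSup₂_le h2) (by positivity)).trans (le_of_eq ?_)
    rw [ENNReal.mul_rpow_of_nonneg _ _ (by positivity), ENNReal.mul_rpow_of_nonneg _ _ (by positivity),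
      ← ENNReal.rpow_mul, ← ENNReal.rpow_mul, mul_one_div_cancel hp.ne', ENNReal.rpow_one,
      ENNReal.rpow_one, mul_assoc]
  unfold qkNorm
  refine (add_le_add h0 h1).trans (le_of_eq ?_)
  rw [← add_mul]
  congr 1
  push_cast
  rw [ENNReal.coe_rpow_of_nonneg _ (by positivity)]
  simp

theorem IsBoundedOp.mem_bloch {p q : ℝ} {K : ℝ≥0 → ℝ≥0} {hp : 0 < p} {m : ℝ → ℝ}
    {T : (ℂ → ℂ) → (ℂ → ℂ)} (hT : IsBoundedOp p q K hp m T) {f : ℂ → ℂ} (hf : f ∈ QK p q K hp) :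
    T f ∈ Bloch m := by
  obtain ⟨_, hM⟩ := hT
  exact (hM f hf).1

/-! ### Test functions -/

/-- The test function `(1 - |w|²)^(γ+1) (z - w)^k (1 - conj w * z)^(-(2γ+k))` on the disc. It vanishes
to order `k` at `w`, and its derivative is dominated by `|φ_w'|^γ`. -/
def testFun (γ : ℝ) (k : ℕ) (w : ℂ) : ℂ → ℂ :=
  disc.indicator fun z => (((1 - ‖w‖ ^ 2) ^ (γ + 1) : ℝ) : ℂ) *
    ((z - w) ^ k * (1 - (starRingEnd ℂ) w * z) ^ ((-(2 * γ + k) : ℝ) : ℂ))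

theorem den_mem_slitPlane {w z : ℂ} (hw : w ∈ disc) (hz : z ∈ disc) :
    1 - (starRingEnd ℂ) w * z ∈ Complex.slitPlane := by
  rw [sub_eq_add_neg]
  refine Complex.mem_slitPlane_of_norm_lt_one ?_
  rw [norm_neg, norm_mul, RCLike.norm_conj]
  have h1 := norm_lt_one_of_mem_disc hw
  have h2 := norm_lt_one_of_mem_disc hz
  nlinarith [norm_nonneg w, norm_nonneg z]

theorem hasDerivAt_cpow_den {w z : ℂ} (hw : w ∈ disc) (hz : z ∈ disc) (s : ℝ) :
    HasDerivAt (fun z => (1 - (starRingEnd ℂ) w * z) ^ (s : ℂ))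
      (s * (1 - (starRingEnd ℂ) w * z) ^ ((s - 1 : ℝ) : ℂ) * -(starRingEnd ℂ) w) z := by
  have h1 : HasDerivAt (fun z => 1 - (starRingEnd ℂ) w * z) (-(starRingEnd ℂ) w) z := by
    simpa using ((hasDerivAt_id z).const_mul ((starRingEnd ℂ) w)).const_sub 1
  have := h1.cpow_const (c := (s : ℂ)) (den_mem_slitPlane hw hz)
  rwa [Complex.ofReal_sub, Complex.ofReal_one]

theorem testFun_mem_HolDisc (γ : ℝ) (k : ℕ) {w : ℂ} (hw : w ∈ disc) : testFun γ k w ∈ HolDisc := by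
  refine indicator_mem_HolDisc (DifferentiableOn.const_mul (DifferentiableOn.mul (by fun_prop) ?_) _)
  exact fun z hz => (hasDerivAt_cpow_den hw hz _).differentiableAt.differentiableWithinAt

theorem norm_testFun_zero_le {γ : ℝ} (hγ : 0 ≤ γ) (k : ℕ) {w : ℂ} (hw : w ∈ disc) :
    ‖testFun γ k w 0‖ ≤ 1 := by
  have h1 := one_sub_norm_sq_pos hw
  have h2 := norm_lt_one_of_mem_disc hw
  rw [testFun, indicator_of_mem (mem_ball_self one_pos)]
  simp only [mul_zero, sub_zero, Complex.one_cpow, mul_one, zero_sub, norm_mul, norm_pow, norm_neg,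
    Complex.norm_real]
  rw [Real.norm_of_nonneg (by positivity)]
  exact mul_le_one₀ (Real.rpow_le_one h1.le (by nlinarith [norm_nonneg w]) (by linarith))
    (by positivity) (pow_le_one₀ (norm_nonneg w) h2.le)

theorem norm_testFun_le {γ : ℝ} (hγ : 0 ≤ γ) (k : ℕ) {w z : ℂ} (hw : w ∈ disc) (hz : z ∈ disc) :
    ‖testFun γ k w z‖ ≤ (1 - ‖w‖ ^ 2) ^ (γ + 1) * (1 - ‖z‖) ^ (-(2 * γ)) := by
  have h1 := one_sub_norm_sq_pos hw
  have hD := norm_den_pos hw (norm_lt_one_of_mem_disc hz).le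
  rw [testFun, indicator_of_mem hz]
  simp only [norm_mul, norm_pow, Complex.norm_real, Complex.norm_cpow_real]
  rw [Real.norm_of_nonneg (by positivity)]
  refine mul_le_mul_of_nonneg_left ?_ (by positivity)
  rw [norm_sub_rev]
  calc ‖w - z‖ ^ k * ‖1 - (starRingEnd ℂ) w * z‖ ^ (-(2 * γ + k))
      ≤ ‖1 - (starRingEnd ℂ) w * z‖ ^ k * ‖1 - (starRingEnd ℂ) w * z‖ ^ (-(2 * γ + k)) := by
        gcongr
        exact norm_num_le_norm_den hw hz
    _ = ‖1 - (starRingEnd ℂ) w * z‖ ^ (-(2 * γ)) := by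
        rw [← Real.rpow_natCast, ← Real.rpow_add hD]; congr 1; ring
    _ ≤ _ := Real.rpow_le_rpow_of_nonpos (sub_pos.2 (norm_lt_one_of_mem_disc hz))
        (one_sub_norm_right_le (norm_lt_one_of_mem_disc hw).le) (by linarith)

theorem norm_deriv_testFun_le {γ : ℝ} (hγ : 0 ≤ γ) (k : ℕ) {w z : ℂ} (hw : w ∈ disc)
    (hz : z ∈ disc) :
    ‖deriv (testFun γ k w) z‖ ≤ 2 * (k + (2 * γ + k)) * autDeriv w z ^ γ := by
  have hw1 := norm_lt_one_of_mem_disc hw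
  have h1 := one_sub_norm_sq_pos hw
  have hD := norm_den_pos hw (norm_lt_one_of_mem_disc hz).le
  have hnum := norm_num_le_norm_den hw hz
  have hDw := one_sub_norm_left_le (w := w) (norm_lt_one_of_mem_disc hz).le
  set D := ‖1 - (starRingEnd ℂ) w * z‖ with hDdef
  have hder := ((((hasDerivAt_id z).sub_const w).pow k).mul
    (hasDerivAt_cpow_den hw hz (-(2 * γ + k)))).const_mul (((1 - ‖w‖ ^ 2) ^ (γ + 1) : ℝ) : ℂ)
  have hval : deriv (testFun γ k w) z = _ := (deriv_indicator hz).trans hder.deriv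
  rw [hval]
  simp only [id_eq, mul_one, Pi.pow_apply, norm_mul, Complex.norm_real]
  rw [Real.norm_of_nonneg (by positivity)]
  have hA : ‖(k : ℂ) * (z - w) ^ (k - 1) *
      (1 - (starRingEnd ℂ) w * z) ^ ((-(2 * γ + k) : ℝ) : ℂ)‖ ≤ k * D ^ (-(2 * γ) - 1) := by
    rw [norm_mul, norm_mul, norm_pow, Complex.norm_cpow_real, Complex.norm_natCast, norm_sub_rev,
      mul_assoc]
    rcases Nat.eq_zero_or_pos k with rfl | hk
    · simp
    · refine mul_le_mul_of_nonneg_left ?_ (by positivity)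
      calc ‖w - z‖ ^ (k - 1) * D ^ (-(2 * γ + k)) ≤ D ^ (k - 1) * D ^ (-(2 * γ + k)) := by gcongr
        _ = _ := by
          rw [← Real.rpow_natCast, ← Real.rpow_add hD]
          congr 1
          push_cast [hk]
          ring
  have hB : ‖(z - w) ^ k * (((-(2 * γ + k) : ℝ) : ℂ) *
      (1 - (starRingEnd ℂ) w * z) ^ ((-(2 * γ + k) - 1 : ℝ) : ℂ) * -(starRingEnd ℂ) w)‖ ≤
      (2 * γ + k) * D ^ (-(2 * γ) - 1) := by
    rw [norm_mul, norm_mul, norm_mul, norm_pow, Complex.norm_cpow_real, norm_neg, RCLike.norm_conj,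
      Complex.norm_real, norm_neg, Real.norm_of_nonneg (by positivity), norm_sub_rev]
    calc ‖w - z‖ ^ k * ((2 * γ + k) * D ^ (-(2 * γ + k) - 1) * ‖w‖)
        ≤ D ^ k * ((2 * γ + k) * D ^ (-(2 * γ + k) - 1) * 1) := by gcongr
      _ = (2 * γ + k) * (D ^ k * D ^ (-(2 * γ + k) - 1)) := by ring
      _ = _ := by
        rw [← Real.rpow_natCast, ← Real.rpow_add hD]
        congr 2
        ring
  have hsum := (norm_add_le _ _).trans (add_le_add hA hB)
  rw [← add_mul] at hsum
  calc _ ≤ (1 - ‖w‖ ^ 2) ^ (γ + 1) * ((k + (2 * γ + k)) * D ^ (-(2 * γ) - 1)) :=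
        mul_le_mul_of_nonneg_left hsum (by positivity)
    _ = (k + (2 * γ + k)) * ((1 - ‖w‖ ^ 2) / D) * autDeriv w z ^ γ := by
        rw [autDeriv, Real.div_rpow h1.le (by positivity), ← hDdef, Real.rpow_add h1,
          Real.rpow_one, Real.rpow_sub hD, Real.rpow_one, Real.rpow_neg hD.le,
          Real.rpow_mul hD.le, Real.rpow_two]
        field_simp
    _ ≤ (k + (2 * γ + k)) * 2 * autDeriv w z ^ γ := by
        have h2 : (1 - ‖w‖ ^ 2) / D ≤ 2 := by
          rw [div_le_iff₀ hD]; nlinarith [norm_nonneg w]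
        have := (autDeriv_pos hw hz).le
        gcongr
    _ = _ := by ring

theorem exists_qkNorm_testFun_le {p q : ℝ} (hp : 0 < p) (hq : -2 < q) {K : ℝ≥0 → ℝ≥0}
    (hKcont : Continuous K) (hK : Admissible q K) (k : ℕ) :
    ∃ B : ℝ≥0, ∀ w ∈ disc, qkNorm p q K (testFun ((q + 2) / p) k w) ≤ B := by
  obtain ⟨C, hC⟩ := exists_qkNorm_le_of_autDeriv hp hq hKcont hK
  have hγ : 0 ≤ (q + 2) / p := div_nonneg (by linarith) hp.le
  refine ⟨1 + Real.toNNReal (2 * (k + (2 * ((q + 2) / p) + k))) * C, fun w hw => ?_⟩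
  refine (hC w hw _ _ (by positivity) fun z hz => norm_deriv_testFun_le hγ k hw hz).trans ?_
  push_cast
  refine add_le_add ?_ le_rfl
  rw [← ofReal_norm, ← ENNReal.ofReal_one]
  exact ENNReal.ofReal_le_ofReal (norm_testFun_zero_le hγ k hw)

/-- Derivatives at the centre of a function with a zero of order `k`. -/
theorem iteratedDeriv_pow_mul (k : ℕ) : ∀ {g : ℂ → ℂ} {w : ℂ}, AnalyticAt ℂ g w →
    (∀ i < k, iteratedDeriv i (fun z => (z - w) ^ k * g z) w = 0) ∧
      iteratedDeriv k (fun z => (z - w) ^ k * g z) w = k.factorial * g w := by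
  induction k with
  | zero => intro g w _; simp
  | succ k ih =>
    intro g w hg
    have hev : deriv (fun z => (z - w) ^ (k + 1) * g z) =ᶠ[𝓝 w]
        fun z => (z - w) ^ k * ((k + 1) * g z + (z - w) * deriv g z) := by
      filter_upwards [hg.eventually_analyticAt] with z hz
      have h := (((hasDerivAt_id z).sub_const w).pow (k + 1)).mul hz.differentiableAt.hasDerivAt
      refine h.deriv.trans ?_
      simp
      ring
    have hg' : AnalyticAt ℂ (fun z => (k + 1) * g z + (z - w) * deriv g z) w := by
      have := hg.deriv
      fun_prop
    obtain ⟨ih0, ih1⟩ := ih hg'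
    constructor
    · intro i hi
      rcases i with _ | i
      · simp
      · rw [iteratedDeriv_succ', hev.iteratedDeriv_eq]
        exact ih0 i (by omega)
    · rw [iteratedDeriv_succ', hev.iteratedDeriv_eq, ih1, Nat.factorial_succ]
      push_cast
      simp
      ring

theorem testFun_iteratedDeriv_self (γ : ℝ) (k : ℕ) {w : ℂ} (hw : w ∈ disc) :
    (∀ i < k, iteratedDeriv i (testFun γ k w) w = 0) ∧
      ‖iteratedDeriv k (testFun γ k w) w‖ = k.factorial * (1 - ‖w‖ ^ 2) ^ (1 - γ - k) := by
  have h1 := one_sub_norm_sq_pos hw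
  set g : ℂ → ℂ := fun z => (((1 - ‖w‖ ^ 2) ^ (γ + 1) : ℝ) : ℂ) *
    (1 - (starRingEnd ℂ) w * z) ^ ((-(2 * γ + k) : ℝ) : ℂ) with hg
  have hgan : AnalyticAt ℂ g w := by
    have hd : DifferentiableOn ℂ g disc := fun z hz =>
      ((hasDerivAt_cpow_den hw hz _).differentiableAt.const_mul _).differentiableWithinAt
    exact hd.analyticAt (isOpen_ball.mem_nhds hw)
  have heq : ∀ i, iteratedDeriv i (testFun γ k w) w =
      iteratedDeriv i (fun z => (z - w) ^ k * g z) w := by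
    intro i
    rw [testFun, iteratedDeriv_indicator hw]
    congr 1
    ext z
    rw [hg]
    ring
  obtain ⟨h0, hk⟩ := iteratedDeriv_pow_mul k hgan
  refine ⟨fun i hi => (heq i).trans (h0 i hi), ?_⟩
  rw [heq, hk, hg, norm_mul, Complex.norm_natCast, norm_mul, Complex.norm_cpow_real,
    Complex.norm_real, Real.norm_of_nonneg (by positivity)]
  have h2 : ‖1 - (starRingEnd ℂ) w * w‖ = 1 - ‖w‖ ^ 2 := by
    rw [← ofReal_norm_sq, ← Complex.ofReal_one, ← Complex.ofReal_sub, Complex.norm_real,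
      Real.norm_of_nonneg h1.le]
  rw [h2, ← Real.rpow_add h1]
  congr 2
  ring

theorem norm_iteratedDeriv_testFun_le {γ : ℝ} (hγ : 0 ≤ γ) (k i : ℕ) {w z : ℂ} (hw : w ∈ disc)
    (hz : z ∈ disc) :
    ‖iteratedDeriv i (testFun γ k w) z‖ ≤
      i.factorial * 2 ^ i * 3 ^ (2 * γ) * (1 - ‖w‖ ^ 2) ^ (γ + 1) * (1 - ‖z‖) ^ (-(2 * γ) - i) := by
  have h1 := one_sub_norm_sq_pos hw
  have := norm_iteratedDeriv_le_of_rpow (testFun_mem_HolDisc γ k hw).1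
    (by positivity) (fun z hz => norm_testFun_le hγ k hw hz) i hz
  rwa [abs_neg, abs_of_nonneg (by positivity : 0 ≤ 2 * γ)] at this

theorem exists_norm_iteratedDeriv_testFun_self_le {γ : ℝ} (hγ : 0 ≤ γ) (i : ℕ) :
    ∃ C : ℝ, 0 ≤ C ∧ ∀ k : ℕ, ∀ w ∈ disc,
      ‖iteratedDeriv i (testFun γ k w) w‖ ≤ C * (1 - ‖w‖ ^ 2) ^ (1 - γ - i) := by
  refine ⟨i.factorial * 2 ^ i * 3 ^ (2 * γ) * 2 ^ (2 * γ + i), by positivity, fun k w hw => ?_⟩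
  have h1 := one_sub_norm_sq_pos hw
  have h2 := norm_lt_one_of_mem_disc hw
  refine (norm_iteratedDeriv_testFun_le hγ k i hw hw).trans ?_
  have h3 : (1 - ‖w‖) ^ (-(2 * γ) - i) ≤ ((1 - ‖w‖ ^ 2) / 2) ^ (-(2 * γ) - i) := by
    refine Real.rpow_le_rpow_of_nonpos (by positivity) (by nlinarith [norm_nonneg w]) ?_
    have : (0 : ℝ) ≤ i := by positivity
    linarith
  have h4 : ((1 - ‖w‖ ^ 2) / 2) ^ (-(2 * γ) - i) =
      2 ^ (2 * γ + i) * (1 - ‖w‖ ^ 2) ^ (-(2 * γ) - i) := by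
    rw [Real.div_rpow h1.le (by norm_num), div_eq_mul_inv, ← Real.rpow_neg (by norm_num), mul_comm]
    congr 2
    ring
  calc _ ≤ i.factorial * 2 ^ i * 3 ^ (2 * γ) * (1 - ‖w‖ ^ 2) ^ (γ + 1) *
        (2 ^ (2 * γ + i) * (1 - ‖w‖ ^ 2) ^ (-(2 * γ) - i)) := by
        rw [← h4]; gcongr
    _ = i.factorial * 2 ^ i * 3 ^ (2 * γ) * 2 ^ (2 * γ + i) *
        ((1 - ‖w‖ ^ 2) ^ (γ + 1) * (1 - ‖w‖ ^ 2) ^ (-(2 * γ) - i)) := by ring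
    _ = _ := by
      rw [← Real.rpow_add h1]
      congr 2
      ring

theorem tendsto_iteratedDeriv_testFun {γ : ℝ} (hγ : 0 ≤ γ) (k i : ℕ) {z : ℂ} (hz : z ∈ disc)
    {w : ℕ → ℂ} (hw : ∀ j, w j ∈ disc) (hlim : Tendsto (fun j => ‖w j‖) atTop (𝓝 1)) :
    Tendsto (fun j => iteratedDeriv i (testFun γ k (w j)) z) atTop (𝓝 0) := by
  refine squeeze_zero_norm (fun j => norm_iteratedDeriv_testFun_le hγ k i (hw j) hz) ?_
  have h1 : Tendsto (fun j => (1 - ‖w j‖ ^ 2) ^ (γ + 1)) atTop (𝓝 ((1 - 1 ^ 2) ^ (γ + 1))) :=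
    ((hlim.pow 2).const_sub 1).rpow_const (Or.inr (by linarith))
  have h2 := (h1.const_mul ((i.factorial * 2 ^ i * 3 ^ (2 * γ) : ℝ))).mul_const
    ((1 - ‖z‖) ^ (-(2 * γ) - i))
  have h3 : ((1 : ℝ) - 1 ^ 2) ^ (γ + 1) = 0 := by
    rw [one_pow, sub_self, Real.zero_rpow (by linarith)]
  rwa [h3, mul_zero, zero_mul] at h2

/-! ### Lower bound for the essential norm -/

/-- The operator quasi-norm `‖T - L‖`, taken over the unit ball of `Q_K(p,q)`; its infimum over compact
`L` is the essential norm of `T`. -/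
def opDist {p q : ℝ} {K : ℝ≥0 → ℝ≥0} {hp : 0 < p} {m : ℝ → ℝ} (T : (ℂ → ℂ) → (ℂ → ℂ))
    (L : QK p q K hp →ₗ[ℂ] Bloch m) : ℝ≥0∞ :=
  ⨆ (f : QK p q K hp) (_ : qkNorm p q K f ≤ 1), blochNorm m (T f - (L f : ℂ → ℂ))

/-- Homogeneity extends the bound by `opDist` from the unit ball. The hypothesis `0 < b` avoids the
product `0 * ∞`. -/
theorem blochNorm_sub_le_opDist {p q : ℝ} {K : ℝ≥0 → ℝ≥0} {hp : 0 < p} {m : ℝ → ℝ} {n : ℕ}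
    {ψ₁ ψ₂ φ : ℂ → ℂ} (hφ : MapsTo φ disc disc)
    (hT : IsBoundedOp p q K hp m (steSha n ψ₁ ψ₂ φ)) (L : QK p q K hp →ₗ[ℂ] Bloch m)
    {b : ℝ≥0} (hb : 0 < b) (f : QK p q K hp) (hf : qkNorm p q K f ≤ b) :
    blochNorm m (steSha n ψ₁ ψ₂ φ f - (L f : ℂ → ℂ)) ≤ b * opDist (steSha n ψ₁ ψ₂ φ) L := by
  have hb0 : ((b : ℝ) : ℂ) ≠ 0 := by exact_mod_cast hb.ne'
  set g : QK p q K hp := ((b : ℝ) : ℂ)⁻¹ • f with hg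
  have hfg : f = ((b : ℝ) : ℂ) • g := by rw [hg, smul_smul, mul_inv_cancel₀ hb0, one_smul]
  have hbe : ‖((b : ℝ) : ℂ)‖ₑ = b := by
    rw [← ofReal_norm, Complex.norm_real, Real.norm_of_nonneg b.coe_nonneg, ENNReal.ofReal_coe_nnreal]
  have hg1 : qkNorm p q K g ≤ 1 := by
    have h1 : qkNorm p q K f = b * qkNorm p q K g := by
      conv_lhs => rw [hfg]
      rw [Submodule.coe_smul, qkNorm_smul hp q K g.2.1, hbe]
    rw [h1] at hf
    refine (ENNReal.mul_le_mul_iff_right (a := (b : ℝ≥0∞)) (by exact_mod_cast hb.ne') (by simp)).1 ?_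
    rwa [mul_one]
  have h2 : steSha n ψ₁ ψ₂ φ f - (L f : ℂ → ℂ) =
      ((b : ℝ) : ℂ) • (steSha n ψ₁ ψ₂ φ g - (L g : ℂ → ℂ)) := by
    rw [smul_sub, ← steSha_smul hφ g.2.1, ← Submodule.coe_smul, ← Submodule.coe_smul,
      ← map_smul, ← hfg]
  rw [h2]
  refine (blochNorm_smul_le m (HolDisc.sub_mem (hT.mem_bloch g.2).1 (L g).2.1) _).trans ?_
  rw [hbe]
  exact mul_le_mul_right (le_iSup₂ (f := fun (f : QK p q K hp) (_ : qkNorm p q K f ≤ 1) =>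
    blochNorm m (steSha n ψ₁ ψ₂ φ f - (L f : ℂ → ℂ))) g hg1) _

/-- The filter describing `|φ(z)| → 1` inside the disc. -/
def boundaryFilter (φ : ℂ → ℂ) : Filter ℂ := comap (fun z => ‖φ z‖) (𝓝 1) ⊓ 𝓟 disc

instance (φ : ℂ → ℂ) : (boundaryFilter φ).IsCountablyGenerated := by
  unfold boundaryFilter
  infer_instance

/-- Along a sequence `z_j` with `|φ(z_j)| → 1`, a compact `L` sends differences of the test functions
centred at the `φ(z_j)` to almost zero after passing to a subsequence, while the second member of
such a difference is negligible near the point `z_i` belonging to the first one. -/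
theorem limsup_testFun_le {p q : ℝ} {K : ℝ≥0 → ℝ≥0} {hp : 0 < p} (hq : -2 < q) {m : ℝ → ℝ} {n : ℕ}
    {ψ₁ ψ₂ φ : ℂ → ℂ} (h₁ : DifferentiableOn ℂ ψ₁ disc)
    (h₂ : DifferentiableOn ℂ ψ₂ disc) (h₃ : DifferentiableOn ℂ φ disc) (hφ : MapsTo φ disc disc)
    (hT : IsBoundedOp p q K hp m (steSha n ψ₁ ψ₂ φ)) (L : QK p q K hp →ₗ[ℂ] Bloch m)
    (hL : IsCompactOp L) {k : ℕ} {B κ : ℝ≥0}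
    (hB : ∀ w ∈ disc, qkNorm p q K (testFun ((q + 2) / p) k w) ≤ B)
    (hκ : ∀ f ∈ HolDisc, ∀ g ∈ HolDisc, ∀ B : ℝ≥0, qkNorm p q K f ≤ B → qkNorm p q K g ≤ B →
      qkNorm p q K (f - g) ≤ κ * B) :
    limsup (fun z => ENNReal.ofReal (m ‖z‖) *
      ‖deriv (steSha n ψ₁ ψ₂ φ (testFun ((q + 2) / p) k (φ z))) z‖ₑ) (boundaryFilter φ) ≤
      (κ * B + 1 : ℝ≥0) * opDist (steSha n ψ₁ ψ₂ φ) L := by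
  have hγ : 0 ≤ (q + 2) / p := div_nonneg (by linarith) hp.le
  by_contra! hcon
  obtain ⟨c, hc1, hc2⟩ := exists_between hcon
  have hfreq := (frequently_lt_of_lt_limsup (by isBoundedDefault) hc2).and_eventually
    (mem_inf_of_right (mem_principal_self disc) : ∀ᶠ z in boundaryFilter φ, z ∈ disc)
  obtain ⟨z, hz, hzp⟩ := exists_seq_forall_of_frequently hfreq
  have hzd : ∀ j, z j ∈ disc := fun j => (hzp j).2
  have hlim : Tendsto (fun j => ‖φ (z j)‖) atTop (𝓝 1) :=
      (tendsto_comap (f := fun z => ‖φ z‖) (x := 𝓝 1)).comp (tendsto_inf.1 hz).1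
  set F : ℕ → QK p q K hp := fun j => ⟨testFun ((q + 2) / p) k (φ (z j)),
    testFun_mem_HolDisc _ k (hφ (hzd j)), (hB _ (hφ (hzd j))).trans_lt (by simp)⟩ with hF
  obtain ⟨g, s, hs, hsg⟩ := hL B F fun j => hB _ (hφ (hzd j))
  obtain ⟨ε, hε, hεc⟩ := ENNReal.lt_iff_exists_add_pos_lt.1 hc1
  have hε2 : (0 : ℝ≥0∞) < (ε / 2 : ℝ≥0) := by exact_mod_cast half_pos hε
  have hev := hsg.eventually (gt_mem_nhds hε2)
  obtain ⟨i, hi⟩ := hev.exists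
  set x := z (s i) with hx
  have hxd : x ∈ disc := hzd _
  have hbound : ∀ᶠ j in atTop, ENNReal.ofReal (m ‖x‖) * ‖deriv (steSha n ψ₁ ψ₂ φ (F (s i))) x‖ₑ ≤
      (κ * B + 1 : ℝ≥0) * opDist (steSha n ψ₁ ψ₂ φ) L + ε +
        ENNReal.ofReal (m ‖x‖) * ‖deriv (steSha n ψ₁ ψ₂ φ (F (s j))) x‖ₑ := by
    filter_upwards [hev] with j hj
    have hTi := (hT.mem_bloch (F (s i)).2).1
    have hTj := (hT.mem_bloch (F (s j)).2).1
    have hnorm : qkNorm p q K (F (s i) - F (s j) : QK p q K hp) ≤ (κ * B + 1 : ℝ≥0) := by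
      refine (hκ _ (F (s i)).2.1 _ (F (s j)).2.1 B (hB _ (hφ (hzd _))) (hB _ (hφ (hzd _)))).trans ?_
      exact_mod_cast (le_self_add : κ * B ≤ κ * B + 1)
    have hdist := blochNorm_sub_le_opDist hφ hT L (by positivity) _ hnorm
    have hLdiff : blochNorm m (L (F (s i) - F (s j)) : ℂ → ℂ) ≤ ε := by
      have h4 : (L (F (s i) - F (s j)) : ℂ → ℂ) =
          ((L (F (s i)) : ℂ → ℂ) - g) - ((L (F (s j)) : ℂ → ℂ) - g) := by
        rw [map_sub, Submodule.coe_sub, sub_sub_sub_cancel_right]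
      rw [h4]
      refine (blochNorm_sub_le m (HolDisc.sub_mem (L _).2.1 g.2.1)
        (HolDisc.sub_mem (L _).2.1 g.2.1)).trans ((add_le_add hi.le hj.le).trans ?_)
      rw [← ENNReal.coe_add, add_halves]
    have hTsub : steSha n ψ₁ ψ₂ φ ((F (s i) - F (s j) : QK p q K hp) : ℂ → ℂ) =
        steSha n ψ₁ ψ₂ φ (F (s i)) - steSha n ψ₁ ψ₂ φ (F (s j)) := by
      rw [Submodule.coe_sub, steSha_sub hφ (F (s i)).2.1 (F (s j)).2.1]
    have hTd : blochNorm m (steSha n ψ₁ ψ₂ φ (F (s i)) - steSha n ψ₁ ψ₂ φ (F (s j))) ≤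
        (κ * B + 1 : ℝ≥0) * opDist (steSha n ψ₁ ψ₂ φ) L + ε := by
      rw [hTsub] at hdist
      have h5 := blochNorm_add_le m (HolDisc.sub_mem (HolDisc.sub_mem hTi hTj)
        (L (F (s i) - F (s j))).2.1) (L (F (s i) - F (s j))).2.1
      rw [sub_add_cancel] at h5
      exact h5.trans (add_le_add hdist hLdiff)
    have h6 := (mul_enorm_deriv_le_blochNorm m _ hxd).trans hTd
    rw [deriv_sub (HolDisc.differentiableAt hTi hxd) (HolDisc.differentiableAt hTj hxd)] at h6
    have h7 : ‖deriv (steSha n ψ₁ ψ₂ φ (F (s i))) x‖ₑ ≤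
        ‖deriv (steSha n ψ₁ ψ₂ φ (F (s i))) x - deriv (steSha n ψ₁ ψ₂ φ (F (s j))) x‖ₑ +
          ‖deriv (steSha n ψ₁ ψ₂ φ (F (s j))) x‖ₑ := by
      simpa using enorm_add_le
        (deriv (steSha n ψ₁ ψ₂ φ (F (s i))) x - deriv (steSha n ψ₁ ψ₂ φ (F (s j))) x)
        (deriv (steSha n ψ₁ ψ₂ φ (F (s j))) x)
    refine (mul_le_mul_right h7 _).trans ?_
    rw [mul_add]
    exact add_le_add_left h6 _
  have hzero : Tendsto (fun j => deriv (steSha n ψ₁ ψ₂ φ (F (s j))) x) atTop (𝓝 0) := by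
    have hj : ∀ i, Tendsto (fun j => iteratedDeriv i (F (s j) : ℂ → ℂ) (φ x)) atTop (𝓝 0) :=
      fun i => (tendsto_iteratedDeriv_testFun hγ k i (hφ hxd) (fun j => hφ (hzd j)) hlim).comp
        hs.tendsto_atTop
    have h8 : ∀ j, deriv (steSha n ψ₁ ψ₂ φ (F (s j))) x = _ := fun j =>
      deriv_steSha n h₁ h₂ h₃ hφ (F (s j)).2.1 hxd
    simp only [h8]
    have h9 := (((hj n).const_mul (deriv ψ₁ x)).add
      ((hj (n + 1)).const_mul (ψ₁ x * deriv φ x + deriv ψ₂ x))).add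
      ((hj (n + 2)).const_mul (ψ₂ x * deriv φ x))
    simpa using h9
  have hzero' : Tendsto (fun j => (κ * B + 1 : ℝ≥0) * opDist (steSha n ψ₁ ψ₂ φ) L + ε +
        ENNReal.ofReal (m ‖x‖) * ‖deriv (steSha n ψ₁ ψ₂ φ (F (s j))) x‖ₑ) atTop
        (𝓝 ((κ * B + 1 : ℝ≥0) * opDist (steSha n ψ₁ ψ₂ φ) L + ε + 0)) := by
    refine tendsto_const_nhds.add ?_
    have h10 := ENNReal.Tendsto.const_mul (a := ENNReal.ofReal (m ‖x‖))
      ((continuous_enorm.tendsto (0 : ℂ)).comp hzero) (Or.inr ENNReal.ofReal_ne_top)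
    simpa using h10
  -- The index `i` stays fixed while `j → ∞`, which removes the contribution of `F (s j)`.
  have hfin := ge_of_tendsto hzero' hbound
  rw [add_zero] at hfin
  exact absurd ((hzp (s i)).1.trans_le hfin) (not_lt.2 hεc.le)

theorem norm_le_norm_add_add (a b c : ℂ) : ‖a‖ ≤ ‖a + b + c‖ + ‖b‖ + ‖c‖ := by
  have h1 : a = a + b + c - b - c := by ring
  calc ‖a‖ = ‖a + b + c - b - c‖ := by rw [← h1]
    _ ≤ ‖a + b + c - b‖ + ‖c‖ := norm_sub_le _ _
    _ ≤ _ := by gcongr; exact norm_sub_le _ _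

/-- The test functions with zeros of order `n + 2`, `n + 1` and `n` at `φ(z)` isolate successively the
coefficients of the derivatives of order `n + 2`, `n + 1` and `n` in `(T f)'(z)`. -/
theorem exists_coefficient_le (n : ℕ) {γ : ℝ} (hγ : 0 ≤ γ) :
    ∃ C : ℝ, 1 ≤ C ∧ ∀ (M : ℝ) (u₀ u₁ u₂ w : ℂ) (e : ℝ), 0 ≤ M → 0 ≤ e → w ∈ disc →
      (∀ k ∈ ({n, n + 1, n + 2} : Set ℕ), M * ‖u₀ * iteratedDeriv n (testFun γ k w) w +
        u₁ * iteratedDeriv (n + 1) (testFun γ k w) w +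
        u₂ * iteratedDeriv (n + 2) (testFun γ k w) w‖ ≤ e) →
      M * ‖u₀‖ / (1 - ‖w‖ ^ 2) ^ (γ + n - 1) ≤ C * e ∧
        M * ‖u₁‖ / (1 - ‖w‖ ^ 2) ^ (γ + n) ≤ C * e ∧
        M * ‖u₂‖ / (1 - ‖w‖ ^ 2) ^ (γ + n + 1) ≤ C * e := by
  obtain ⟨c₁, hc₁, hC₁⟩ := exists_norm_iteratedDeriv_testFun_self_le hγ (n + 1)
  obtain ⟨c₂, hc₂, hC₂⟩ := exists_norm_iteratedDeriv_testFun_self_le hγ (n + 2)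
  refine ⟨(1 + c₁) * (1 + c₂), by nlinarith [mul_nonneg hc₁ hc₂], ?_⟩
  intro M u₀ u₁ u₂ w e hM he hw h
  have hd := one_sub_norm_sq_pos hw
  set d := 1 - ‖w‖ ^ 2 with hd_def
  have e₀ : d ^ (1 - γ - n) = (d ^ (γ + n - 1))⁻¹ := by
    rw [← Real.rpow_neg hd.le]; congr 1; ring
  have e₁ : d ^ (1 - γ - (n + 1 : ℕ)) = (d ^ (γ + n))⁻¹ := by
    rw [← Real.rpow_neg hd.le]; congr 1; push_cast; ring
  have e₂ : d ^ (1 - γ - (n + 2 : ℕ)) = (d ^ (γ + n + 1))⁻¹ := by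
    rw [← Real.rpow_neg hd.le]; congr 1; push_cast; ring
  have hfac : ∀ k : ℕ, (1 : ℝ) ≤ k.factorial := fun k => by exact_mod_cast Nat.factorial_pos k
  have hlow : ∀ (k : ℕ) (x : ℝ), d ^ (1 - γ - k) = x⁻¹ → 0 < x → ∀ u : ℂ,
      M * ‖u‖ / x ≤ M * (‖u‖ * ‖iteratedDeriv k (testFun γ k w) w‖) := by
    intro k x hx hx0 u
    rw [(testFun_iteratedDeriv_self γ k hw).2, ← hd_def, hx, div_eq_mul_inv, mul_assoc]
    refine mul_le_mul_of_nonneg_left ?_ hM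
    refine mul_le_mul_of_nonneg_left ?_ (norm_nonneg _)
    exact le_mul_of_one_le_left (by positivity) (hfac k)
  have hx₀ : 0 < d ^ (γ + n - 1) := by positivity
  have hx₁ : 0 < d ^ (γ + n) := by positivity
  have hx₂ : 0 < d ^ (γ + n + 1) := by positivity
  have up₁ : ∀ k, M * (‖u₁‖ * ‖iteratedDeriv (n + 1) (testFun γ k w) w‖) ≤
      c₁ * (M * ‖u₁‖ / d ^ (γ + n)) := by
    intro k
    have h1 := hC₁ k w hw
    rw [← hd_def, e₁] at h1
    calc _ ≤ M * (‖u₁‖ * (c₁ * (d ^ (γ + n))⁻¹)) := by gcongr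
      _ = _ := by ring
  have up₂ : ∀ k, M * (‖u₂‖ * ‖iteratedDeriv (n + 2) (testFun γ k w) w‖) ≤
      c₂ * (M * ‖u₂‖ / d ^ (γ + n + 1)) := by
    intro k
    have h1 := hC₂ k w hw
    rw [← hd_def, e₂] at h1
    calc _ ≤ M * (‖u₂‖ * (c₂ * (d ^ (γ + n + 1))⁻¹)) := by gcongr
      _ = _ := by ring
  -- A zero of order `k` kills all derivatives of order below `k`, so the system is triangular.
  have X₂ : M * ‖u₂‖ / d ^ (γ + n + 1) ≤ e := by
    have h1 := h (n + 2) (by simp)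
    obtain ⟨hz, -⟩ := testFun_iteratedDeriv_self γ (n + 2) hw
    rw [hz n (by omega), hz (n + 1) (by omega), mul_zero, mul_zero, zero_add, zero_add,
      norm_mul] at h1
    exact (hlow (n + 2) _ e₂ hx₂ u₂).trans h1
  have X₁ : M * ‖u₁‖ / d ^ (γ + n) ≤ (1 + c₂) * e := by
    have h1 := h (n + 1) (by simp)
    obtain ⟨hz, -⟩ := testFun_iteratedDeriv_self γ (n + 1) hw
    rw [hz n (by omega), mul_zero] at h1
    have h2 := norm_le_norm_add_add (u₁ * iteratedDeriv (n + 1) (testFun γ (n + 1) w) w)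
      (u₂ * iteratedDeriv (n + 2) (testFun γ (n + 1) w) w) 0
    rw [zero_add] at h1
    rw [add_zero, norm_zero, add_zero, norm_mul, norm_mul] at h2
    have h3 := mul_le_mul_of_nonneg_left h2 hM
    have h4 := hlow (n + 1) _ e₁ hx₁ u₁
    have h5 := up₂ (n + 1)
    nlinarith [mul_le_mul_of_nonneg_left X₂ hc₂]
  have X₀ : M * ‖u₀‖ / d ^ (γ + n - 1) ≤ (1 + c₁) * (1 + c₂) * e := by
    have h1 := h n (by simp)
    have h2 := norm_le_norm_add_add (u₀ * iteratedDeriv n (testFun γ n w) w)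
      (u₁ * iteratedDeriv (n + 1) (testFun γ n w) w) (u₂ * iteratedDeriv (n + 2) (testFun γ n w) w)
    rw [norm_mul, norm_mul, norm_mul] at h2
    have h3 := mul_le_mul_of_nonneg_left h2 hM
    have h4 := hlow n _ e₀ hx₀ u₀
    have h5 := up₁ n
    have h6 := up₂ n
    nlinarith [mul_le_mul_of_nonneg_left X₂ hc₂, mul_le_mul_of_nonneg_left X₁ hc₁]
  refine ⟨X₀, X₁.trans ?_, X₂.trans ?_⟩
  · nlinarith [mul_nonneg hc₁ he, mul_nonneg (mul_nonneg hc₁ hc₂) he]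
  · nlinarith [mul_nonneg hc₁ he, mul_nonneg hc₂ he, mul_nonneg (mul_nonneg hc₁ hc₂) he]

/-- The essential norm is at least a multiple of the three limits superior. -/
theorem exists_maxA_le_essNorm (n : ℕ) {p q : ℝ} (hp : 0 < p) (hq : -2 < q) {K : ℝ≥0 → ℝ≥0}
    (hKcont : Continuous K) (hK : Admissible q K) :
    ∃ C : ℝ≥0, 0 < C ∧ ∀ m : ℝ → ℝ, IsNormal m → ∀ ψ₁ ψ₂ φ : ℂ → ℂ,
      DifferentiableOn ℂ ψ₁ disc → DifferentiableOn ℂ ψ₂ disc → DifferentiableOn ℂ φ disc →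
      MapsTo φ disc disc → IsBoundedOp p q K hp m (steSha n ψ₁ ψ₂ φ) →
      maxA n ((q + 2) / p) m ψ₁ ψ₂ φ ≤ C * essNorm p q K hp m (steSha n ψ₁ ψ₂ φ) := by
  have hγ : 0 ≤ (q + 2) / p := div_nonneg (by linarith) hp.le
  obtain ⟨κ, hκ⟩ := exists_qkNorm_sub_le hp q K
  choose B hB using exists_qkNorm_testFun_le hp hq hKcont hK
  obtain ⟨C, hC1, hC⟩ := exists_coefficient_le n hγ
  lift C to ℝ≥0 using by linarith
  have hCpos : 0 < C := by exact_mod_cast (lt_of_lt_of_le one_pos hC1)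
  set B' : ℝ≥0 := max (B n) (max (B (n + 1)) (B (n + 2))) with hB'
  have hBk : ∀ k ∈ ({n, n + 1, n + 2} : Set ℕ), B k ≤ B' := by
    rintro k (rfl | rfl | rfl) <;> simp [hB']
  refine ⟨C * (κ * B' + 1), by positivity, ?_⟩
  intro m hm ψ₁ ψ₂ φ h₁ h₂ h₃ hφ hT
  have hL : ∀ L : QK p q K hp →ₗ[ℂ] Bloch m, IsCompactOp L →
      maxA n ((q + 2) / p) m ψ₁ ψ₂ φ ≤
        (C * (κ * B' + 1) : ℝ≥0) * opDist (steSha n ψ₁ ψ₂ φ) L := by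
    intro L hLc
    have hlim : ∀ k ∈ ({n, n + 1, n + 2} : Set ℕ), limsup (fun z => ENNReal.ofReal (m ‖z‖) *
        ‖deriv (steSha n ψ₁ ψ₂ φ (testFun ((q + 2) / p) k (φ z))) z‖ₑ) (boundaryFilter φ) ≤
        (κ * B' + 1 : ℝ≥0) * opDist (steSha n ψ₁ ψ₂ φ) L := fun k hk =>
      limsup_testFun_le hq h₁ h₂ h₃ hφ hT L hLc
        (fun w hw => (hB k w hw).trans (by exact_mod_cast hBk k hk)) hκ
    rw [ENNReal.coe_mul, mul_assoc, mul_comm (C : ℝ≥0∞),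
      ← ENNReal.div_le_iff (by exact_mod_cast hCpos.ne') (by simp)]
    refine le_of_forall_gt_imp_ge_of_dense fun e he => ?_
    rw [ENNReal.div_le_iff (by exact_mod_cast hCpos.ne') (by simp), mul_comm]
    rcases eq_or_ne e ∞ with rfl | hetop
    · rw [ENNReal.mul_top (by exact_mod_cast hCpos.ne')]; exact le_top
    lift e to ℝ≥0 using hetop
    have hev : ∀ k ∈ ({n, n + 1, n + 2} : Set ℕ), ∀ᶠ z in boundaryFilter φ,
        ENNReal.ofReal (m ‖z‖) *
          ‖deriv (steSha n ψ₁ ψ₂ φ (testFun ((q + 2) / p) k (φ z))) z‖ₑ < e := fun k hk =>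
      eventually_lt_of_limsup_lt ((hlim k hk).trans_lt he)
    have hdisc : ∀ᶠ z in boundaryFilter φ, z ∈ disc := mem_inf_of_right (mem_principal_self disc)
    have hfin : ∀ᶠ z in boundaryFilter φ,
        m ‖z‖ * ‖deriv ψ₁ z‖ / (1 - ‖φ z‖ ^ 2) ^ ((q + 2) / p + n - 1) ≤ C * e ∧
        m ‖z‖ * ‖ψ₁ z * deriv φ z + deriv ψ₂ z‖ / (1 - ‖φ z‖ ^ 2) ^ ((q + 2) / p + n) ≤ C * e ∧
        m ‖z‖ * ‖ψ₂ z * deriv φ z‖ / (1 - ‖φ z‖ ^ 2) ^ ((q + 2) / p + n + 1) ≤ C * e := by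
      filter_upwards [hev n (by simp), hev (n + 1) (by simp), hev (n + 2) (by simp), hdisc]
        with z hz0 hz1 hz2 hz
      have hmz : 0 ≤ m ‖z‖ := (hm.2.1 _ ⟨norm_nonneg z, norm_lt_one_of_mem_disc hz⟩).le
      refine hC _ _ _ _ _ _ hmz e.2 (hφ hz) fun k hk => ?_
      rw [← deriv_steSha n h₁ h₂ h₃ hφ (testFun_mem_HolDisc _ k (hφ hz)) hz]
      have hzk : ENNReal.ofReal (m ‖z‖) *
          ‖deriv (steSha n ψ₁ ψ₂ φ (testFun ((q + 2) / p) k (φ z))) z‖ₑ < e := by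
        rcases hk with rfl | rfl | rfl
        exacts [hz0, hz1, hz2]
      rw [← ofReal_norm, ← ENNReal.ofReal_mul hmz] at hzk
      have := (ENNReal.ofReal_le_iff_le_toReal (by simp)).1 hzk.le
      simpa using this
    have hA : ∀ x : ℝ, x ≤ C * e → ENNReal.ofReal x ≤ (C : ℝ≥0∞) * e := by
      intro x hx
      refine (ENNReal.ofReal_le_ofReal hx).trans ?_
      rw [← NNReal.coe_mul, ENNReal.ofReal_coe_nnreal, ENNReal.coe_mul]
    refine max_le ?_ (max_le ?_ ?_) <;> refine limsup_le_of_le (by isBoundedDefault) ?_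
    · filter_upwards [hfin] with z hz using hA _ hz.1
    · filter_upwards [hfin] with z hz using hA _ hz.2.1
    · filter_upwards [hfin] with z hz using hA _ hz.2.2
  have hne : ((C * (κ * B' + 1) : ℝ≥0) : ℝ≥0∞) ≠ 0 := by
    have : 0 < C * (κ * B' + 1) := by positivity
    exact_mod_cast this.ne'
  rw [mul_comm, ← ENNReal.div_le_iff hne ENNReal.coe_ne_top]
  refine le_iInf₂ fun L hLc => ?_
  rw [ENNReal.div_le_iff hne ENNReal.coe_ne_top, mul_comm]
  exact hL L hLc

/-! ### Dilations and Taylor truncations -/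

/-- The monomial `z ^ k` on the disc, extended by zero. -/
def discMonomial (k : ℕ) : ℂ → ℂ := disc.indicator fun z => z ^ k

/-- The dilation `z ↦ f (r z)` on the disc, extended by zero. -/
def dilation (r : ℝ) (f : ℂ → ℂ) : ℂ → ℂ := disc.indicator fun z => f (r * z)

/-- The Taylor polynomial with `N` terms of `z ↦ f (r z)` at the origin, on the disc. -/
def taylorTrunc (r : ℝ) (N : ℕ) (f : ℂ → ℂ) : ℂ → ℂ :=
  ∑ k ∈ Finset.range N,
    ((r : ℂ) ^ k * ((k.factorial : ℂ)⁻¹ * iteratedDeriv k f 0)) • discMonomial k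

theorem discMonomial_mem_HolDisc (k : ℕ) : discMonomial k ∈ HolDisc :=
  indicator_mem_HolDisc (by fun_prop)

theorem iteratedDeriv_discMonomial (k i : ℕ) {z : ℂ} (hz : z ∈ disc) :
    iteratedDeriv i (discMonomial k) z = k.descFactorial i * z ^ (k - i) := by
  rw [discMonomial, iteratedDeriv_indicator hz, iteratedDeriv_pow]

theorem deriv_discMonomial (k : ℕ) {z : ℂ} (hz : z ∈ disc) :
    deriv (discMonomial k) z = k * z ^ (k - 1) := by
  rw [discMonomial, deriv_indicator hz]
  simp

theorem real_mul_mem_disc {r : ℝ} (hr : r ∈ Icc (0 : ℝ) 1) {z : ℂ} (hz : z ∈ disc) :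
    (r : ℂ) * z ∈ disc := by
  rw [mem_ball_zero_iff] at hz ⊢
  rw [norm_mul, Complex.norm_real, Real.norm_of_nonneg hr.1]
  nlinarith [norm_nonneg z, hr.1, hr.2]

theorem hasDerivAt_comp_real_mul {f : ℂ → ℂ} (hf : f ∈ HolDisc) {r : ℝ} (hr : r ∈ Icc (0 : ℝ) 1)
    {z : ℂ} (hz : z ∈ disc) :
    HasDerivAt (fun z => f (r * z)) (r * deriv f (r * z)) z := by
  have h1 := (HolDisc.differentiableAt hf (real_mul_mem_disc hr hz)).hasDerivAt
  have h2 : HasDerivAt (fun z : ℂ => (r : ℂ) * z) r z := by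
    simpa using (hasDerivAt_id z).const_mul (r : ℂ)
  rw [mul_comm (r : ℂ) (deriv f _)]
  exact h1.comp z h2

theorem dilation_mem_HolDisc {f : ℂ → ℂ} (hf : f ∈ HolDisc) {r : ℝ} (hr : r ∈ Icc (0 : ℝ) 1) :
    dilation r f ∈ HolDisc :=
  indicator_mem_HolDisc fun _ hz =>
    (hasDerivAt_comp_real_mul hf hr hz).differentiableAt.differentiableWithinAt

theorem deriv_dilation {f : ℂ → ℂ} (hf : f ∈ HolDisc) {r : ℝ} (hr : r ∈ Icc (0 : ℝ) 1)
    {z : ℂ} (hz : z ∈ disc) : deriv (dilation r f) z = r * deriv f (r * z) := by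
  rw [dilation, deriv_indicator hz]
  exact (hasDerivAt_comp_real_mul hf hr hz).deriv

theorem taylorTrunc_mem_HolDisc (r : ℝ) (N : ℕ) (f : ℂ → ℂ) : taylorTrunc r N f ∈ HolDisc :=
  HolDisc.sum_mem fun k _ => HolDisc.smul_mem _ (discMonomial_mem_HolDisc k)

theorem taylorTrunc_zero (r : ℝ) (N : ℕ) (f : ℂ → ℂ) : taylorTrunc r (N + 1) f 0 = f 0 := by
  rw [taylorTrunc, Finset.sum_range_succ']
  simp [discMonomial]

theorem deriv_taylorTrunc (r : ℝ) (N : ℕ) (f : ℂ → ℂ) {z : ℂ} (hz : z ∈ disc) :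
    deriv (taylorTrunc r (N + 1) f) z = r * ∑ k ∈ Finset.range N,
      ((k.factorial : ℂ)⁻¹ * ((r * z) ^ k * iteratedDeriv k (deriv f) 0)) := by
  have hd : ∀ k, DifferentiableAt ℂ (discMonomial k) z := fun k =>
    HolDisc.differentiableAt (discMonomial_mem_HolDisc k) hz
  rw [taylorTrunc, deriv_sum fun k _ => (hd k).const_smul _, Finset.sum_range_succ', Finset.mul_sum]
  simp only [deriv_const_smul _ (hd _), deriv_discMonomial _ hz, smul_eq_mul]
  rw [Nat.cast_zero, zero_mul, mul_zero, add_zero]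
  refine Finset.sum_congr rfl fun k _ => ?_
  rw [iteratedDeriv_succ', Nat.factorial_succ, Nat.add_sub_cancel]
  have h1 : (k.factorial : ℂ) ≠ 0 := by exact_mod_cast k.factorial_ne_zero
  have h2 : ((k : ℂ) + 1) ≠ 0 := by exact_mod_cast k.succ_ne_zero
  push_cast
  rw [mul_pow]
  field_simp
  ring

/-- Cauchy's estimate for the Taylor remainder. -/
theorem norm_taylor_remainder_le {g : ℂ → ℂ} (hg : DifferentiableOn ℂ g disc) {ρ A : ℝ} (hρ0 : 0 < ρ)
    (hρ1 : ρ < 1) (hA : ∀ z ∈ closedBall (0 : ℂ) ρ, ‖g z‖ ≤ A) {r : ℝ} (hr : r < ρ) {u : ℂ}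
    (hu : ‖u‖ ≤ r) (N : ℕ) :
    ‖g u - ∑ k ∈ Finset.range N, ((k.factorial : ℂ)⁻¹ * (u ^ k * iteratedDeriv k g 0))‖ ≤
      A * (r / ρ) ^ N / (1 - r / ρ) := by
  have hud : u ∈ disc := mem_ball_zero_iff.2 (by linarith)
  have hsum := Complex.hasSum_taylorSeries_on_ball hg hud
  simp only [sub_zero, smul_eq_mul] at hsum
  rw [norm_sub_rev]
  refine norm_sub_le_of_geometric_bound_of_hasSum ((div_lt_one hρ0).2 hr) (fun k => ?_) hsum N
  have hdc : DiffContOnCl ℂ g (ball 0 ρ) := DifferentiableOn.diffContOnCl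
    (hg.mono (closure_ball_subset_closedBall.trans (closedBall_subset_ball hρ1)))
  have hk := Complex.norm_iteratedDeriv_le_of_forall_mem_sphere_norm_le k hρ0 hdc
    fun z hz => hA z (sphere_subset_closedBall hz)
  have hA0 : 0 ≤ A := (norm_nonneg _).trans (hA 0 (mem_closedBall_self hρ0.le))
  have hf : (0 : ℝ) < k.factorial := by exact_mod_cast k.factorial_pos
  have hr0 : 0 ≤ r := (norm_nonneg u).trans hu
  rw [norm_mul, norm_mul, norm_inv, norm_pow, Complex.norm_natCast]
  calc (k.factorial : ℝ)⁻¹ * (‖u‖ ^ k * ‖iteratedDeriv k g 0‖)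
      ≤ (k.factorial : ℝ)⁻¹ * (r ^ k * (k.factorial * A / ρ ^ k)) := by gcongr
    _ = _ := by rw [div_pow]; field_simp

/-! ### Finite rank operators -/

/-- Finite sums `f ↦ ∑ c_k(f) v_k` are compact once the functionals `c_k` are bounded on quasi-norm
balls, by compactness of balls in `ℂ^N`. -/
theorem isCompactOp_finRank {p q : ℝ} {K : ℝ≥0 → ℝ≥0} {hp : 0 < p} {m : ℝ → ℝ} {N : ℕ}
    (c : Fin N → (QK p q K hp →ₗ[ℂ] ℂ)) (v : Fin N → Bloch m)
    (hc : ∀ M : ℝ≥0, ∃ R : ℝ, 0 ≤ R ∧ ∀ f : QK p q K hp, qkNorm p q K f ≤ M → ∀ k, ‖c k f‖ ≤ R) :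
    IsCompactOp (∑ k, (c k).smulRight (v k)) := by
  intro M f hf
  obtain ⟨R, hR0, hR⟩ := hc M
  have hmem : ∀ i, (fun k => c k (f i)) ∈ closedBall (0 : Fin N → ℂ) R := fun i => by
    rw [mem_closedBall_zero_iff, pi_norm_le_iff_of_nonneg hR0]
    exact hR (f i) (hf i)
  obtain ⟨a, -, s, hs, hlim⟩ := (isCompact_closedBall (0 : Fin N → ℂ) R).tendsto_subseq hmem
  refine ⟨∑ k, a k • v k, s, hs, ?_⟩
  have hle : ∀ i, blochNorm m (((∑ k, (c k).smulRight (v k)) (f (s i)) : Bloch m) -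
      (∑ k, a k • v k : Bloch m) : ℂ → ℂ) ≤
      ∑ k, ‖c k (f (s i)) - a k‖ₑ * blochNorm m (v k) := by
    intro i
    have h1 : (((∑ k, (c k).smulRight (v k)) (f (s i)) : Bloch m) -
      (∑ k, a k • v k : Bloch m) : ℂ → ℂ) = ∑ k, (c k (f (s i)) - a k) • (v k : ℂ → ℂ) := by
      rw [← Submodule.coe_sub, LinearMap.sum_apply, ← Finset.sum_sub_distrib]
      simp only [LinearMap.smulRight_apply, ← sub_smul]
      rw [Submodule.coe_sum]
      rfl
    rw [h1]
    refine (blochNorm_sum_le m _ _ fun k _ => HolDisc.smul_mem _ (v k).2.1).trans ?_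
    exact Finset.sum_le_sum fun k _ => blochNorm_smul_le m (v k).2.1 _
  refine tendsto_of_tendsto_of_tendsto_of_le_of_le tendsto_const_nhds ?_ (fun _ => zero_le) hle
  have hz : (0 : ℝ≥0∞) = ∑ k : Fin N, 0 * blochNorm m (v k) := by simp
  rw [hz]
  refine tendsto_finsetSum _ fun k _ => ENNReal.Tendsto.mul_const ?_ (Or.inr (v k).2.2.ne)
  have hk : Tendsto (fun i => c k (f (s i)) - a k) atTop (𝓝 (a k - a k)) :=
    ((tendsto_pi_nhds.1 hlim) k).sub_const (a k)
  rw [sub_self] at hk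
  simpa [Function.comp_def] using (continuous_enorm.tendsto (0 : ℂ)).comp hk

theorem discMonomial_mem_QK {p q : ℝ} {K : ℝ≥0 → ℝ≥0} (hp : 0 < p) (hq : -2 < q)
    (hKcont : Continuous K) (hK : Admissible q K) (k : ℕ) : discMonomial k ∈ QK p q K hp := by
  obtain ⟨C, hC⟩ := exists_qkNorm_le_of_deriv_bounded hp hq hKcont hK
  refine ⟨discMonomial_mem_HolDisc k, (hC _ k (by positivity) fun z hz => ?_).trans_lt
    (by finiteness)⟩
  rw [deriv_discMonomial k hz, norm_mul, norm_pow, Complex.norm_natCast]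
  exact mul_le_of_le_one_right (by positivity)
    (pow_le_one₀ (norm_nonneg z) (norm_lt_one_of_mem_disc hz).le)

/-- Composing `T` with a Taylor truncation gives a compact operator. -/
theorem essNorm_le_taylorTrunc {p q : ℝ} {K : ℝ≥0 → ℝ≥0} {hp : 0 < p} (hq : -2 < q)
    (hKcont : Continuous K) (hK : Admissible q K) {m : ℝ → ℝ} {n : ℕ}
    {ψ₁ ψ₂ φ : ℂ → ℂ} (hφ : MapsTo φ disc disc)
    (hT : IsBoundedOp p q K hp m (steSha n ψ₁ ψ₂ φ)) (r : ℝ) (N : ℕ)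
    (hc : ∀ M : ℝ≥0, ∃ R : ℝ, 0 ≤ R ∧ ∀ f : QK p q K hp, qkNorm p q K f ≤ M →
      ∀ k < N, ‖iteratedDeriv k (f : ℂ → ℂ) 0‖ ≤ R) :
    essNorm p q K hp m (steSha n ψ₁ ψ₂ φ) ≤
      ⨆ (f : QK p q K hp) (_ : qkNorm p q K f ≤ 1),
        blochNorm m (steSha n ψ₁ ψ₂ φ (f - taylorTrunc r N f)) := by
  have h0 : (0 : ℂ) ∈ disc := mem_ball_self one_pos
  let c : Fin N → (QK p q K hp →ₗ[ℂ] ℂ) := fun k =>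
    { toFun := fun f => (r : ℂ) ^ (k : ℕ) *
        (((k : ℕ).factorial : ℂ)⁻¹ * iteratedDeriv k (f : ℂ → ℂ) 0)
      map_add' := fun f g => by
        rw [Submodule.coe_add, iteratedDeriv_add (HolDisc.contDiffAt f.2.1 h0)
          (HolDisc.contDiffAt g.2.1 h0)]
        ring
      map_smul' := fun a f => by
        rw [Submodule.coe_smul, iteratedDeriv_const_smul_field, smul_eq_mul, smul_eq_mul,
          RingHom.id_apply]
        ring }
  let v : Fin N → Bloch m := fun k =>
    ⟨steSha n ψ₁ ψ₂ φ (discMonomial k), hT.mem_bloch (discMonomial_mem_QK hp hq hKcont hK k)⟩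
  have hcb : ∀ M : ℝ≥0, ∃ R : ℝ, 0 ≤ R ∧ ∀ f : QK p q K hp, qkNorm p q K f ≤ M →
      ∀ k, ‖c k f‖ ≤ R := by
    intro M
    obtain ⟨R, hR0, hR⟩ := hc M
    have hR' : ∀ k : Fin N, |r| ^ (k : ℕ) * (((k : ℕ).factorial : ℝ)⁻¹ * R) ≤
        ∑ j : Fin N, |r| ^ (j : ℕ) * (((j : ℕ).factorial : ℝ)⁻¹ * R) := fun k =>
      Finset.single_le_sum (f := fun j : Fin N => |r| ^ (j : ℕ) * (((j : ℕ).factorial : ℝ)⁻¹ * R))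
        (fun j _ => by positivity) (Finset.mem_univ k)
    refine ⟨_, Finset.sum_nonneg fun (j : Fin N) _ => by positivity, fun f hf k =>
      le_trans ?_ (hR' k)⟩
    change ‖(r : ℂ) ^ (k : ℕ) * (((k : ℕ).factorial : ℂ)⁻¹ * iteratedDeriv k (f : ℂ → ℂ) 0)‖ ≤ _
    rw [norm_mul, norm_mul, norm_pow, norm_inv, Complex.norm_real, Complex.norm_natCast,
      Real.norm_eq_abs]
    gcongr
    exact hR f hf k k.2
  refine (iInf₂_le _ (isCompactOp_finRank c v hcb)).trans (iSup₂_mono fun f _ => le_of_eq ?_)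
  congr 1
  rw [steSha_sub hφ f.2.1 (taylorTrunc_mem_HolDisc r N f)]
  congr 1
  have hlin : steSha n ψ₁ ψ₂ φ (taylorTrunc r N f) = ∑ k : Fin N, c k f • (v k : ℂ → ℂ) := by
    have h1 : taylorTrunc r N f = ((∑ k : Fin N, c k f •
        (⟨discMonomial k, discMonomial_mem_HolDisc k⟩ : HolDisc) : HolDisc) : ℂ → ℂ) := by
      rw [Submodule.coe_sum, taylorTrunc, Finset.sum_range]
      rfl
    rw [h1]
    change steShaLin n ψ₁ ψ₂ φ hφ _ = _
    rw [map_sum]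
    exact Finset.sum_congr rfl fun k _ => map_smul _ _ _
  rw [hlin, LinearMap.sum_apply, Submodule.coe_sum]
  rfl

/-! ### The error of a dilation -/

/-- The derivative of `f - f_r` obeys the growth bound of `f'`, uniformly in `r`, because
`(1 - ‖z‖) ^ (-γ)` increases with `‖z‖`. -/
theorem norm_deriv_sub_dilation_le {f : ℂ → ℂ} (hf : f ∈ HolDisc) {B γ : ℝ} (hγ : 0 < γ)
    (hB : 0 ≤ B) (h : ∀ z ∈ disc, ‖deriv f z‖ ≤ B * (1 - ‖z‖) ^ (-γ)) {r : ℝ}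
    (hr : r ∈ Ioo (0 : ℝ) 1) {z : ℂ} (hz : z ∈ disc) :
    ‖deriv (f - dilation r f) z‖ ≤ 2 * B * (1 - ‖z‖) ^ (-γ) := by
  have hr' : r ∈ Icc (0 : ℝ) 1 := ⟨hr.1.le, hr.2.le⟩
  have hz1 := norm_lt_one_of_mem_disc hz
  have hrz := real_mul_mem_disc hr' hz
  rw [deriv_sub (HolDisc.differentiableAt hf hz)
    (HolDisc.differentiableAt (dilation_mem_HolDisc hf hr') hz), deriv_dilation hf hr' hz]
  have h1 : ‖(r : ℂ) * deriv f (r * z)‖ ≤ B * (1 - ‖z‖) ^ (-γ) := by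
    rw [norm_mul, Complex.norm_real, Real.norm_of_nonneg hr.1.le]
    have h2 := h _ hrz
    have h3 : ‖(r : ℂ) * z‖ ≤ ‖z‖ := by
      rw [norm_mul, Complex.norm_real, Real.norm_of_nonneg hr.1.le]
      exact mul_le_of_le_one_left (norm_nonneg z) hr.2.le
    have h4 : (1 - ‖(r : ℂ) * z‖) ^ (-γ) ≤ (1 - ‖z‖) ^ (-γ) :=
      Real.rpow_le_rpow_of_nonpos (by linarith) (by linarith) (by linarith)
    calc r * ‖deriv f (r * z)‖ ≤ 1 * ‖deriv f (r * z)‖ := by gcongr; exact hr.2.le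
      _ = ‖deriv f (r * z)‖ := one_mul _
      _ ≤ _ := h2.trans (mul_le_mul_of_nonneg_left h4 hB)
  refine (norm_sub_le _ _).trans ((add_le_add (h z hz) h1).trans (le_of_eq ?_))
  ring

theorem one_sub_norm_rpow_neg_le {s : ℝ} (hs : 0 ≤ s) {z : ℂ} (hz : z ∈ disc) :
    (1 - ‖z‖) ^ (-s) ≤ 2 ^ s * (1 - ‖z‖ ^ 2) ^ (-s) := by
  have hz1 := norm_lt_one_of_mem_disc hz
  have h1 := one_sub_norm_sq_pos hz
  calc (1 - ‖z‖) ^ (-s) ≤ ((1 - ‖z‖ ^ 2) / 2) ^ (-s) :=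
        Real.rpow_le_rpow_of_nonpos (by positivity) (by nlinarith [norm_nonneg z]) (by linarith)
    _ = _ := by
      rw [Real.div_rpow h1.le (by norm_num), Real.rpow_neg (by norm_num : (0 : ℝ) ≤ 2), div_inv_eq_mul,
        mul_comm]

theorem exists_iteratedDeriv_succ_sub_dilation_le {γ : ℝ} (hγ : 0 < γ) (k : ℕ) :
    ∃ D : ℝ, 0 ≤ D ∧ ∀ f ∈ HolDisc, ∀ B : ℝ, 0 ≤ B →
      (∀ z ∈ disc, ‖deriv f z‖ ≤ B * (1 - ‖z‖) ^ (-γ)) → ∀ r ∈ Ioo (0 : ℝ) 1, ∀ z ∈ disc,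
        ‖iteratedDeriv (k + 1) (f - dilation r f) z‖ ≤ D * B * (1 - ‖z‖ ^ 2) ^ (-(γ + k)) := by
  refine ⟨k.factorial * 2 ^ k * 3 ^ |γ| * 2 * 2 ^ (γ + k), by positivity, ?_⟩
  intro f hf B hB h r hr z hz
  have h1 := iteratedDeriv_succ_bound
    (HolDisc.sub_mem hf (dilation_mem_HolDisc hf ⟨hr.1.le, hr.2.le⟩)) (by positivity)
    (fun z hz => norm_deriv_sub_dilation_le hf hγ hB h hr hz) k hz
  refine h1.trans ?_
  have h2 := one_sub_norm_rpow_neg_le (by positivity : 0 ≤ γ + k) hz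
  calc _ ≤ k.factorial * 2 ^ k * 3 ^ |γ| * (2 * B) * (2 ^ (γ + k) * (1 - ‖z‖ ^ 2) ^ (-(γ + k))) := by
        gcongr
    _ = _ := by ring

theorem rpow_sub_rpow_le_rpow_sub {a b s : ℝ} (hb : 0 ≤ b) (hab : b ≤ a) (hs : 0 ≤ s) (hs1 : s ≤ 1) :
    a ^ s - b ^ s ≤ (a - b) ^ s := by
  have h1 := NNReal.rpow_add_le_add_rpow ⟨a - b, sub_nonneg.2 hab⟩ ⟨b, hb⟩ hs hs1
  have h2 : (a - b + b) ^ s ≤ (a - b) ^ s + b ^ s := by exact_mod_cast h1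
  rw [sub_add_cancel] at h2
  linarith

/-- For `n = 0` and `γ < 1` functions with this growth are bounded, and the error is uniformly small on
the whole disc as `r → 1`; in all other cases it obeys the growth bound of order `n`. -/
theorem exists_iteratedDeriv_sub_dilation_le {γ : ℝ} (hγ : 0 < γ) (n : ℕ) (hn : n = 0 → γ ≠ 1) :
    ∃ (D : ℝ) (δ : ℝ → ℝ), 0 ≤ D ∧ Tendsto δ (𝓝[<] 1) (𝓝 0) ∧ ∀ f ∈ HolDisc, ∀ B : ℝ, 0 ≤ B →
      (∀ z ∈ disc, ‖deriv f z‖ ≤ B * (1 - ‖z‖) ^ (-γ)) → ∀ r ∈ Ioo (0 : ℝ) 1, ∀ z ∈ disc,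
        ‖iteratedDeriv n (f - dilation r f) z‖ ≤
          D * B * (1 - ‖z‖ ^ 2) ^ (-(γ + n - 1)) + B * δ r := by
  rcases n with _ | k
  · have hγ1 : γ ≠ 1 := hn rfl
    have key : ∀ f ∈ HolDisc, ∀ B : ℝ,
        (∀ z ∈ disc, ‖deriv f z‖ ≤ B * (1 - ‖z‖) ^ (-γ)) → ∀ r ∈ Ioo (0 : ℝ) 1, ∀ z ∈ disc,
        ‖iteratedDeriv 0 (f - dilation r f) z‖ ≤
          B * (((1 - r * ‖z‖) ^ (1 - γ) - (1 - ‖z‖) ^ (1 - γ)) / (1 - γ)) := by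
      intro f hf B h r hr z hz
      rw [iteratedDeriv_zero, Pi.sub_apply, dilation, indicator_of_mem hz]
      exact norm_sub_dilation_le hf hγ1 h ⟨hr.1.le, hr.2.le⟩ hz
    rcases lt_or_gt_of_ne hγ1 with hlt | hgt
    · refine ⟨0, fun r => (1 - r) ^ (1 - γ) / (1 - γ), le_rfl, ?_, ?_⟩
      · have h1 : Tendsto (fun r : ℝ => (1 - r) ^ (1 - γ) / (1 - γ)) (𝓝 1)
            (𝓝 ((1 - 1) ^ (1 - γ) / (1 - γ))) :=
          (((tendsto_id).const_sub 1).rpow_const (Or.inr (by linarith))).div_const _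
        rw [sub_self, Real.zero_rpow (by linarith), zero_div] at h1
        exact h1.mono_left nhdsWithin_le_nhds
      · intro f hf B hB h r hr z hz
        have hz1 := norm_lt_one_of_mem_disc hz
        refine (key f hf B h r hr z hz).trans ?_
        rw [zero_mul, zero_mul, zero_add]
        have hpos : 0 < 1 - γ := by linarith
        have hle : ‖z‖ * r ≤ ‖z‖ := mul_le_of_le_one_right (norm_nonneg z) hr.2.le
        have h2 := rpow_sub_rpow_le_rpow_sub (a := 1 - r * ‖z‖) (b := 1 - ‖z‖) (s := 1 - γ)
          (by linarith) (by linarith) hpos.le (by linarith)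
        have h3 : (1 - r * ‖z‖ - (1 - ‖z‖)) ^ (1 - γ) ≤ (1 - r) ^ (1 - γ) := by
          refine Real.rpow_le_rpow (by linarith) ?_ hpos.le
          nlinarith [hr.2]
        exact mul_le_mul_of_nonneg_left
          (div_le_div_of_nonneg_right (h2.trans h3) hpos.le) hB
    · refine ⟨2 ^ (γ - 1) / (γ - 1), fun _ => 0, ?_, tendsto_const_nhds, ?_⟩
      · have : 0 < γ - 1 := by linarith
        positivity
      · intro f hf B hB h r hr z hz
        have hz1 := norm_lt_one_of_mem_disc hz
        refine (key f hf B h r hr z hz).trans ?_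
        have hpos : 0 < γ - 1 := by linarith
        have hle : r * ‖z‖ ≤ ‖z‖ := mul_le_of_le_one_left (norm_nonneg z) hr.2.le
        have h2 : 0 ≤ (1 - r * ‖z‖) ^ (1 - γ) := Real.rpow_nonneg (by linarith) _
        have h3 := one_sub_norm_rpow_neg_le hpos.le hz
        rw [neg_sub] at h3
        have h4 : ((1 - r * ‖z‖) ^ (1 - γ) - (1 - ‖z‖) ^ (1 - γ)) / (1 - γ) ≤
            2 ^ (γ - 1) * (1 - ‖z‖ ^ 2) ^ (1 - γ) / (γ - 1) := by
          rw [← neg_div_neg_eq, neg_sub, neg_sub]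
          gcongr
          linarith
        have h5 : -(γ + (0 : ℕ) - 1) = 1 - γ := by push_cast; ring
        rw [h5, mul_zero, add_zero]
        calc _ ≤ B * (2 ^ (γ - 1) * (1 - ‖z‖ ^ 2) ^ (1 - γ) / (γ - 1)) := by gcongr
          _ = _ := by ring
  · obtain ⟨D, hD0, hD⟩ := exists_iteratedDeriv_succ_sub_dilation_le hγ k
    refine ⟨D, fun _ => 0, hD0, tendsto_const_nhds, fun f hf B hB h r hr z hz => ?_⟩
    have h5 : -(γ + (k + 1 : ℕ) - 1) = -(γ + k) := by push_cast; ring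
    rw [mul_zero, add_zero, h5]
    exact hD f hf B hB h r hr z hz

/-- On a smaller disc, `f - f_r` and its derivatives are of order `1 - r`, by the mean value inequality
along the segment from `r z` to `z` and Cauchy's estimate. -/
theorem exists_iteratedDeriv_sub_dilation_le_local {γ : ℝ} (i : ℕ) {ρ : ℝ} (hγ : 0 < γ)
    (hρ : ρ < 1) :
    ∃ E : ℝ, 0 ≤ E ∧ ∀ f ∈ HolDisc, ∀ B : ℝ, 0 ≤ B →
      (∀ z ∈ disc, ‖deriv f z‖ ≤ B * (1 - ‖z‖) ^ (-γ)) → ∀ r ∈ Ioo (0 : ℝ) 1, ∀ z : ℂ, ‖z‖ ≤ ρ →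
        ‖iteratedDeriv i (f - dilation r f) z‖ ≤ E * B * (1 - r) := by
  set ρ' := (1 + ρ) / 2 with hρ'
  have hρ'1 : 0 < 1 - ρ' := by linarith
  have hR : 0 < (1 - ρ) / 2 := by linarith
  refine ⟨i.factorial * (1 - ρ') ^ (-γ) / ((1 - ρ) / 2) ^ i, by positivity, ?_⟩
  intro f hf B hB h r hr z hz
  have hr' : r ∈ Icc (0 : ℝ) 1 := ⟨hr.1.le, hr.2.le⟩
  have hsub : closedBall (0 : ℂ) ρ' ⊆ disc := closedBall_subset_ball (by linarith)
  have hball : closedBall z ((1 - ρ) / 2) ⊆ closedBall (0 : ℂ) ρ' := by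
    refine closedBall_subset_closedBall' ?_
    rw [dist_zero_right]
    linarith
  have hbd : ∀ u ∈ closedBall (0 : ℂ) ρ',
      ‖(f - dilation r f) u‖ ≤ B * (1 - ρ') ^ (-γ) * (1 - r) := by
    intro u hu
    have hu1 := mem_closedBall_zero_iff.1 hu
    have hru : (r : ℂ) * u ∈ closedBall (0 : ℂ) ρ' := by
      rw [mem_closedBall_zero_iff, norm_mul, Complex.norm_real, Real.norm_of_nonneg hr.1.le]
      exact (mul_le_of_le_one_left (norm_nonneg u) hr.2.le).trans hu1
    rw [Pi.sub_apply, dilation, indicator_of_mem (hsub hu)]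
    refine ((convex_closedBall (0 : ℂ) ρ').norm_image_sub_le_of_norm_deriv_le
      (C := B * (1 - ρ') ^ (-γ)) (fun x hx => HolDisc.differentiableAt hf (hsub hx))
      (fun x hx => (h x (hsub hx)).trans ?_) hru hu).trans ?_
    · have hx1 := mem_closedBall_zero_iff.1 hx
      exact mul_le_mul_of_nonneg_left
        (Real.rpow_le_rpow_of_nonpos hρ'1 (by linarith) (by linarith)) hB
    · refine mul_le_mul_of_nonneg_left ?_ (by positivity)
      have h1 : u - r * u = ((1 - r : ℝ) : ℂ) * u := by push_cast; ring
      have h2 : 0 ≤ 1 - r := by linarith [hr.2]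
      rw [h1, norm_mul, Complex.norm_real, Real.norm_of_nonneg h2]
      exact mul_le_of_le_one_right h2 (by linarith)
  have hhol := HolDisc.sub_mem hf (dilation_mem_HolDisc hf hr')
  have hdc : DiffContOnCl ℂ (f - dilation r f) (ball z ((1 - ρ) / 2)) :=
    DifferentiableOn.diffContOnCl
      (hhol.1.mono (closure_ball_subset_closedBall.trans (hball.trans hsub)))
  refine (Complex.norm_iteratedDeriv_le_of_forall_mem_sphere_norm_le i hR hdc
    fun u hu => hbd u (hball (sphere_subset_closedBall hu))).trans (le_of_eq ?_)
  ring

/-- The Taylor polynomials of `f_r` converge geometrically in the derivative on the whole disc, as `f_r`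
is holomorphic on a disc of radius `1 / r > 1`. -/
theorem exists_norm_deriv_dilation_sub_taylorTrunc_le {γ r : ℝ} (hr : r ∈ Ioo (0 : ℝ) 1)
    (hγ : 0 < γ) :
    ∃ E θ : ℝ, 0 ≤ E ∧ 0 ≤ θ ∧ θ < 1 ∧ ∀ f ∈ HolDisc, ∀ B : ℝ, 0 ≤ B →
      (∀ z ∈ disc, ‖deriv f z‖ ≤ B * (1 - ‖z‖) ^ (-γ)) → ∀ N : ℕ, ∀ z ∈ disc,
        ‖deriv (dilation r f - taylorTrunc r (N + 1) f) z‖ ≤ E * B * θ ^ N := by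
  have hr' : r ∈ Icc (0 : ℝ) 1 := ⟨hr.1.le, hr.2.le⟩
  set ρ := (1 + r) / 2 with hρ
  have hρ0 : 0 < ρ := by linarith [hr.1]
  have hρ1 : ρ < 1 := by linarith [hr.2]
  have hrρ : r < ρ := by linarith [hr.2]
  have hθ : r / ρ < 1 := (div_lt_one hρ0).2 hrρ
  have h1θ : 0 < 1 - r / ρ := by linarith
  have h1ρ : 0 < 1 - ρ := by linarith
  refine ⟨(1 - ρ) ^ (-γ) / (1 - r / ρ), r / ρ, by positivity, div_nonneg hr.1.le hρ0.le, hθ, ?_⟩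
  intro f hf B hB h N z hz
  have hz1 := norm_lt_one_of_mem_disc hz
  have hA : ∀ u ∈ closedBall (0 : ℂ) ρ, ‖deriv f u‖ ≤ B * (1 - ρ) ^ (-γ) := by
    intro u hu
    have hu1 := mem_closedBall_zero_iff.1 hu
    exact (h u (closedBall_subset_ball hρ1 hu)).trans (mul_le_mul_of_nonneg_left
      (Real.rpow_le_rpow_of_nonpos h1ρ (by linarith) (by linarith)) hB)
  have hrz : ‖(r : ℂ) * z‖ ≤ r := by
    rw [norm_mul, Complex.norm_real, Real.norm_of_nonneg hr.1.le]
    exact mul_le_of_le_one_right hr.1.le hz1.le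
  have hrem := norm_taylor_remainder_le (hf.1.deriv isOpen_ball) hρ0 hρ1 hA hrρ hrz N
  rw [deriv_sub (HolDisc.differentiableAt (dilation_mem_HolDisc hf hr') hz)
    (HolDisc.differentiableAt (taylorTrunc_mem_HolDisc r (N + 1) f) hz), deriv_dilation hf hr' hz,
    deriv_taylorTrunc r N f hz, ← mul_sub, norm_mul, Complex.norm_real, Real.norm_of_nonneg hr.1.le]
  calc _ ≤ 1 * (B * (1 - ρ) ^ (-γ) * (r / ρ) ^ N / (1 - r / ρ)) :=
        mul_le_mul hr.2.le hrem (norm_nonneg _) zero_le_one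
    _ = _ := by ring

/-! ### Upper bound for the essential norm -/

/-- Boundedness of `T` on the monomials of degree `n`, `n + 1` and `n + 2` bounds the three
coefficients of `(T f)'`. -/
theorem exists_coefficient_bound {p q : ℝ} {K : ℝ≥0 → ℝ≥0} {hp : 0 < p} (hq : -2 < q)
    (hKcont : Continuous K) (hK : Admissible q K) {m : ℝ → ℝ} (hm : IsNormal m) {n : ℕ}
    {ψ₁ ψ₂ φ : ℂ → ℂ} (h₁ : DifferentiableOn ℂ ψ₁ disc)
    (h₂ : DifferentiableOn ℂ ψ₂ disc) (h₃ : DifferentiableOn ℂ φ disc) (hφ : MapsTo φ disc disc)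
    (hT : IsBoundedOp p q K hp m (steSha n ψ₁ ψ₂ φ)) :
    ∃ b : ℝ, 0 ≤ b ∧ ∀ z ∈ disc, m ‖z‖ * ‖deriv ψ₁ z‖ ≤ b ∧
      m ‖z‖ * ‖ψ₁ z * deriv φ z + deriv ψ₂ z‖ ≤ b ∧ m ‖z‖ * ‖ψ₂ z * deriv φ z‖ ≤ b := by
  have hbl : ∀ k, blochNorm m (steSha n ψ₁ ψ₂ φ (discMonomial k)) < ∞ := fun k =>
    (hT.mem_bloch (discMonomial_mem_QK hp hq hKcont hK k)).2
  set e : ℝ := (blochNorm m (steSha n ψ₁ ψ₂ φ (discMonomial n)) +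
    blochNorm m (steSha n ψ₁ ψ₂ φ (discMonomial (n + 1))) +
    blochNorm m (steSha n ψ₁ ψ₂ φ (discMonomial (n + 2)))).toReal with he
  have he0 : 0 ≤ e := ENNReal.toReal_nonneg
  have hbd : ∀ z ∈ disc, ∀ k ∈ ({n, n + 1, n + 2} : Set ℕ),
      m ‖z‖ * ‖deriv (steSha n ψ₁ ψ₂ φ (discMonomial k)) z‖ ≤ e := by
    intro z hz k hk
    have hmz : 0 ≤ m ‖z‖ := (hm.2.1 _ ⟨norm_nonneg z, norm_lt_one_of_mem_disc hz⟩).le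
    have h4 := mul_enorm_deriv_le_blochNorm m (steSha n ψ₁ ψ₂ φ (discMonomial k)) hz
    rw [← ofReal_norm, ← ENNReal.ofReal_mul hmz] at h4
    have h5 : blochNorm m (steSha n ψ₁ ψ₂ φ (discMonomial k)) ≤
        blochNorm m (steSha n ψ₁ ψ₂ φ (discMonomial n)) +
        blochNorm m (steSha n ψ₁ ψ₂ φ (discMonomial (n + 1))) +
        blochNorm m (steSha n ψ₁ ψ₂ φ (discMonomial (n + 2))) := by
      rcases hk with rfl | rfl | rfl
      · rw [add_assoc]; exact le_self_add
      · exact le_add_self.trans le_self_add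
      · exact le_add_self
    refine (ENNReal.ofReal_le_iff_le_toReal ?_).1 (h4.trans h5)
    exact (ENNReal.add_lt_top.2 ⟨ENNReal.add_lt_top.2 ⟨hbl _, hbl _⟩, hbl _⟩).ne
  set F : ℝ := ((n + 2).factorial : ℝ) with hF
  have hF1 : 1 ≤ F := by rw [hF]; exact_mod_cast Nat.factorial_pos (n + 2)
  have hmono : ∀ k ≤ n + 2, ∀ i, ∀ w ∈ disc, ‖iteratedDeriv i (discMonomial k) w‖ ≤ F := by
    intro k hk i w hw
    rw [iteratedDeriv_discMonomial k i hw, norm_mul, norm_pow, Complex.norm_natCast]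
    refine (mul_le_of_le_one_right (by positivity)
      (pow_le_one₀ (norm_nonneg w) (norm_lt_one_of_mem_disc hw).le)).trans ?_
    have h6 : k.descFactorial i ≤ (n + 2).factorial := by
      refine le_trans ?_ (Nat.factorial_le hk)
      rcases le_or_gt i k with hik | hik
      · rw [← Nat.factorial_mul_descFactorial hik]
        exact Nat.le_mul_of_pos_left _ (Nat.factorial_pos _)
      · rw [Nat.descFactorial_of_lt hik]
        exact Nat.zero_le _
    rw [hF]
    exact_mod_cast h6
  have htop : ∀ k, ∀ w ∈ disc, 1 ≤ ‖iteratedDeriv k (discMonomial k) w‖ := by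
    intro k w hw
    rw [iteratedDeriv_discMonomial k k hw, Nat.descFactorial_self, Nat.sub_self, pow_zero, mul_one,
      Complex.norm_natCast]
    exact_mod_cast Nat.factorial_pos k
  have hzero : ∀ k i, k < i → ∀ w ∈ disc, iteratedDeriv i (discMonomial k) w = 0 := by
    intro k i hki w hw
    rw [iteratedDeriv_discMonomial k i hw, Nat.descFactorial_of_lt hki, Nat.cast_zero, zero_mul]
  refine ⟨(1 + F) * (1 + F) * e, by positivity, fun z hz => ?_⟩
  have hmz : 0 ≤ m ‖z‖ := (hm.2.1 _ ⟨norm_nonneg z, norm_lt_one_of_mem_disc hz⟩).le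
  have hw := hφ hz
  have hform : ∀ k, deriv (steSha n ψ₁ ψ₂ φ (discMonomial k)) z = _ := fun k =>
    deriv_steSha n h₁ h₂ h₃ hφ (discMonomial_mem_HolDisc k) hz
  have hlow : ∀ (u : ℂ) (k : ℕ), m ‖z‖ * ‖u‖ ≤
      m ‖z‖ * (‖u‖ * ‖iteratedDeriv k (discMonomial k) (φ z)‖) := fun u k =>
    mul_le_mul_of_nonneg_left (le_mul_of_one_le_right (norm_nonneg u) (htop k _ hw)) hmz
  have hup : ∀ (u : ℂ) (k i : ℕ), k ≤ n + 2 →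
      m ‖z‖ * (‖u‖ * ‖iteratedDeriv i (discMonomial k) (φ z)‖) ≤ F * (m ‖z‖ * ‖u‖) := by
    intro u k i hk
    calc _ ≤ m ‖z‖ * (‖u‖ * F) := by gcongr; exact hmono k hk i _ hw
      _ = _ := by ring
  set u₀ := deriv ψ₁ z
  set u₁ := ψ₁ z * deriv φ z + deriv ψ₂ z
  set u₂ := ψ₂ z * deriv φ z
  -- The `i`-th derivative of `z ^ k` vanishes for `i > k` and is the constant `k!` for `i = k`, so the
  -- system for the three coefficients is triangular.
  have X₀ : m ‖z‖ * ‖u₀‖ ≤ e := by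
    have h7 := hbd z hz n (by simp)
    rw [hform, hzero n (n + 1) (by omega) _ hw, hzero n (n + 2) (by omega) _ hw, mul_zero, mul_zero,
      add_zero, add_zero, norm_mul] at h7
    exact (hlow u₀ n).trans h7
  have X₁ : m ‖z‖ * ‖u₁‖ ≤ (1 + F) * e := by
    have h7 := hbd z hz (n + 1) (by simp)
    rw [hform, hzero (n + 1) (n + 2) (by omega) _ hw, mul_zero, add_comm (u₀ * _)] at h7
    have h8 := norm_le_norm_add_add (u₁ * iteratedDeriv (n + 1) (discMonomial (n + 1)) (φ z))
      (u₀ * iteratedDeriv n (discMonomial (n + 1)) (φ z)) 0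
    rw [norm_zero, add_zero, norm_mul, norm_mul u₀] at h8
    have h9 := mul_le_mul_of_nonneg_left h8 hmz
    have h10 := hlow u₁ (n + 1)
    have h11 := hup u₀ (n + 1) n (by omega)
    nlinarith
  have X₂ : m ‖z‖ * ‖u₂‖ ≤ (1 + F) * (1 + F) * e := by
    have h7 := hbd z hz (n + 2) (by simp)
    have hcomm : ∀ a b c : ℂ, a + b + c = c + a + b := fun a b c => by ring
    rw [hform, hcomm] at h7
    have h8 := norm_le_norm_add_add (u₂ * iteratedDeriv (n + 2) (discMonomial (n + 2)) (φ z))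
      (u₀ * iteratedDeriv n (discMonomial (n + 2)) (φ z))
      (u₁ * iteratedDeriv (n + 1) (discMonomial (n + 2)) (φ z))
    rw [norm_mul u₂, norm_mul u₀, norm_mul u₁] at h8
    have h9 := mul_le_mul_of_nonneg_left h8 hmz
    have h10 := hlow u₂ (n + 2)
    have h11 := hup u₀ (n + 2) n (by omega)
    have h12 := hup u₁ (n + 2) (n + 1) (by omega)
    nlinarith [mul_le_mul_of_nonneg_left X₁ (by positivity : 0 ≤ F),
      mul_le_mul_of_nonneg_left X₀ (by positivity : 0 ≤ F)]
  refine ⟨X₀.trans ?_, X₁.trans ?_, X₂⟩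
  · nlinarith [mul_nonneg (by positivity : 0 ≤ F) he0, mul_nonneg (by positivity : 0 ≤ F * F) he0]
  · nlinarith [mul_nonneg (by positivity : 0 ≤ F) he0, mul_nonneg (by positivity : 0 ≤ F * F) he0]

/-- Taylor coefficients at the origin are bounded on quasi-norm balls of `Q_K(p,q)`. -/
theorem exists_iteratedDeriv_zero_le {p q : ℝ} {hp : 0 < p} {K : ℝ≥0 → ℝ≥0} {G : ℝ} (hG0 : 0 < G)
    (hG : ∀ f ∈ HolDisc, ∀ N : ℝ, 0 ≤ N → qkNorm p q K f ≤ ENNReal.ofReal N →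
      ∀ z ∈ disc, ‖deriv f z‖ ≤ G * N * (1 - ‖z‖) ^ (-((q + 2) / p))) (N : ℕ) (M : ℝ≥0) :
    ∃ R : ℝ, 0 ≤ R ∧ ∀ f : QK p q K hp, qkNorm p q K f ≤ M →
      ∀ k < N, ‖iteratedDeriv k (f : ℂ → ℂ) 0‖ ≤ R := by
  have hnn : ∀ j ∈ Finset.range N,
      0 ≤ (j.factorial * 2 ^ j * 3 ^ |(q + 2) / p| * (G * M) : ℝ) := fun j _ => by positivity
  refine ⟨M + ∑ j ∈ Finset.range N, (j.factorial * 2 ^ j * 3 ^ |(q + 2) / p| * (G * M)),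
    add_nonneg M.coe_nonneg (Finset.sum_nonneg hnn), fun f hf k hk => ?_⟩
  rcases k with _ | j
  · rw [iteratedDeriv_zero]
    have h1 : ‖(f : ℂ → ℂ) 0‖ₑ ≤ M := le_self_add.trans hf
    have h2 : ‖(f : ℂ → ℂ) 0‖ ≤ M := by
      rw [← ofReal_norm] at h1
      simpa using (ENNReal.ofReal_le_iff_le_toReal (by simp)).1 h1
    linarith [Finset.sum_nonneg hnn]
  · have h1 := iteratedDeriv_succ_bound f.2.1 (by positivity)
      (hG f f.2.1 M M.coe_nonneg (by rwa [ENNReal.ofReal_coe_nnreal])) j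
      (mem_ball_self one_pos : (0 : ℂ) ∈ disc)
    rw [norm_zero, sub_zero, Real.one_rpow, mul_one] at h1
    have h2 := Finset.single_le_sum hnn (Finset.mem_range.2 (by omega : j < N))
    linarith [M.coe_nonneg]

theorem exists_radius_of_eventually_boundaryFilter {φ : ℂ → ℂ} (hφ : MapsTo φ disc disc)
    {P : ℂ → Prop} (h : ∀ᶠ z in boundaryFilter φ, P z) :
    ∃ ρ : ℝ, ρ < 1 ∧ ∀ z ∈ disc, ρ < ‖φ z‖ → P z := by
  rw [boundaryFilter, eventually_inf_principal, eventually_comap, Metric.eventually_nhds_iff] at h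
  obtain ⟨ε, hε, h⟩ := h
  refine ⟨1 - ε, by linarith, fun z hz hz1 => h (y := ‖φ z‖) ?_ z rfl hz⟩
  have := norm_lt_one_of_mem_disc (hφ hz)
  rw [Real.dist_eq, abs_sub_comm, abs_of_nonneg (by linarith)]
  linarith

theorem exists_radius_of_maxA_lt {n : ℕ} {γ : ℝ} {m : ℝ → ℝ} {ψ₁ ψ₂ φ : ℂ → ℂ}
    (hφ : MapsTo φ disc disc) {a : ℝ} (ha : 0 ≤ a) (h : maxA n γ m ψ₁ ψ₂ φ < ENNReal.ofReal a) :
    ∃ ρ : ℝ, ρ < 1 ∧ ∀ z ∈ disc, ρ < ‖φ z‖ →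
      m ‖z‖ * ‖deriv ψ₁ z‖ / (1 - ‖φ z‖ ^ 2) ^ (γ + n - 1) ≤ a ∧
      m ‖z‖ * ‖ψ₁ z * deriv φ z + deriv ψ₂ z‖ / (1 - ‖φ z‖ ^ 2) ^ (γ + n) ≤ a ∧
      m ‖z‖ * ‖ψ₂ z * deriv φ z‖ / (1 - ‖φ z‖ ^ 2) ^ (γ + n + 1) ≤ a := by
  obtain ⟨h0, h12⟩ := max_lt_iff.1 h
  obtain ⟨h1, h2⟩ := max_lt_iff.1 h12
  refine exists_radius_of_eventually_boundaryFilter hφ ?_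
  filter_upwards [eventually_lt_of_limsup_lt h0, eventually_lt_of_limsup_lt h1,
    eventually_lt_of_limsup_lt h2] with z hz0 hz1 hz2
  exact ⟨(ENNReal.ofReal_le_ofReal_iff ha).1 hz0.le, (ENNReal.ofReal_le_ofReal_iff ha).1 hz1.le,
    (ENNReal.ofReal_le_ofReal_iff ha).1 hz2.le⟩

/-- The values of `T` on the errors `f - f_r` of dilations: near the boundary (in `φ(z)`) these obey
the growth estimates, elsewhere they are uniformly small. -/
theorem blochNorm_steSha_le_of_bounds {m : ℝ → ℝ} (hm : IsNormal m) {n : ℕ} {γ : ℝ}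
    {ψ₁ ψ₂ φ : ℂ → ℂ} (h₁ : DifferentiableOn ℂ ψ₁ disc) (h₂ : DifferentiableOn ℂ ψ₂ disc)
    (h₃ : DifferentiableOn ℂ φ disc) (hφ : MapsTo φ disc disc)
    {b a ρ η D₀ D₁ D₂ s e₀ e₁ e₂ : ℝ} (hD₀ : 0 ≤ D₀) (hD₁ : 0 ≤ D₁) (hD₂ : 0 ≤ D₂) (ha : 0 ≤ a)
    (hb : ∀ z ∈ disc, m ‖z‖ * ‖deriv ψ₁ z‖ ≤ b ∧
      m ‖z‖ * ‖ψ₁ z * deriv φ z + deriv ψ₂ z‖ ≤ b ∧ m ‖z‖ * ‖ψ₂ z * deriv φ z‖ ≤ b)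
    (hA : ∀ z ∈ disc, ρ < ‖φ z‖ →
      m ‖z‖ * ‖deriv ψ₁ z‖ / (1 - ‖φ z‖ ^ 2) ^ (γ + n - 1) ≤ a ∧
      m ‖z‖ * ‖ψ₁ z * deriv φ z + deriv ψ₂ z‖ / (1 - ‖φ z‖ ^ 2) ^ (γ + n) ≤ a ∧
      m ‖z‖ * ‖ψ₂ z * deriv φ z‖ / (1 - ‖φ z‖ ^ 2) ^ (γ + n + 1) ≤ a)
    {h : ℂ → ℂ} (hh : h ∈ HolDisc)
    (g₀ : ∀ w ∈ disc, ‖iteratedDeriv n h w‖ ≤ D₀ * (1 - ‖w‖ ^ 2) ^ (-(γ + n - 1)) + s)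
    (g₁ : ∀ w ∈ disc, ‖iteratedDeriv (n + 1) h w‖ ≤ D₁ * (1 - ‖w‖ ^ 2) ^ (-(γ + n)))
    (g₂ : ∀ w ∈ disc, ‖iteratedDeriv (n + 2) h w‖ ≤ D₂ * (1 - ‖w‖ ^ 2) ^ (-(γ + n + 1)))
    (l₀ : ∀ w, ‖w‖ ≤ ρ → ‖iteratedDeriv n h w‖ ≤ e₀)
    (l₁ : ∀ w, ‖w‖ ≤ ρ → ‖iteratedDeriv (n + 1) h w‖ ≤ e₁)
    (l₂ : ∀ w, ‖w‖ ≤ ρ → ‖iteratedDeriv (n + 2) h w‖ ≤ e₂)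
    (he₀ : 0 ≤ e₀) (he₁ : 0 ≤ e₁)
    (hφ0 : ‖φ 0‖ ≤ ρ) (hs : b * |s| ≤ η) (he : b * (e₀ + e₁ + e₂) ≤ η)
    (h0 : ‖ψ₁ 0‖ * e₀ + ‖ψ₂ 0‖ * e₁ ≤ η) :
    blochNorm m (steSha n ψ₁ ψ₂ φ h) ≤ ENNReal.ofReal ((D₀ + D₁ + D₂) * a + 2 * η) := by
  have hd0 : (0 : ℂ) ∈ disc := mem_ball_self one_pos
  have hη : 0 ≤ η := le_trans (by positivity) h0
  have hzero : ‖steSha n ψ₁ ψ₂ φ h 0‖ ≤ η := by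
    rw [steSha, indicator_of_mem hd0]
    refine (norm_add_le _ _).trans (le_trans ?_ h0)
    rw [norm_mul, norm_mul]
    gcongr
    · exact l₀ _ hφ0
    · exact l₁ _ hφ0
  have hpt : ∀ z ∈ disc, m ‖z‖ * ‖deriv (steSha n ψ₁ ψ₂ φ h) z‖ ≤ (D₀ + D₁ + D₂) * a + η := by
    intro z hz
    have hmz : 0 ≤ m ‖z‖ := (hm.2.1 _ ⟨norm_nonneg z, norm_lt_one_of_mem_disc hz⟩).le
    have hw := hφ hz
    obtain ⟨b₀, b₁, b₂⟩ := hb z hz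
    rw [deriv_steSha n h₁ h₂ h₃ hφ hh hz]
    have htri : m ‖z‖ * ‖deriv ψ₁ z * iteratedDeriv n h (φ z) +
        (ψ₁ z * deriv φ z + deriv ψ₂ z) * iteratedDeriv (n + 1) h (φ z) +
        ψ₂ z * deriv φ z * iteratedDeriv (n + 2) h (φ z)‖ ≤
        m ‖z‖ * ‖deriv ψ₁ z‖ * ‖iteratedDeriv n h (φ z)‖ +
        m ‖z‖ * ‖ψ₁ z * deriv φ z + deriv ψ₂ z‖ * ‖iteratedDeriv (n + 1) h (φ z)‖ +
        m ‖z‖ * ‖ψ₂ z * deriv φ z‖ * ‖iteratedDeriv (n + 2) h (φ z)‖ := by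
      have := mul_le_mul_of_nonneg_left (norm_add₃_le
        (a := deriv ψ₁ z * iteratedDeriv n h (φ z))
        (b := (ψ₁ z * deriv φ z + deriv ψ₂ z) * iteratedDeriv (n + 1) h (φ z))
        (c := ψ₂ z * deriv φ z * iteratedDeriv (n + 2) h (φ z))) hmz
      rw [norm_mul, norm_mul (ψ₁ z * deriv φ z + deriv ψ₂ z), norm_mul (ψ₂ z * deriv φ z)] at this
      refine this.trans (le_of_eq ?_)
      ring
    refine htri.trans ?_
    set x₀ := m ‖z‖ * ‖deriv ψ₁ z‖ with hx₀
    set x₁ := m ‖z‖ * ‖ψ₁ z * deriv φ z + deriv ψ₂ z‖ with hx₁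
    set x₂ := m ‖z‖ * ‖ψ₂ z * deriv φ z‖ with hx₂
    have p₀ : 0 ≤ x₀ := by positivity
    have p₁ : 0 ≤ x₁ := by positivity
    have p₂ : 0 ≤ x₂ := by positivity
    rcases lt_or_ge ρ ‖φ z‖ with hρ | hρ
    · obtain ⟨a₀, a₁, a₂⟩ := hA z hz hρ
      have hd := one_sub_norm_sq_pos hw
      have k₀ := mul_le_mul_of_nonneg_left (g₀ _ hw) p₀
      have k₁ := mul_le_mul_of_nonneg_left (g₁ _ hw) p₁
      have k₂ := mul_le_mul_of_nonneg_left (g₂ _ hw) p₂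
      rw [Real.rpow_neg hd.le] at k₀ k₁ k₂
      have j₀ : x₀ * s ≤ η := calc
        x₀ * s ≤ x₀ * |s| := mul_le_mul_of_nonneg_left (le_abs_self s) p₀
        _ ≤ b * |s| := mul_le_mul_of_nonneg_right b₀ (abs_nonneg s)
        _ ≤ η := hs
      have i₀ := mul_le_mul_of_nonneg_left a₀ hD₀
      have i₁ := mul_le_mul_of_nonneg_left a₁ hD₁
      have i₂ := mul_le_mul_of_nonneg_left a₂ hD₂
      rw [div_eq_mul_inv] at i₀ i₁ i₂
      linarith
    · have k₀ := mul_le_mul b₀ (l₀ _ hρ) (norm_nonneg _) (p₀.trans b₀)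
      have k₁ := mul_le_mul b₁ (l₁ _ hρ) (norm_nonneg _) (p₁.trans b₁)
      have k₂ := mul_le_mul b₂ (l₂ _ hρ) (norm_nonneg _) (p₂.trans b₂)
      have : 0 ≤ (D₀ + D₁ + D₂) * a := by positivity
      linarith
  unfold blochNorm
  have hfin : (D₀ + D₁ + D₂) * a + 2 * η = η + ((D₀ + D₁ + D₂) * a + η) := by ring
  rw [hfin, ENNReal.ofReal_add hη (by positivity)]
  refine add_le_add ?_ (iSup₂_le fun z hz => ?_)
  · rw [← ofReal_norm]
    exact ENNReal.ofReal_le_ofReal hzero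
  · have hmz : 0 ≤ m ‖z‖ := (hm.2.1 _ ⟨norm_nonneg z, norm_lt_one_of_mem_disc hz⟩).le
    rw [← ofReal_norm, ← ENNReal.ofReal_mul hmz]
    exact ENNReal.ofReal_le_ofReal (hpt z hz)

/-- With `T (f - P) = T (f - f_r) - T (P - f_r)`, where `P` is the Taylor truncation, the first term is
estimated by `blochNorm_steSha_le_of_bounds` for `r` close to `1`, and then the second one by the
boundedness of `T` for large `N`. -/
theorem exists_essNorm_le_of_ne_zero (n : ℕ) {p q : ℝ} (hp : 0 < p) (hq : -2 < q) {K : ℝ≥0 → ℝ≥0}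
    (hKmono : Monotone K) (hKcont : Continuous K) (hK : Admissible q K) (hnp : n = 0 → p ≠ q + 2)
    {t : ℝ≥0} (ht : K t ≠ 0) :
    ∃ C : ℝ≥0, 0 < C ∧ ∀ m : ℝ → ℝ, IsNormal m → ∀ ψ₁ ψ₂ φ : ℂ → ℂ,
      DifferentiableOn ℂ ψ₁ disc → DifferentiableOn ℂ ψ₂ disc → DifferentiableOn ℂ φ disc →
      MapsTo φ disc disc → IsBoundedOp p q K hp m (steSha n ψ₁ ψ₂ φ) →
      essNorm p q K hp m (steSha n ψ₁ ψ₂ φ) ≤ C * maxA n ((q + 2) / p) m ψ₁ ψ₂ φ := by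
  obtain ⟨G, hG0, hG⟩ := exists_norm_deriv_le (q := q) hp hKmono ht
  have hcoef := exists_iteratedDeriv_zero_le (hp := hp) hG0 hG
  set γ := (q + 2) / p with hγ_def
  have hγ : 0 < γ := div_pos (by linarith) hp
  have hnγ : n = 0 → γ ≠ 1 := by
    intro hn h1
    rw [hγ_def, div_eq_one_iff_eq hp.ne'] at h1
    exact hnp hn h1.symm
  obtain ⟨D₀, δ, hD₀, hδ, hD₀'⟩ := exists_iteratedDeriv_sub_dilation_le hγ n hnγ
  obtain ⟨D₁, hD₁, hD₁'⟩ := exists_iteratedDeriv_succ_sub_dilation_le hγ n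
  obtain ⟨D₂, hD₂, hD₂'⟩ := exists_iteratedDeriv_succ_sub_dilation_le hγ (n + 1)
  obtain ⟨Q, hQ⟩ := exists_qkNorm_le_of_deriv_bounded hp hq hKcont hK
  set D := D₀ * G + D₁ * G + D₂ * G with hD
  have hD0 : 0 ≤ D := by positivity
  refine ⟨Real.toNNReal (D + 1), by simpa using by linarith, ?_⟩
  intro m hm ψ₁ ψ₂ φ h₁ h₂ h₃ hφ hT
  have hCof : ((Real.toNNReal (D + 1) : ℝ≥0) : ℝ≥0∞) = ENNReal.ofReal (D + 1) := rfl
  rw [hCof]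
  rcases eq_or_ne (maxA n γ m ψ₁ ψ₂ φ) ∞ with hAtop | hAtop
  · rw [hAtop, ENNReal.mul_top (by simp; linarith)]
    exact le_top
  set a := (maxA n γ m ψ₁ ψ₂ φ).toReal with ha_def
  have ha0 : 0 ≤ a := ENNReal.toReal_nonneg
  have haA : maxA n γ m ψ₁ ψ₂ φ = ENNReal.ofReal a := (ENNReal.ofReal_toReal hAtop).symm
  rw [haA, ← ENNReal.ofReal_mul (by linarith)]
  refine ENNReal.le_of_forall_pos_le_add fun ε hε _ => ?_
  -- The final bound is `D * (a + η) + 3 * η`: one `η` each from the value at `0`, from the errors that are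
  -- uniformly small, and from the Taylor tail.
  set η : ℝ := ε / (D + 3) with hη_def
  have hη : 0 < η := div_pos (by exact_mod_cast hε) (by linarith)
  obtain ⟨ρ₀, hρ₀, hA⟩ := exists_radius_of_maxA_lt hφ (a := a + η) (by positivity)
    (by rw [haA, ENNReal.ofReal_lt_ofReal_iff (by positivity)]; linarith)
  set ρ := max ρ₀ ‖φ 0‖ with hρ_def
  have hρ : ρ < 1 := max_lt hρ₀ (norm_lt_one_of_mem_disc (hφ (mem_ball_self one_pos)))
  obtain ⟨b, hb0, hb⟩ := exists_coefficient_bound hq hKcont hK hm h₁ h₂ h₃ hφ hT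
  obtain ⟨E₀, hE₀, hE₀'⟩ := exists_iteratedDeriv_sub_dilation_le_local n hγ hρ
  obtain ⟨E₁, hE₁, hE₁'⟩ := exists_iteratedDeriv_sub_dilation_le_local (n + 1) hγ hρ
  obtain ⟨E₂, hE₂, hE₂'⟩ := exists_iteratedDeriv_sub_dilation_le_local (n + 2) hγ hρ
  -- A radius `r` close to `1` makes every error that is not a growth term at most `η`.
  have hone : Tendsto (fun r : ℝ => 1 - r) (𝓝[<] 1) (𝓝 0) := by
    have : Tendsto (fun r : ℝ => 1 - r) (𝓝 1) (𝓝 (1 - 1)) := tendsto_id.const_sub 1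
    rw [sub_self] at this
    exact this.mono_left nhdsWithin_le_nhds
  have t₁ : Tendsto (fun r => b * |G * δ r|) (𝓝[<] 1) (𝓝 0) := by
    simpa using ((hδ.const_mul G).abs).const_mul b
  have t₂ : Tendsto (fun r => b * (E₀ * G * (1 - r) + E₁ * G * (1 - r) + E₂ * G * (1 - r)))
      (𝓝[<] 1) (𝓝 0) := by
    simpa using ((((hone.const_mul (E₀ * G)).add (hone.const_mul (E₁ * G))).add
      (hone.const_mul (E₂ * G))).const_mul b)
  have t₃ : Tendsto (fun r => ‖ψ₁ 0‖ * (E₀ * G * (1 - r)) + ‖ψ₂ 0‖ * (E₁ * G * (1 - r)))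
      (𝓝[<] 1) (𝓝 0) := by
    simpa using (((hone.const_mul (E₀ * G)).const_mul ‖ψ₁ 0‖).add
      ((hone.const_mul (E₁ * G)).const_mul ‖ψ₂ 0‖))
  obtain ⟨r, hr₁, hr₂, hr₃, hr⟩ := ((t₁.eventually (ge_mem_nhds hη)).and
    ((t₂.eventually (ge_mem_nhds hη)).and ((t₃.eventually (ge_mem_nhds hη)).and
      (Ioo_mem_nhdsLT (zero_lt_one (α := ℝ)))))).exists
  have hr' : r ∈ Icc (0 : ℝ) 1 := ⟨hr.1.le, hr.2.le⟩
  obtain ⟨E, θ, hE, hθ0, hθ1, hEθ⟩ := exists_norm_deriv_dilation_sub_taylorTrunc_le hr hγ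
  obtain ⟨M, hM⟩ := hT
  have t₄ : Tendsto (fun N : ℕ => (M : ℝ) * (E * G * θ ^ N * Q)) atTop (𝓝 0) := by
    have := ((tendsto_pow_atTop_nhds_zero_of_lt_one hθ0 hθ1).const_mul (E * G)).mul_const (Q : ℝ)
    simpa using this.const_mul (M : ℝ)
  obtain ⟨N, hN⟩ := (t₄.eventually (ge_mem_nhds hη)).exists
  refine (essNorm_le_taylorTrunc hq hKcont hK hφ ⟨M, hM⟩ r (N + 1) fun M => hcoef _ M).trans ?_
  refine iSup₂_le fun f hf => ?_
  have hgrow : ∀ z ∈ disc, ‖deriv (f : ℂ → ℂ) z‖ ≤ G * (1 - ‖z‖) ^ (-γ) := by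
    have := hG f f.2.1 1 zero_le_one (by simpa using hf)
    simpa using this
  have hdil := dilation_mem_HolDisc f.2.1 hr'
  have htr := taylorTrunc_mem_HolDisc r (N + 1) (f : ℂ → ℂ)
  have hsplit : (f : ℂ → ℂ) - taylorTrunc r (N + 1) f =
      (f - dilation r f) - (taylorTrunc r (N + 1) f - dilation r f) := by
    rw [sub_sub_sub_cancel_right]
  have htail : qkNorm p q K (taylorTrunc r (N + 1) f - dilation r f) ≤
      ENNReal.ofReal (E * G * θ ^ N * Q) := by
    refine (hQ _ (E * G * θ ^ N) (by positivity) fun z hz => ?_).trans (le_of_eq ?_)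
    · rw [← neg_sub, deriv.neg, norm_neg]
      exact hEθ f f.2.1 G hG0.le hgrow N z hz
    · have h0 : (taylorTrunc r (N + 1) f - dilation r f) 0 = 0 := by
        rw [Pi.sub_apply, taylorTrunc_zero, dilation,
          indicator_of_mem (mem_ball_self one_pos : (0 : ℂ) ∈ disc), mul_zero, sub_self]
      rw [h0, enorm_zero, zero_add, ENNReal.ofReal_mul (by positivity : 0 ≤ E * G * θ ^ N),
        ENNReal.ofReal_coe_nnreal]
  have htailQK : taylorTrunc r (N + 1) f - dilation r f ∈ QK p q K hp :=
    ⟨HolDisc.sub_mem htr hdil, htail.trans_lt ENNReal.ofReal_lt_top⟩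
  have hlow := hM _ htailQK
  have hdist : f - dilation r f ∈ HolDisc := HolDisc.sub_mem f.2.1 hdil
  have hTd : steSha n ψ₁ ψ₂ φ (f - taylorTrunc r (N + 1) f) ∈ HolDisc := by
    have h5 : taylorTrunc r (N + 1) f ∈ QK p q K hp := Submodule.sum_mem _ fun k _ =>
      Submodule.smul_mem _ _ (discMonomial_mem_QK hp hq hKcont hK k)
    exact (hM _ (Submodule.sub_mem _ f.2 h5)).1.1
  have hTdil : steSha n ψ₁ ψ₂ φ (f - dilation r f) ∈ HolDisc := by
    have h6 : (f : ℂ → ℂ) - dilation r f = (f - taylorTrunc r (N + 1) f) +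
        (taylorTrunc r (N + 1) f - dilation r f) := by rw [sub_add_sub_cancel]
    have h5 : taylorTrunc r (N + 1) f ∈ QK p q K hp := Submodule.sum_mem _ fun k _ =>
      Submodule.smul_mem _ _ (discMonomial_mem_QK hp hq hKcont hK k)
    rw [h6]
    exact (hM _ (Submodule.add_mem _ (Submodule.sub_mem _ f.2 h5) htailQK)).1.1
  rw [hsplit, steSha_sub hφ hdist (HolDisc.sub_mem htr hdil)]
  refine (blochNorm_sub_le m hTdil hlow.1.1).trans ?_
  have hmain : blochNorm m (steSha n ψ₁ ψ₂ φ (f - dilation r f)) ≤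
      ENNReal.ofReal (D * (a + η) + 2 * η) := by
    refine blochNorm_steSha_le_of_bounds (γ := γ) (ρ := ρ) hm h₁ h₂ h₃ hφ
      (mul_nonneg hD₀ hG0.le) (mul_nonneg hD₁ hG0.le) (mul_nonneg hD₂ hG0.le) (by positivity) hb
      (fun z hz hz1 => hA z hz ((le_max_left _ _).trans_lt hz1)) hdist
      (fun w hw => hD₀' f f.2.1 G hG0.le hgrow r hr w hw)
      (fun w hw => hD₁' f f.2.1 G hG0.le hgrow r hr w hw)
      (fun w hw => ?_)
      (fun w hw => hE₀' f f.2.1 G hG0.le hgrow r hr w hw)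
      (fun w hw => hE₁' f f.2.1 G hG0.le hgrow r hr w hw)
      (fun w hw => hE₂' f f.2.1 G hG0.le hgrow r hr w hw)
      ?_ ?_ (le_max_right _ _) hr₁ hr₂ hr₃
    · have h7 := hD₂' f f.2.1 G hG0.le hgrow r hr w hw
      have h8 : γ + (n + 1 : ℕ) = γ + n + 1 := by push_cast; ring
      rwa [h8] at h7
    all_goals
      have : 0 ≤ 1 - r := by linarith [hr.2]
      positivity
  have hsmall : blochNorm m (steSha n ψ₁ ψ₂ φ (taylorTrunc r (N + 1) f - dilation r f)) ≤
      ENNReal.ofReal η := by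
    refine hlow.2.trans ((mul_le_mul_right htail _).trans ?_)
    rw [← ENNReal.ofReal_coe_nnreal, ← ENNReal.ofReal_mul M.coe_nonneg]
    exact ENNReal.ofReal_le_ofReal hN
  refine (add_le_add hmain hsmall).trans ?_
  rw [← ENNReal.ofReal_add (by positivity) hη.le, ← ENNReal.ofReal_coe_nnreal (p := ε),
    ← ENNReal.ofReal_add (by positivity) ε.coe_nonneg]
  refine ENNReal.ofReal_le_ofReal ?_
  have h9 : (D + 3) * η = ε := by
    rw [hη_def]
    field_simp
  nlinarith

/-- If `K = 0`, the quasi-norm is `|f(0)|`, so that a bounded `T` has rank at most one. -/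
theorem essNorm_eq_zero_of_eq_zero (n : ℕ) {p q : ℝ} (hp : 0 < p) (hq : -2 < q) {K : ℝ≥0 → ℝ≥0}
    (hKcont : Continuous K) (hK : Admissible q K) (hK0 : ∀ t, K t = 0) {m : ℝ → ℝ}
    {ψ₁ ψ₂ φ : ℂ → ℂ} (hφ : MapsTo φ disc disc)
    (hT : IsBoundedOp p q K hp m (steSha n ψ₁ ψ₂ φ)) :
    essNorm p q K hp m (steSha n ψ₁ ψ₂ φ) = 0 := by
  have hnorm : ∀ f : ℂ → ℂ, qkNorm p q K f = ‖f 0‖ₑ := by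
    intro f
    simp [qkNorm, qkIntegral, hK0, hp]
  rw [← nonpos_iff_eq_zero]
  refine (essNorm_le_taylorTrunc hq hKcont hK hφ hT 1 1 fun M => ⟨M, M.coe_nonneg, ?_⟩).trans ?_
  · intro f hf k hk
    obtain rfl : k = 0 := by omega
    rw [iteratedDeriv_zero]
    rw [hnorm, ← ofReal_norm] at hf
    simpa using (ENNReal.ofReal_le_iff_le_toReal (by simp)).1 hf
  · refine iSup₂_le fun f _ => ?_
    obtain ⟨M, hM⟩ := hT
    have hmem : (f : ℂ → ℂ) - taylorTrunc 1 1 f ∈ QK p q K hp :=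
      ⟨HolDisc.sub_mem f.2.1 (taylorTrunc_mem_HolDisc 1 1 f), by rw [hnorm]; exact enorm_lt_top⟩
    refine (hM _ hmem).2.trans (le_of_eq ?_)
    have h0 := taylorTrunc_zero 1 0 (f : ℂ → ℂ)
    rw [zero_add] at h0
    rw [hnorm, Pi.sub_apply, h0, sub_self, enorm_zero, mul_zero]

theorem exists_essNorm_le_maxA (n : ℕ) {p q : ℝ} (hp : 0 < p) (hq : -2 < q) {K : ℝ≥0 → ℝ≥0}
    (hKmono : Monotone K) (hKcont : Continuous K) (hK : Admissible q K)
    (hnp : n = 0 → p ≠ q + 2) :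
    ∃ C : ℝ≥0, 0 < C ∧ ∀ m : ℝ → ℝ, IsNormal m → ∀ ψ₁ ψ₂ φ : ℂ → ℂ,
      DifferentiableOn ℂ ψ₁ disc → DifferentiableOn ℂ ψ₂ disc → DifferentiableOn ℂ φ disc →
      MapsTo φ disc disc → IsBoundedOp p q K hp m (steSha n ψ₁ ψ₂ φ) →
      essNorm p q K hp m (steSha n ψ₁ ψ₂ φ) ≤ C * maxA n ((q + 2) / p) m ψ₁ ψ₂ φ := by
  by_cases h : ∀ t, K t = 0
  · refine ⟨1, one_pos, fun m _ ψ₁ ψ₂ φ _ _ _ hφ hT => ?_⟩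
    rw [essNorm_eq_zero_of_eq_zero n hp hq hKcont hK h hφ hT]
    exact zero_le
  · push Not at h
    obtain ⟨t, ht⟩ := h
    exact exists_essNorm_le_of_ne_zero n hp hq hKmono hKcont hK hnp ht

end SteSha

end

theorem mainTheorem1 (n : ℕ) (p q : ℝ) (hp : 0 < p) (hq : -2 < q)
    (K : ℝ≥0 → ℝ≥0) (hKmono : Monotone K) (hKcont : Continuous K)
    (hK : SteSha.Admissible q K) (hnp : n = 0 → p ≠ q + 2) :
    ∃ C : ℝ≥0, 0 < C ∧
      ∀ m : ℝ → ℝ, SteSha.IsNormal m →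
      ∀ ψ₁ ψ₂ φ : ℂ → ℂ, DifferentiableOn ℂ ψ₁ SteSha.disc →
        DifferentiableOn ℂ ψ₂ SteSha.disc → DifferentiableOn ℂ φ SteSha.disc →
        MapsTo φ SteSha.disc SteSha.disc →
        SteSha.IsBoundedOp p q K hp m (SteSha.steSha n ψ₁ ψ₂ φ) →
        SteSha.essNorm p q K hp m (SteSha.steSha n ψ₁ ψ₂ φ) ≤
            C * SteSha.maxA n ((q + 2) / p) m ψ₁ ψ₂ φ ∧
          SteSha.maxA n ((q + 2) / p) m ψ₁ ψ₂ φ ≤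
            C * SteSha.essNorm p q K hp m (SteSha.steSha n ψ₁ ψ₂ φ) := by
  obtain ⟨C₁, hC₁, h₁⟩ := SteSha.exists_essNorm_le_maxA n hp hq hKmono hKcont hK hnp
  obtain ⟨C₂, hC₂, h₂⟩ := SteSha.exists_maxA_le_essNorm n hp hq hKcont hK
  refine ⟨max C₁ C₂, lt_max_of_lt_left hC₁, fun m hm ψ₁ ψ₂ φ d₁ d₂ d₃ hφ hT => ⟨?_, ?_⟩⟩
  · refine (h₁ m hm ψ₁ ψ₂ φ d₁ d₂ d₃ hφ hT).trans (mul_le_mul_left ?_ _)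
    exact_mod_cast le_max_left C₁ C₂
  · refine (h₂ m hm ψ₁ ψ₂ φ d₁ d₂ d₃ hφ hT).trans (mul_le_mul_left ?_ _)
    exact_mod_cast le_max_right C₁ C₂
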